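/- **Setting.** Trees are finite, rooted and ordered (plane), taken up to isomorphism; $\mathfrak T$ is the countable set of all of them and $|T|$ is the number of nodes of $T$. For $v\in T$, the fringe subtree $T_v$ consists of $v$ and all its descendants, and $n_{T'}(T):=|\{v\in T: T_v=T'\}|$. Let $\xi$ be a random variable with values in $\{0,1,2,\dots\}$, $\mathbb E\,\xi=1$ and $0<\sigma^2:=\operatorname{Var}\xi<\infty$. Let $\mathcal T$ be the Galton–Watson tree with offspring distribution $\xi$, that is, the family tree in which the numbers of children of all individuals are independent copies of $\xi$, and let $\mathcal T_n$ be $\mathcal T$ conditioned on $|\mathcal T|=n$, where only $n$ with $\mathbb P(|\mathcal T|=n)>0$ are considered (there are infinitely many such $n$). All limits are as $n\to\infty$ through these values. **Corollary.** The subtree counts $n_T(\mathcal T_n)$, $T\in\mathfrak T$, are asymptotically jointly normal. More precisely, let $\pi_T:=\mathbb P(\mathcal T=T)$, $$\gamma_{T,T}:=\pi_T-\bigl(2|T|-1+\sigma^{-2}\bigr)\pi_T^2,$$ and, for $T_1\ne T_2$, $$\gamma_{T_1,T_2}:=n_{T_2}(T_1)\,\pi_{T_1}+n_{T_1}(T_2)\,\pi_{T_2}-\bigl(|T_1|+|T_2|-1+\sigma^{-2}\bigr)\pi_{T_1}\pi_{T_2}.$$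 Then, for any trees $T,T_1,T_2\in\mathfrak T$, $$\mathbb E\,n_T(\mathcal T_n)=n\pi_T+o(\sqrt n),$$ $$\operatorname{Var}n_T(\mathcal T_n)=n\gamma_{T,T}+o(n),$$ $$\operatorname{Cov}\bigl(n_{T_1}(\mathcal T_n),n_{T_2}(\mathcal T_n)\bigr)=n\gamma_{T_1,T_2}+o(n).$$ Moreover, there exists a family $(Z_T)_{T\in\mathfrak T}$ of jointly normal random variables with $\mathbb E Z_T=0$ and $\operatorname{Cov}(Z_{T_1},Z_{T_2})=\gamma_{T_1,T_2}$ for all $T_1,T_2\in\mathfrak T$, such that $$\frac{n_T(\mathcal T_n)-n\pi_T}{\sqrt n}\;\xrightarrow{\;d\;}\;Z_T\qquad\text{jointly for all }T\in\mathfrak T,$$ that is, as random elements of the product space $\mathbb R^{\mathfrak T}$. -/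

import Mathlib

open MeasureTheory ProbabilityTheory Filter Topology Asymptotics

/-- Finite rooted ordered (plane) trees: a tree is a root together with the ordered list of the
branches at the children of the root. -/
inductive PlaneTree : Type
  | node (branches : List PlaneTree) : PlaneTree

namespace PlaneTree

/-- The number of nodes `|T|`. -/
def size : PlaneTree → ℕ
  | node ts => 1 + (ts.map size).sum

/-- The fringe subtrees `T_v`, one list entry for every node `v` of `T`, in depth-first order. -/
def fringe : PlaneTree → List PlaneTree
  | node ts => node ts :: (ts.map fringe).flatten

open Classical in
/-- `fringeCount S T` is `n_S(T) = |{v ∈ T : T_v = S}|`. -/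
noncomputable def fringeCount (S T : PlaneTree) : ℕ := (fringe T).count S

/-- Induction principle: a property that passes from the branches to the tree holds for all
trees. -/
theorem ind {p : PlaneTree → Prop} (h : ∀ ts, (∀ t ∈ ts, p t) → p (node ts)) : ∀ T, p T
  | node ts => h ts fun t _ => ind h t

/-- There is exactly one fringe subtree for every node. -/
theorem length_fringe (T : PlaneTree) : (fringe T).length = size T := by
  induction T using ind with
  | h ts ih =>
    rw [fringe, size, List.length_cons, List.length_flatten, List.map_map, add_comm]
    congr 2
    exact List.map_congr_left ih

/-- An injective code for plane trees. -/
def code : PlaneTree → ℕ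
  | node ts => Encodable.encode (ts.map code)

theorem code_injective : Function.Injective code := by
  intro S
  induction S using ind with
  | h ts ih =>
    rintro ⟨us⟩ h
    rw [code, code] at h
    replace h := Encodable.encode_injective h
    congr 1
    induction ts generalizing us with
    | nil => simpa [eq_comm] using h
    | cons t ts iht =>
      cases us with
      | nil => simp at h
      | cons u us =>
        simp only [List.map_cons, List.cons.injEq] at h
        rw [ih t (by simp) h.1, iht (fun x hx => ih x (by simp [hx])) us h.2]

instance : Countable PlaneTree := code_injective.countable

end PlaneTree

/-- Individuals are finite words of natural numbers: `[]` is the root and `u ++ [i]` is the `i`-th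
child of `u` (counted from `0`). If `c u` is the number of children of the individual `u`, then
`IsFamilyTree c T` says that the family tree of the root is (finite and equal to) `T`: the root has
`c []` children, and the `i`-th branch of `T` is the family tree of the `i`-th child. -/
inductive IsFamilyTree : (List ℕ → ℕ) → PlaneTree → Prop
  | node (c : List ℕ → ℕ) (ts : List PlaneTree) (h0 : c [] = ts.length)
      (h : ∀ i : Fin ts.length, IsFamilyTree (fun u => c (i.val :: u)) (ts.get i)) :
      IsFamilyTree c (PlaneTree.node ts)

theorem IsFamilyTree.unique {c : List ℕ → ℕ} {S T : PlaneTree} (hS : IsFamilyTree c S)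
    (hT : IsFamilyTree c T) : S = T := by
  induction hS generalizing T with
  | node c ts h0 _ ih =>
    cases hT with
    | node _ us k0 k =>
      congr 1
      refine List.ext_get (h0.symm.trans k0) fun i h1 h2 => ?_
      exact ih ⟨i, h1⟩ (k ⟨i, h2⟩)

open Classical in
/-- The family tree for the numbers of children `c`; `none` if it is infinite. -/
noncomputable def familyTree (c : List ℕ → ℕ) : Option PlaneTree :=
  if h : ∃ T, IsFamilyTree c T then some h.choose else none

theorem familyTree_eq_some_iff {c : List ℕ → ℕ} {T : PlaneTree} :
    familyTree c = some T ↔ IsFamilyTree c T := by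
  unfold familyTree
  split_ifs with h
  · rw [Option.some_inj]
    exact ⟨fun e => e ▸ h.choose_spec, fun hT => h.choose_spec.unique hT⟩
  · exact ⟨fun e => by simp at e, fun hT => (h ⟨T, hT⟩).elim⟩

section GaltonWatson

variable {Ω : Type*} [MeasurableSpace Ω]

/-- The Galton-Watson tree in which the individual `u` has `ξ u` children. -/
noncomputable def gwTree (ξ : List ℕ → Ω → ℕ) (ω : Ω) : Option PlaneTree :=
  familyTree fun u => ξ u ω

/-- `π_T`, the probability that the Galton-Watson tree equals `T`. -/
noncomputable def gwProb (P : Measure Ω) (ξ : List ℕ → Ω → ℕ) (T : PlaneTree) : ℝ :=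
  P.real {ω | gwTree ξ ω = some T}

/-- The event that the Galton-Watson tree has exactly `n` nodes. -/
def gwSizeEvent (ξ : List ℕ → Ω → ℕ) (n : ℕ) : Set Ω :=
  {ω | ∃ T, gwTree ξ ω = some T ∧ T.size = n}

/-- The sizes `n` that the Galton-Watson tree has with positive probability. -/
abbrev AdmissibleSize (P : Measure Ω) (ξ : List ℕ → Ω → ℕ) : Type :=
  {n : ℕ // P (gwSizeEvent ξ n) ≠ 0}

/-- `n → ∞` through the admissible sizes. -/
def admissibleAtTop (P : Measure Ω) (ξ : List ℕ → Ω → ℕ) : Filter (AdmissibleSize P ξ) :=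
  comap (fun n => n.val) atTop

/-- The conditional probability given that the Galton-Watson tree has `n` nodes. Under it,
`gwTree ξ` is the conditioned Galton-Watson tree of order `n`. -/
noncomputable def condGW (P : Measure Ω) (ξ : List ℕ → Ω → ℕ) (n : AdmissibleSize P ξ) :
    Measure Ω :=
  cond P (gwSizeEvent ξ n.val)

instance (P : Measure Ω) [IsFiniteMeasure P] (ξ : List ℕ → Ω → ℕ) (n : AdmissibleSize P ξ) :
    IsProbabilityMeasure (condGW P ξ n) :=
  cond_isProbabilityMeasure n.property

/-- The random number `n_T(𝒯)` of fringe subtrees equal to `T` in the Galton-Watson tree. The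
value for an infinite tree is `0`; it plays no role, since `condGW` is concentrated on finite
trees. -/
noncomputable def gwCount (ξ : List ℕ → Ω → ℕ) (T : PlaneTree) (ω : Ω) : ℝ :=
  match gwTree ξ ω with
  | some S => (PlaneTree.fringeCount T S : ℝ)
  | none => 0

open Classical in
/-- The asymptotic covariances `γ_{T₁,T₂}` for the tree probabilities `π` and the offspring
variance `σ2`. -/
noncomputable def gwGamma (π : PlaneTree → ℝ) (σ2 : ℝ) (T₁ T₂ : PlaneTree) : ℝ :=
  if T₁ = T₂ then
    π T₁ - (2 * (T₁.size : ℝ) - 1 + σ2⁻¹) * π T₁ ^ 2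
  else
    (PlaneTree.fringeCount T₂ T₁ : ℝ) * π T₁ + (PlaneTree.fringeCount T₁ T₂ : ℝ) * π T₂
      - ((T₁.size : ℝ) + (T₂.size : ℝ) - 1 + σ2⁻¹) * π T₁ * π T₂

end GaltonWatson

/-!
Reading the numbers of children of the nodes in depth-first order turns a tree into a word, and the
fringe subtrees equal to `S` into the occurrences of the word of `S` in it. By the cycle lemma, the
word of the conditioned tree of size `n` is, up to a rotation, a sequence of `n` independent
offspring variables given that their sum is `n - 1`. Rotations do not change the number of cyclic
occurrences of a pattern, so the subtree counts are jointly distributed as the cyclic pattern counts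
in an independent sequence given its total sum (`map_gwCount_condGW`).

A linear combination of centred pattern indicators is a bounded function of a window of bounded
length, and the sum of such a function over all windows is treated for general local functions.
Given the total sum it is asymptotically normal (`tendsto_integral_exp_wrappedSum_cond`): up to a
small proportion of windows it is a sum over independent blocks. For the sum over the blocks,
Fourier inversion over the total sum expresses the characteristic function on the event that the
total sum is `n - 1` as an integral of products of characteristic functions. It converges by the
central limit theorem for each fixed frequency, dominated by a Gaussian because a positive
proportion of the variables lies outside the blocks. The remaining windows are negligible by a bound
for fourth moments (`exists_setIntegral_sum_pow_four_le`), which passes from independent variables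
to the conditional law because leaving out half of the variables changes the density of the total
sum only by a constant factor (`exists_setIntegral_bridgeEvent_le`).

The limit variance is the variance of the unconditioned sum less the part explained by the linear
regression on the total sum. Since words of trees can overlap only by inclusion, the covariances of
the patterns of `S` and `T` are given by `fringeCount T S` and `fringeCount S T`, and a word of `S`
contributes `-1` to the centred total sum; this gives `gwGamma`
(`IsCriticalSequence.asymptotic_variance_sum_pattern`).

The bounds for the fourth moments also give the convergence of means and covariances
(`tendsto_moments_coord`), and tightness in the countable product. By Prokhorov's theorem there is a
limit law, and it is Gaussian since its finite linear combinations are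
(`exists_hasGaussianCharFun_tendsto`). This also shows that `gwGamma` is positive semidefinite, so
that the Gaussian family does not have to be constructed.
-/

/-! ### Depth-first words of plane trees -/

namespace PlaneTree

/-- The depth-first word of a tree: the list of the numbers of children of its nodes, in
depth-first order. -/
def word : PlaneTree → List ℕ
  | node ts => ts.length :: (ts.map word).flatten

/-- The depth-first word of an ordered forest, the concatenation of the words of its trees. -/
def forestWord (ts : List PlaneTree) : List ℕ := (ts.map word).flatten

lemma word_node (ts : List PlaneTree) : word (node ts) = ts.length :: forestWord ts := by
  rw [word, forestWord]

@[simp] lemma forestWord_nil : forestWord [] = [] := rfl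

@[simp] lemma forestWord_cons (t : PlaneTree) (ts : List PlaneTree) :
    forestWord (t :: ts) = word t ++ forestWord ts := rfl

lemma forestWord_append (us ts : List PlaneTree) :
    forestWord (us ++ ts) = forestWord us ++ forestWord ts := by
  simp [forestWord]

lemma forestWord_node_cons (us ts : List PlaneTree) :
    forestWord (node us :: ts) = us.length :: forestWord (us ++ ts) := by
  rw [forestWord_cons, word_node, forestWord_append, List.cons_append]

/-- Induction on forests along the depth-first order: deleting the root of the first tree leaves
its branches followed by the other trees. -/
theorem forest_ind {p : List PlaneTree → Prop} (h0 : p [])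
    (h : ∀ us ts, p (us ++ ts) → p (node us :: ts)) : ∀ ts, p ts := by
  have key : ∀ n ts, (forestWord ts).length = n → p ts := by
    intro n
    induction n with
    | zero =>
      rintro (_ | ⟨⟨us⟩, ts⟩) hn
      · exact h0
      · rw [forestWord_node_cons] at hn
        simp at hn
    | succ n ih =>
      rintro (_ | ⟨⟨us⟩, ts⟩) hn
      · exact h0
      · rw [forestWord_node_cons] at hn
        exact h us ts (ih _ (by simpa using hn))
  exact fun ts => key _ ts rfl

lemma length_word (T : PlaneTree) : (word T).length = size T := by
  induction T using ind with
  | h ts ih =>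
    rw [word_node, size, forestWord, List.length_cons, List.length_flatten, List.map_map, add_comm]
    congr 2
    exact List.map_congr_left ih

lemma size_pos (T : PlaneTree) : 0 < size T := by
  cases T; rw [size]; omega

/-- The forest with a given depth-first word, read from right to left: a letter `d` makes the first
`d` trees read so far into the branches of a new tree. -/
def parse : List ℕ → List PlaneTree
  | [] => []
  | d :: w => node ((parse w).take d) :: (parse w).drop d

lemma parse_word_append (T : PlaneTree) (w : List ℕ) : parse (word T ++ w) = T :: parse w := by
  induction T using ind generalizing w with
  | h ts ih =>
    have : parse (forestWord ts ++ w) = ts ++ parse w := by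
      induction ts with
      | nil => rfl
      | cons t ts iht =>
        rw [forestWord_cons, List.append_assoc, ih t (by simp),
          iht (fun x hx => ih x (by simp [hx])), List.cons_append]
    rw [word_node, List.cons_append, parse, this]
    simp

/-- Every nonempty suffix of the word of a forest is longer than the sum of its letters. -/
lemma sum_lt_length_of_suffix_forestWord (ts : List PlaneTree) :
    (forestWord ts).sum + ts.length = (forestWord ts).length ∧
      ∀ s, s <:+ forestWord ts → s ≠ [] → s.sum < s.length := by
  induction ts using forest_ind with
  | h0 => simp
  | h us ts ih =>
    have h1 : (forestWord (node us :: ts)).sum + (node us :: ts).length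
        = (forestWord (node us :: ts)).length := by
      have := ih.1
      rw [forestWord_node_cons]
      simp only [List.sum_cons, List.length_cons, List.length_append] at this ⊢
      omega
    refine ⟨h1, fun s hs hne => ?_⟩
    rw [forestWord_node_cons, List.suffix_cons_iff] at hs
    rcases hs with rfl | hs
    · rw [← forestWord_node_cons]
      simp only [List.length_cons] at h1
      omega
    · exact ih.2 s hs hne

/-- A list all of whose nonempty suffixes are longer than the sum of their letters is the word of a
forest: at each letter `d`, at least `d` trees have been read. -/
lemma forestWord_parse (w : List ℕ) (hw : ∀ s, s <:+ w → s ≠ [] → s.sum < s.length) :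
    forestWord (parse w) = w ∧ w.sum + (parse w).length = w.length := by
  induction w with
  | nil => simp [parse]
  | cons d w ih =>
    obtain ⟨h1, h2⟩ := ih fun s hs => hw s (hs.trans (List.suffix_cons d w))
    have h3 := hw (d :: w) List.suffix_rfl (by simp)
    simp only [List.sum_cons, List.length_cons] at h3
    have hd : d ≤ (parse w).length := by omega
    rw [parse, forestWord_node_cons, List.take_append_drop, h1]
    simp only [List.length_take, List.length_cons, List.sum_cons, List.length_drop]
    refine ⟨by rw [min_eq_left hd], by omega⟩

lemma sum_word (T : PlaneTree) : (word T).sum + 1 = size T := by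
  simpa [length_word] using (sum_lt_length_of_suffix_forestWord [T]).1

/-- A proper nonempty prefix of the word of a tree is at most as long as the sum of its letters. -/
lemma length_take_le_sum (T : PlaneTree) {k : ℕ} (hk : k < size T) :
    k ≤ ((word T).take k).sum := by
  have h := sum_lt_length_of_suffix_forestWord [T]
  simp only [forestWord_cons, forestWord_nil, List.append_nil] at h
  have h1 := h.2 ((word T).drop k) (List.drop_suffix _ _) (by simp [length_word, hk])
  have h2 : ((word T).take k).sum + ((word T).drop k).sum = (word T).sum := by
    rw [← List.sum_append, List.take_append_drop]
  have h3 := sum_word T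
  rw [List.length_drop, length_word] at h1
  omega

/-- The words of trees are the lists `w` all of whose nonempty suffixes are longer than the sum of
their letters, by exactly one for `w` itself. -/
lemma exists_word_eq (w : List ℕ) (hw : ∀ s, s <:+ w → s ≠ [] → s.sum < s.length)
    (hs : w.sum + 1 = w.length) : ∃ T, word T = w := by
  obtain ⟨h1, h2⟩ := forestWord_parse w hw
  obtain ⟨T, hT⟩ := List.length_eq_one_iff.1 (show (parse w).length = 1 by omega)
  exact ⟨T, by simpa [hT] using h1⟩

end PlaneTree

/-- The sequence `x` starts with the list `l`. -/
def StartsWith (x : ℕ → ℕ) (l : List ℕ) : Prop := ∀ k (hk : k < l.length), x k = l[k]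

lemma startsWith_cons {x : ℕ → ℕ} {d : ℕ} {l : List ℕ} :
    StartsWith x (d :: l) ↔ x 0 = d ∧ StartsWith (fun k => x (k + 1)) l := by
  constructor
  · intro h
    exact ⟨h 0 (by simp), fun k hk => h (k + 1) (by simpa using hk)⟩
  · rintro ⟨h0, h⟩ (_ | k) hk
    · exact h0
    · exact h k (by simpa using hk)

lemma StartsWith.eq_take {x : ℕ → ℕ} {l : List ℕ} (h : StartsWith x l) {n : ℕ}
    (hn : l.length ≤ n) : l = ((List.range n).map x).take l.length := by
  refine List.ext_getElem (by simp [hn]) fun k h1 h2 => ?_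
  simp [h k h1]

lemma StartsWith.sum_take {x : ℕ → ℕ} {l : List ℕ} (h : StartsWith x l) {n : ℕ}
    (hn : n ≤ l.length) : (l.take n).sum = ∑ k ∈ Finset.range n, x k := by
  have : l.take n = (List.range n).map x := by
    refine List.ext_getElem (by simp [hn]) fun k h1 h2 => ?_
    simp only [List.length_take, lt_inf_iff] at h1
    simp [h k h1.2]
  rw [this]
  rfl

namespace PlaneTree

/-- The set of words of trees is prefix-free. -/
lemma eq_of_startsWith {x : ℕ → ℕ} {S T : PlaneTree} (hS : StartsWith x (word S))
    (hT : StartsWith x (word T)) : S = T := by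
  set n := max (word S).length (word T).length
  set w := (List.range n).map x
  have h1 : w = word S ++ w.drop (word S).length := by
    conv_lhs => rw [← List.take_append_drop (word S).length w]
    rw [← hS.eq_take (le_max_left _ _)]
  have h2 : w = word T ++ w.drop (word T).length := by
    conv_lhs => rw [← List.take_append_drop (word T).length w]
    rw [← hT.eq_take (le_max_right _ _)]
  have h3 := congrArg parse (h1.symm.trans h2)
  rw [parse_word_append, parse_word_append] at h3
  exact (List.cons.inj h3).1

open Classical in
/-- In a sequence that starts with the word of `T`, the words of trees that start at the positions
of the nodes of `T` are the words of the fringe subtrees at these nodes. -/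
theorem card_startsWith_eq_fringeCount {x : ℕ → ℕ} (S T : PlaneTree)
    (h : StartsWith x (word T)) :
    ((Finset.range (size T)).filter fun i => StartsWith (fun k => x (i + k)) (word S)).card
      = fringeCount S T := by
  have key : ∀ (ts : List PlaneTree) (x : ℕ → ℕ), StartsWith x (forestWord ts) →
      ((Finset.range (forestWord ts).length).filter
        fun i => StartsWith (fun k => x (i + k)) (word S)).card
      = ((ts.map fringe).flatten).count S := by
    intro ts
    induction ts using forest_ind with
    | h0 => intro x _; rfl
    | h us ts ih =>
      intro x hx
      have hw : StartsWith x (word (node us)) := fun k hk => by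
        rw [forestWord_cons] at hx
        rw [hx k (by simp; omega), List.getElem_append_left hk]
      rw [forestWord_node_cons, startsWith_cons] at hx
      have := ih _ hx.2
      rw [forestWord_node_cons, List.length_cons, Finset.card_filter, Finset.sum_range_succ',
        List.map_cons, List.flatten_cons, fringe, List.cons_append, List.count_cons,
        ← List.flatten_append, ← List.map_append, ← this, Finset.card_filter]
      congr 1
      · refine Finset.sum_congr rfl fun i _ => ?_
        simp only [show ∀ k, i + 1 + k = i + k + 1 from fun k => by omega]
      · have : StartsWith x (word S) ↔ node us = S :=
          ⟨fun hS => eq_of_startsWith hw hS, fun e => e ▸ hw⟩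
        simp [this]
  have := key [T] x (by simpa using h)
  simpa [length_word, fringeCount] using this

/-- Words of trees do not overlap properly: if the words of `T` and `S` start at `0` and at
`i < |T|`, then the second lies inside the first. -/
lemma add_size_le_of_startsWith {x : ℕ → ℕ} {S T : PlaneTree} {i : ℕ}
    (hT : StartsWith x (word T)) (hi : i < size T)
    (hS : StartsWith (fun k => x (i + k)) (word S)) : i + size S ≤ size T := by
  by_contra! hlt
  have h1 : size T - i ≤ ((word S).take (size T - i)).sum := length_take_le_sum S (by omega)
  rw [hS.sum_take (by rw [length_word]; omega)] at h1
  have h2 := length_take_le_sum T hi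
  rw [hT.sum_take (by rw [length_word]; omega)] at h2
  have h3 := sum_word T
  rw [← List.take_length (l := word T), length_word, hT.sum_take (by rw [length_word]),
    show size T = i + (size T - i) by omega, Finset.sum_range_add] at h3
  omega

end PlaneTree

/-! ### The cycle lemma -/

/-- The words `w` of length `n`, indexed by `ZMod n`, all of whose final segments are longer than
the sum of their letters. -/
def IsLukasiewicz {n : ℕ} (w : ZMod n → ℕ) : Prop :=
  ∀ i < n, ∑ k ∈ Finset.Ico i n, w (k : ZMod n) < n - i

/-- The **cycle lemma**: a word of length `n` and sum `n - 1` has exactly one rotation all of whose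
final segments are longer than the sum of their letters. -/
theorem existsUnique_isLukasiewicz {n : ℕ} [NeZero n] (w : ZMod n → ℕ)
    (hw : ∑ x, w x + 1 = n) : ∃! j : ZMod n, IsLukasiewicz fun x => w (x + j) := by
  have hn : 0 < n := Nat.pos_of_ne_zero (NeZero.ne n)
  -- `h` is the walk with steps `1 - w k`; it climbs by one in every period
  let h : ℕ → ℤ := fun k => ∑ l ∈ Finset.range k, (1 - (w (l : ZMod n) : ℤ))
  have hadd : ∀ j i, h (j + i) = h j
      + ∑ l ∈ Finset.range i, (1 - (w ((j + l : ℕ) : ZMod n) : ℤ)) :=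
    fun j i => Finset.sum_range_add _ _ _
  have hsum : ∑ l ∈ Finset.range n, (w (l : ZMod n) : ℤ) = ∑ x, (w x : ℤ) := by
    refine Finset.sum_nbij (fun l => (l : ZMod n)) (by simp) ?_ ?_ (by simp)
    · intro a ha b hb hab
      simp only [Finset.coe_range, Set.mem_Iio] at ha hb
      have := (ZMod.natCast_eq_natCast_iff' a b n).1 hab
      rwa [Nat.mod_eq_of_lt ha, Nat.mod_eq_of_lt hb] at this
    · intro x _
      exact ⟨x.val, by simpa using x.val_lt, by simp⟩
  have hper : ∀ k, h (k + n) = h k + 1 := by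
    intro k
    have h0 : h n = 1 := by
      simp only [h, Finset.sum_sub_distrib, hsum]
      zify at hw
      simp only [Finset.sum_const, Finset.card_range, nsmul_eq_mul, mul_one]
      linarith
    rw [add_comm k n, hadd, h0, add_comm]
    simp [h]
  have hiff : ∀ j : ZMod n, (IsLukasiewicz fun x => w (x + j)) ↔
      ∀ i < n, h (j.val + i) ≤ h j.val := by
    intro j
    refine forall₂_congr fun i hi => ?_
    have e : ∑ k ∈ Finset.Ico i n, (w ((k : ZMod n) + j) : ℤ)
        = (n - i : ℤ) - (h (j.val + n) - h (j.val + i)) := by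
      rw [hadd, hadd, add_sub_add_left_eq_sub, ← Finset.sum_Ico_eq_sub _ hi.le,
        Finset.sum_sub_distrib, Finset.sum_const, Nat.card_Ico, nsmul_eq_mul, Nat.cast_sub hi.le]
      have : ∀ k : ℕ, ((j.val + k : ℕ) : ZMod n) = k + j := fun k => by
        push_cast
        rw [ZMod.natCast_zmod_val, add_comm]
      simp only [this]
      ring
    rw [hper] at e
    zify [hi.le]
    rw [e]
    constructor <;> intro <;> linarith
  simp only [hiff]
  -- the first maximum of the walk on a period: since `0 ≤ l < n`, maximizing `n * h l - l` is
  -- maximizing `h l` with ties broken in favour of the smaller `l`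
  obtain ⟨j, hj, hmax⟩ := Finset.exists_max_image (Finset.range n) (fun l => (n : ℤ) * h l - l)
    ⟨0, by simpa using hn⟩
  simp only [Finset.mem_range] at hj hmax
  have hjv : ((j : ZMod n)).val = j := ZMod.val_natCast_of_lt hj
  refine ⟨(j : ZMod n), ?_, ?_⟩
  · simp only [hjv]
    intro i hi
    by_cases hlt : j + i < n
    · have := hmax _ hlt
      push_cast at this
      by_contra! hc
      nlinarith
    · obtain ⟨l, hl⟩ : ∃ l, j + i = l + n := ⟨j + i - n, by omega⟩
      rw [hl, hper]
      have := hmax l (by omega)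
      have hlj : (l : ℤ) < j := by omega
      by_contra! hc
      nlinarith
  · intro j' hj'
    have hv := j'.val_lt
    have hval : j'.val = j := by
      rcases lt_trichotomy j'.val j with hlt | heq | hgt
      · have h1 := hj' (j - j'.val) (by omega)
        rw [show j'.val + (j - j'.val) = j by omega] at h1
        have := hmax j'.val hv
        have : (j'.val : ℤ) < j := by exact_mod_cast hlt
        nlinarith
      · exact heq
      · have h1 := hj' (j + n - j'.val) (by omega)
        rw [show j'.val + (j + n - j'.val) = j + n by omega, hper] at h1
        have := hmax j'.val hv
        have : (j'.val : ℤ) < j + n := by exact_mod_cast (by omega)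
        nlinarith
    rw [← hval, ZMod.natCast_zmod_val]

open PlaneTree in
open Classical in
/-- The number of cyclic occurrences of the word of the tree `S` in the word `w`. -/
noncomputable def cyclicCount {n : ℕ} [NeZero n] (S : PlaneTree) (w : ZMod n → ℕ) : ℕ :=
  (Finset.univ.filter fun x : ZMod n => StartsWith (fun k => w (x + k)) (word S)).card

lemma cyclicCount_rotate {n : ℕ} [NeZero n] (S : PlaneTree) (w : ZMod n → ℕ) (j : ZMod n) :
    cyclicCount S (fun x => w (x + j)) = cyclicCount S w := by
  classical
  refine Finset.card_bijective (fun x => x + j) (Equiv.addRight j).bijective fun x => ?_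
  simp only [Finset.mem_filter_univ, add_right_comm _ j]

/-- A product over `ZMod n` as a product over `{0, …, n - 1}`. -/
@[to_additive]
lemma prod_range_natCast_zmod {M : Type*} [CommMonoid M] {n : ℕ} [NeZero n] (f : ZMod n → M) :
    ∏ k ∈ Finset.range n, f (k : ZMod n) = ∏ x, f x := by
  refine Finset.prod_nbij (fun l => (l : ZMod n)) (by simp) ?_ ?_ (by simp)
  · intro a ha b hb hab
    simp only [Finset.coe_range, Set.mem_Iio] at ha hb
    have := (ZMod.natCast_eq_natCast_iff' a b n).1 hab
    rwa [Nat.mod_eq_of_lt ha, Nat.mod_eq_of_lt hb] at this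
  · intro x _
    exact ⟨x.val, by simpa using x.val_lt, by simp⟩

lemma StartsWith.prod_map {M : Type*} [CommMonoid M] {x : ℕ → ℕ} {l : List ℕ}
    (h : StartsWith x l) (q : ℕ → M) :
    ∏ k ∈ Finset.range l.length, q (x k) = (l.map q).prod := by
  have : l.map q = (List.range l.length).map fun k => q (x k) :=
    List.ext_getElem (by simp) fun k h1 h2 => by simp [h k (by simpa using h1)]
  rw [this]
  rfl

namespace PlaneTree

/-- The word of a tree with `n` nodes as a function on `ZMod n`. -/
def cyclicWord {n : ℕ} [NeZero n] (T : {T : PlaneTree // size T = n}) (x : ZMod n) : ℕ :=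
  (word T.1)[x.val]'(by rw [length_word, T.2]; exact x.val_lt)

lemma startsWith_cyclicWord {n : ℕ} [NeZero n] (T : {T : PlaneTree // size T = n}) :
    StartsWith (fun k => cyclicWord T (k : ZMod n)) (word T.1) := by
  intro k hk
  rw [length_word, T.2] at hk
  simp [cyclicWord, ZMod.val_natCast_of_lt hk]

lemma sum_cyclicWord {n : ℕ} [NeZero n] (T : {T : PlaneTree // size T = n}) :
    ∑ x, cyclicWord T x + 1 = n := by
  have h := (startsWith_cyclicWord T).sum_take (n := n) (by rw [length_word, T.2])
  rw [sum_range_natCast_zmod] at h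
  have h2 := sum_word T.1
  rw [← List.take_length (l := word T.1), length_word, T.2, h] at h2
  exact h2

lemma isLukasiewicz_cyclicWord {n : ℕ} [NeZero n] (T : {T : PlaneTree // size T = n}) :
    IsLukasiewicz (cyclicWord T) := by
  intro i hi
  have h1 := length_take_le_sum T.1 (T.2.symm ▸ hi : i < size T.1)
  rw [(startsWith_cyclicWord T).sum_take (by rw [length_word, T.2]; exact hi.le)] at h1
  have h2 := sum_cyclicWord T
  rw [← sum_range_natCast_zmod, ← Finset.sum_range_add_sum_Ico _ hi.le] at h2
  omega

lemma cyclicWord_injective {n : ℕ} [NeZero n] :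
    Function.Injective (cyclicWord : {T : PlaneTree // size T = n} → ZMod n → ℕ) := by
  intro S T h
  refine Subtype.ext (eq_of_startsWith (startsWith_cyclicWord S) ?_)
  rw [h]
  exact startsWith_cyclicWord T

lemma exists_cyclicWord_eq {n : ℕ} [NeZero n] (w : ZMod n → ℕ) (hL : IsLukasiewicz w)
    (hw : ∑ x, w x + 1 = n) : ∃ T, cyclicWord T = w := by
  set l : List ℕ := (List.range n).map fun k : ℕ => w (k : ZMod n) with hl
  have hlen : l.length = n := by simp [hl]
  have hdrop : ∀ i ≤ n, (l.drop i).sum = ∑ k ∈ Finset.Ico i n, w (k : ZMod n) := by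
    intro i hi
    have h1 : l.sum = ∑ k ∈ Finset.range n, w (k : ZMod n) := rfl
    have h2 : (l.take i).sum = ∑ k ∈ Finset.range i, w (k : ZMod n) := by
      rw [hl, ← List.map_take, List.take_range, min_eq_left hi]
      rfl
    have h3 := Finset.sum_range_add_sum_Ico (fun k : ℕ => w (k : ZMod n)) hi
    have h4 : (l.take i).sum + (l.drop i).sum = l.sum := by
      rw [← List.sum_append, List.take_append_drop]
    omega
  obtain ⟨T, hT⟩ := exists_word_eq l (fun s hs hne => by
    obtain ⟨k, rfl⟩ : ∃ k, s = l.drop k := ⟨_, List.suffix_iff_eq_drop.1 hs⟩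
    have hk : k < n := by
      by_contra! h
      exact hne (List.drop_eq_nil_of_le (by omega))
    rw [hdrop k hk.le, List.length_drop, hlen]
    exact hL k hk) (by
    have := hdrop 0 (Nat.zero_le _)
    rw [List.drop_zero, ← Finset.range_eq_Ico, sum_range_natCast_zmod] at this
    omega)
  refine ⟨⟨T, by rw [← length_word, hT, hlen]⟩, funext fun x => ?_⟩
  simp [cyclicWord, hT, hl]

/-- For the word of a tree, the cyclic occurrences of the word of `S` correspond to the fringe
subtrees equal to `S`. -/
lemma cyclicCount_cyclicWord {n : ℕ} [NeZero n] (S : PlaneTree)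
    (T : {T : PlaneTree // size T = n}) :
    cyclicCount S (cyclicWord T) = fringeCount S T.1 := by
  classical
  rw [← card_startsWith_eq_fringeCount S T.1 (startsWith_cyclicWord T), cyclicCount, T.2,
    Finset.card_filter, Finset.card_filter, ← sum_range_natCast_zmod]
  simp only [Nat.cast_add]

/-- The family tree is `T` if and only if finitely many individuals, one for each letter of the
word of `T`, have the number of children given by this letter. -/
lemma exists_addresses (T : PlaneTree) : ∃ l : List (List ℕ × ℕ),
    (l.map Prod.fst).Nodup ∧ l.map Prod.snd = word T ∧
      ∀ c, IsFamilyTree c T ↔ ∀ p ∈ l, c p.1 = p.2 := by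
  induction T using ind with
  | h ts ih =>
    have key : ∀ i₀ : ℕ, ∃ l : List (List ℕ × ℕ),
        (l.map Prod.fst).Nodup ∧ l.map Prod.snd = forestWord ts ∧
        (∀ p ∈ l, ∃ i u, p.1 = i :: u ∧ i₀ ≤ i) ∧
        ∀ c : List ℕ → ℕ, (∀ i : Fin ts.length, IsFamilyTree (fun u => c ((i₀ + i) :: u))
          (ts.get i)) ↔ ∀ p ∈ l, c p.1 = p.2 := by
      induction ts with
      | nil => exact fun i₀ => ⟨[], by simp⟩
      | cons t ts iht =>
        intro i₀
        obtain ⟨l₁, h1, h2, h3, h4⟩ := iht (fun x hx => ih x (by simp [hx])) (i₀ + 1)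
        obtain ⟨l₀, k1, k2, k4⟩ := ih t (by simp)
        refine ⟨l₀.map (fun p => (i₀ :: p.1, p.2)) ++ l₁, ?_, ?_, ?_, ?_⟩
        · rw [List.map_append, List.nodup_append]
          refine ⟨?_, h1, ?_⟩
          · rw [List.map_map]
            have : (Prod.fst ∘ fun p : List ℕ × ℕ => (i₀ :: p.1, p.2))
                = (List.cons i₀) ∘ Prod.fst := rfl
            rw [this, ← List.map_map]
            exact k1.map List.cons_injective
          · intro a ha b hb hab
            obtain ⟨p, hp, rfl⟩ := List.mem_map.1 ha
            obtain ⟨p', hp', rfl⟩ := List.mem_map.1 hp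
            obtain ⟨r, hr, rfl⟩ := List.mem_map.1 hb
            obtain ⟨i, u, hiu, hi⟩ := h3 r hr
            rw [hiu] at hab
            have := (List.cons.inj hab).1
            omega
        · rw [List.map_append, List.map_map, h2, forestWord_cons, ← k2]
          rfl
        · intro p hp
          rcases List.mem_append.1 hp with hp | hp
          · obtain ⟨p', hp', rfl⟩ := List.mem_map.1 hp
            exact ⟨i₀, p'.1, rfl, le_rfl⟩
          · obtain ⟨i, u, hiu, hi⟩ := h3 p hp
            exact ⟨i, u, hiu, by omega⟩
        · intro c
          have e1 := k4 fun u => c (i₀ :: u)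
          have e2 := h4 c
          constructor
          · intro h p hp
            rcases List.mem_append.1 hp with hp | hp
            · obtain ⟨p', hp', rfl⟩ := List.mem_map.1 hp
              exact e1.1 (h ⟨0, by simp⟩) p' hp'
            · refine e2.1 (fun i => ?_) p hp
              have := h i.succ
              simpa [add_assoc, add_comm 1] using this
          · intro h i
            refine Fin.cases ?_ (fun i => ?_) i
            · exact e1.2 fun p hp => h (i₀ :: p.1, p.2)
                (List.mem_append_left _ (List.mem_map.2 ⟨p, hp, rfl⟩))
            · have := e2.2 (fun p hp => h p (List.mem_append_right _ hp)) i
              simpa [add_assoc, add_comm 1] using this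
    obtain ⟨l, h1, h2, h3, h4⟩ := key 0
    refine ⟨([], ts.length) :: l, ?_, by rw [List.map_cons, h2, word_node], fun c => ?_⟩
    · rw [List.map_cons, List.nodup_cons]
      refine ⟨fun hm => ?_, h1⟩
      obtain ⟨p, hp, hp'⟩ := List.mem_map.1 hm
      obtain ⟨i, u, hiu, -⟩ := h3 p hp
      rw [hiu] at hp'
      simp at hp'
    · rw [List.forall_mem_cons, ← h4 c]
      simp only [zero_add]
      exact ⟨fun h => by cases h with | node _ _ h0 h => exact ⟨h0, h⟩, fun h => .node c ts h.1 h.2⟩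

end PlaneTree

/-! ### The law of the Galton–Watson tree -/

section GaltonWatson

variable {Ω : Type*} [MeasurableSpace Ω] {P : Measure Ω} {ξ : List ℕ → Ω → ℕ}

open PlaneTree

lemma measurableSet_gwTree_eq (hmeas : ∀ u, Measurable (ξ u)) (T : PlaneTree) :
    MeasurableSet {ω | gwTree ξ ω = some T} := by
  obtain ⟨l, -, -, h⟩ := exists_addresses T
  simp only [gwTree, familyTree_eq_some_iff, h]
  have : {ω | ∀ p ∈ l, ξ p.1 ω = p.2} = ⋂ p ∈ l, ξ p.1 ⁻¹' {p.2} := by ext; simp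
  rw [this]
  exact MeasurableSet.biInter (Set.to_countable _) fun p _ => hmeas p.1 (measurableSet_singleton _)

lemma measure_gwTree_eq (hindep : iIndepFun ξ P)
    (hident : ∀ u, IdentDistrib (ξ u) (ξ []) P P) (T : PlaneTree) :
    P {ω | gwTree ξ ω = some T} = ((word T).map fun k => P {ω | ξ [] ω = k}).prod := by
  obtain ⟨l, h1, h2, h⟩ := exists_addresses T
  simp only [gwTree, familyTree_eq_some_iff, h]
  have hinj : Function.Injective fun k : Fin l.length => (l[k]).1 := by
    have := List.nodup_iff_injective_get.1 h1
    intro a b hab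
    have h3 := @this ⟨a, by simp⟩ ⟨b, by simp⟩ (by simpa using hab)
    simpa [Fin.ext_iff] using h3
  have hset : {ω | ∀ p ∈ l, ξ p.1 ω = p.2}
      = ⋂ k ∈ (Finset.univ : Finset (Fin l.length)), ξ (l[k]).1 ⁻¹' {(l[k]).2} := by
    ext ω
    simp only [Set.mem_ofPred_eq, Finset.mem_univ, Set.iInter_true, Set.mem_iInter,
      Set.mem_preimage, Set.mem_singleton_iff]
    rw [List.forall_mem_iff_getElem]
    exact ⟨fun h k => h k.1 k.2, fun h i hi => h ⟨i, hi⟩⟩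
  rw [hset, (hindep.precomp hinj).measure_inter_preimage_eq_mul Finset.univ
    (sets := fun k => {(l[k]).2}) fun k _ => measurableSet_singleton _, ← h2, List.map_map,
    ← List.prod_ofFn]
  have : ∀ u k, P (ξ u ⁻¹' {k}) = P {ω | ξ [] ω = k} := fun u k =>
    (hident u).measure_mem_eq (measurableSet_singleton k)
  simp only [this]
  congr 1
  refine List.ext_getElem (by simp) fun i h1 h2 => by simp

/-- The numbers of children along one line of descent are a sequence of independent copies of the
offspring variable. -/
def spine (ξ : List ℕ → Ω → ℕ) (i : ℕ) : Ω → ℕ := ξ (List.replicate i 0)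

lemma iIndepFun_spine (hindep : iIndepFun ξ P) : iIndepFun (spine ξ) P :=
  hindep.precomp (g := fun i => List.replicate i 0) (List.replicate_left_injective 0)

/-- The word formed by the first `n` members of a sequence of random variables. -/
def cyclicPrefix (X : ℕ → Ω → ℕ) (n : ℕ) (ω : Ω) (x : ZMod n) : ℕ := X x.val ω

lemma measurable_cyclicPrefix {X : ℕ → Ω → ℕ} (hX : ∀ i, Measurable (X i)) (n : ℕ) :
    Measurable (cyclicPrefix X n) := measurable_pi_lambda _ fun x => hX x.val

lemma measure_cyclicPrefix_eq {X : ℕ → Ω → ℕ}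
    (hindep : iIndepFun X P) (hident : ∀ i, IdentDistrib (X i) (X 0) P P) {n : ℕ} [NeZero n]
    (w : ZMod n → ℕ) : P (cyclicPrefix X n ⁻¹' {w}) = ∏ x, P {ω | X 0 ω = w x} := by
  have hset : cyclicPrefix X n ⁻¹' {w} = ⋂ x ∈ (Finset.univ : Finset (ZMod n)),
      X x.val ⁻¹' {w x} := by
    ext ω
    simp [cyclicPrefix, funext_iff]
  rw [hset, (hindep.precomp (ZMod.val_injective n)).measure_inter_preimage_eq_mul Finset.univ
    (sets := fun x => {w x}) fun x _ => measurableSet_singleton _]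
  exact Finset.prod_congr rfl fun x _ =>
    (hident x.val).measure_mem_eq (measurableSet_singleton _)

lemma measure_preimage_eq_tsum {α : Type*} [Countable α] [MeasurableSpace α]
    [MeasurableSingletonClass α] {f : Ω → α} (hf : Measurable f) (A : Set α) :
    P (f ⁻¹' A) = ∑' a, A.indicator (fun a => P (f ⁻¹' {a})) a := by
  have hA : MeasurableSet A := A.to_countable.measurableSet
  rw [← Measure.map_apply hf hA, ← Measure.tsum_indicator_apply_singleton _ _ hA]
  congr 1
  ext a
  by_cases ha : a ∈ A
  · simp [ha, Measure.map_apply hf (measurableSet_singleton a)]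
  · simp [ha]

/-- Each cyclically invariant event for the words of length `n` and sum `n - 1` is `n` times as
probable as the same event for the words of trees with `n` nodes. -/
theorem mul_measure_gwTree_eq (hmeas : ∀ u, Measurable (ξ u))
    (hindep : iIndepFun ξ P) (hident : ∀ u, IdentDistrib (ξ u) (ξ []) P P) {n : ℕ} [NeZero n]
    (B : Set (PlaneTree → ℕ)) :
    n * P {ω | ∃ T, gwTree ξ ω = some T ∧ T.size = n ∧ (fun S => fringeCount S T) ∈ B}
      = P {ω | ∑ i ∈ Finset.range n, spine ξ i ω + 1 = n ∧
          (fun S => cyclicCount S (cyclicPrefix (spine ξ) n ω)) ∈ B} := by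
  classical
  let q : ℕ → ENNReal := fun k => P {ω | ξ [] ω = k}
  let A : Set (ZMod n → ℕ) := {w | ∑ x, w x + 1 = n ∧ (fun S => cyclicCount S w) ∈ B}
  let g : (ZMod n → ℕ) → ENNReal := fun w => ∏ x, q (w x)
  let r : ZMod n → (ZMod n → ℕ) ≃ (ZMod n → ℕ) := fun j =>
    (Equiv.addRight j).symm.arrowCongr (Equiv.refl ℕ)
  have hr : ∀ j w, r j w = fun x => w (x + j) := fun j w => rfl
  have hrA : ∀ j w, r j w ∈ A ↔ w ∈ A := by
    intro j w
    simp only [A, Set.mem_ofPred_eq, hr, cyclicCount_rotate]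
    rw [show ∑ x, w (x + j) = ∑ x, w x from Equiv.sum_comp (Equiv.addRight j) w]
  have hrg : ∀ j w, g (r j w) = g w := fun j w =>
    Equiv.prod_comp (Equiv.addRight j) fun x => q (w x)
  have hm : ∀ i, Measurable (spine ξ i) := fun i => hmeas _
  -- the right-hand side as a sum over words
  have hR : P {ω | ∑ i ∈ Finset.range n, spine ξ i ω + 1 = n ∧
      (fun S => cyclicCount S (cyclicPrefix (spine ξ) n ω)) ∈ B} = ∑' w, A.indicator g w := by
    have hset : {ω | ∑ i ∈ Finset.range n, spine ξ i ω + 1 = n ∧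
        (fun S => cyclicCount S (cyclicPrefix (spine ξ) n ω)) ∈ B}
        = cyclicPrefix (spine ξ) n ⁻¹' A := by
      ext ω
      simp only [A, Set.mem_ofPred_eq, Set.mem_preimage]
      rw [← sum_range_natCast_zmod]
      have : ∀ k ∈ Finset.range n, cyclicPrefix (spine ξ) n ω (k : ZMod n) = spine ξ k ω := by
        intro k hk
        rw [cyclicPrefix, ZMod.val_natCast_of_lt (Finset.mem_range.1 hk)]
      rw [Finset.sum_congr rfl this]
    rw [hset, measure_preimage_eq_tsum (measurable_cyclicPrefix hm n)]
    congr 1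
    ext w
    congr 1
    ext w
    exact measure_cyclicPrefix_eq (iIndepFun_spine hindep) (fun i => hident _) w
  -- the left-hand side as a sum over the words of trees
  have hL : P {ω | ∃ T, gwTree ξ ω = some T ∧ T.size = n ∧ (fun S => fringeCount S T) ∈ B}
      = ∑' w, (A ∩ {w | IsLukasiewicz w}).indicator g w := by
    have hset : {ω | ∃ T, gwTree ξ ω = some T ∧ T.size = n ∧ (fun S => fringeCount S T) ∈ B}
        = ⋃ T : {T : PlaneTree // size T = n},
          {ω | gwTree ξ ω = some T.1 ∧ (fun S => fringeCount S T.1) ∈ B} := by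
      ext ω
      simp only [Set.mem_ofPred_eq, Set.mem_iUnion, Subtype.exists, exists_prop]
      exact exists_congr fun T => by tauto
    rw [hset, measure_iUnion]
    · have hsupp : ∀ w, w ∉ Set.range (cyclicWord (n := n)) →
          (A ∩ {w | IsLukasiewicz w}).indicator g w = 0 := by
        intro w hw
        refine Set.indicator_of_notMem (fun hm => hw ?_) _
        exact exists_cyclicWord_eq w hm.2 hm.1.1
      rw [← cyclicWord_injective.tsum_eq (Function.support_subset_iff'.2 hsupp)]
      congr 1
      ext T
      have hT : cyclicWord T ∈ A ∩ {w | IsLukasiewicz w} ↔ (fun S => fringeCount S T.1) ∈ B := by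
        simp only [A, Set.mem_inter_iff, Set.mem_ofPred_eq, isLukasiewicz_cyclicWord, and_true,
          sum_cyclicWord, true_and, cyclicCount_cyclicWord]
      by_cases hB : (fun S => fringeCount S T.1) ∈ B
      · rw [Set.indicator_of_mem (hT.2 hB)]
        simp only [hB, and_true, measure_gwTree_eq hindep hident]
        simp only [g, ← prod_range_natCast_zmod]
        rw [← (startsWith_cyclicWord T).prod_map q, length_word, T.2]
      · rw [Set.indicator_of_notMem (fun h => hB (hT.1 h))]
        simp [hB]
    · intro S T hST
      refine Set.disjoint_left.2 fun ω h1 h2 => hST ?_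
      exact Subtype.ext (Option.some_inj.1 (h1.1.symm.trans h2.1))
    · intro T
      exact (measurableSet_gwTree_eq hmeas T.1).inter (.const _)
  -- by the cycle lemma each word of `A` has exactly one rotation that is the word of a tree
  have hone : ∀ w, A.indicator g w
      = ∑ j : ZMod n, (A ∩ {w | IsLukasiewicz w}).indicator g (r j w) := by
    intro w
    by_cases hw : w ∈ A
    · obtain ⟨j, hj, huniq⟩ := existsUnique_isLukasiewicz w hw.1
      rw [Finset.sum_eq_single j, Set.indicator_of_mem hw, Set.indicator_of_mem, hrg]
      · exact ⟨(hrA j w).2 hw, hj⟩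
      · intro i _ hi
        exact Set.indicator_of_notMem (fun h => hi (huniq i h.2)) _
      · simp
    · rw [Set.indicator_of_notMem hw, Finset.sum_eq_zero]
      exact fun j _ => Set.indicator_of_notMem (fun h => hw ((hrA j w).1 h.1)) _
  rw [hL, hR]
  simp only [hone]
  rw [Summable.tsum_finsetSum fun _ _ => ENNReal.summable]
  simp only [Equiv.tsum_eq (r _) fun w => (A ∩ {w | IsLukasiewicz w}).indicator g w]
  simp [ZMod.card]

/-- The event that the first `n` members of a sequence have sum `n - 1`. -/
def bridgeEvent (X : ℕ → Ω → ℕ) (n : ℕ) : Set Ω := {ω | ∑ i ∈ Finset.range n, X i ω + 1 = n}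

lemma measurableSet_bridgeEvent {X : ℕ → Ω → ℕ} (hX : ∀ i, Measurable (X i)) (n : ℕ) :
    MeasurableSet (bridgeEvent X n) :=
  ((Finset.measurable_fun_sum _ fun i _ => hX i).add_const 1) (measurableSet_singleton n)

open Classical in
/-- The number of occurrences of the word of `S` in the first `n` members of a sequence, read
cyclically. -/
noncomputable def wrappedCount (X : ℕ → Ω → ℕ) (n : ℕ) (S : PlaneTree) (ω : Ω) : ℕ :=
  ((Finset.range n).filter fun i => StartsWith (fun k => X ((i + k) % n) ω) (word S)).card

omit [MeasurableSpace Ω] in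
lemma wrappedCount_eq_cyclicCount (X : ℕ → Ω → ℕ) {n : ℕ} [NeZero n] (S : PlaneTree) (ω : Ω) :
    wrappedCount X n S ω = cyclicCount S (cyclicPrefix X n ω) := by
  classical
  rw [wrappedCount, cyclicCount, Finset.card_filter, Finset.card_filter,
    ← sum_range_natCast_zmod]
  refine Finset.sum_congr rfl fun i _ => ?_
  have : ∀ k : ℕ, cyclicPrefix X n ω ((i : ZMod n) + k) = X ((i + k) % n) ω := fun k => by
    rw [cyclicPrefix, ← Nat.cast_add, ZMod.val_natCast]
  simp only [this]

lemma measurable_wrappedCount {X : ℕ → Ω → ℕ} (hX : ∀ i, Measurable (X i)) (n : ℕ)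
    (S : PlaneTree) : Measurable (wrappedCount X n S) := by
  classical
  have : wrappedCount X n S = fun ω => ∑ i ∈ Finset.range n,
      if StartsWith (fun k => X ((i + k) % n) ω) (word S) then 1 else 0 := by
    ext ω
    rw [wrappedCount, Finset.card_filter]
  rw [this]
  refine Finset.measurable_fun_sum _ fun i _ => Measurable.ite ?_ (by fun_prop) (by fun_prop)
  have : {ω | StartsWith (fun k => X ((i + k) % n) ω) (word S)}
      = ⋂ k, ⋂ hk : k < (word S).length, X ((i + k) % n) ⁻¹' {(word S)[k]} := by
    ext ω
    simp [StartsWith]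
  rw [this]
  exact MeasurableSet.iInter fun k => MeasurableSet.iInter fun hk =>
    hX _ (measurableSet_singleton _)

lemma measurable_gwCount (hmeas : ∀ u, Measurable (ξ u)) (S : PlaneTree) :
    Measurable (gwCount ξ S) := by
  let _ : MeasurableSpace (Option PlaneTree) := ⊤
  have h1 : Measurable (gwTree ξ) := by
    have hs : ∀ T, MeasurableSet (gwTree ξ ⁻¹' {some T}) := fun T => measurableSet_gwTree_eq hmeas T
    refine measurable_to_countable' fun o => ?_
    cases o with
    | some T => exact hs T
    | none =>
      have : gwTree ξ ⁻¹' {none} = (⋃ T, gwTree ξ ⁻¹' {some T})ᶜ := by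
        ext ω
        simp only [Set.mem_preimage, Set.mem_singleton_iff, Set.mem_compl_iff, Set.mem_iUnion,
          ← Option.eq_none_iff_forall_ne_some, not_exists]
      rw [this]
      exact (MeasurableSet.iUnion hs).compl
  exact (measurable_from_top (f := fun o : Option PlaneTree =>
    match o with
    | some T => (fringeCount S T : ℝ)
    | none => 0)).comp h1

omit [MeasurableSpace Ω] in
lemma gwSizeEvent_zero : gwSizeEvent ξ 0 = ∅ := by
  ext ω
  simp only [gwSizeEvent, Set.mem_ofPred_eq, Set.mem_empty_iff_false, iff_false, not_exists,
    not_and]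
  exact fun T _ => (size_pos T).ne'

/-- The probability of a tree of size `n`, in terms of sums of independent offspring variables. -/
lemma mul_measure_gwSizeEvent (hmeas : ∀ u, Measurable (ξ u)) (hindep : iIndepFun ξ P)
    (hident : ∀ u, IdentDistrib (ξ u) (ξ []) P P) (n : ℕ) :
    n * P (gwSizeEvent ξ n) = P (bridgeEvent (spine ξ) n) := by
  rcases Nat.eq_zero_or_pos n with rfl | hn
  · simp [bridgeEvent]
  · have : NeZero n := ⟨hn.ne'⟩
    simpa [gwSizeEvent, bridgeEvent] using
      mul_measure_gwTree_eq hmeas hindep hident (n := n) Set.univ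

/-- The subtree counts of the conditioned Galton–Watson tree are jointly distributed as the cyclic
pattern counts in a sequence of independent offspring variables given that their sum is `n - 1`. -/
theorem map_gwCount_condGW (hmeas : ∀ u, Measurable (ξ u)) (hindep : iIndepFun ξ P)
    (hident : ∀ u, IdentDistrib (ξ u) (ξ []) P P) (n : AdmissibleSize P ξ) :
    (condGW P ξ n).map (fun ω S => gwCount ξ S ω)
      = (cond P (bridgeEvent (spine ξ) n)).map
        (fun ω S => (wrappedCount (spine ξ) n S ω : ℝ)) := by
  obtain ⟨n, hn⟩ := n
  have : NeZero n := ⟨fun h => hn (by rw [h, gwSizeEvent_zero]; simp)⟩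
  have hm : ∀ i, Measurable (spine ξ i) := fun i => hmeas _
  have hn0 : (n : ENNReal) ≠ 0 := by simp [NeZero.ne n]
  have hsize : MeasurableSet (gwSizeEvent ξ n) := by
    have : gwSizeEvent ξ n = ⋃ T : {T : PlaneTree // size T = n}, {ω | gwTree ξ ω = some T.1} := by
      ext ω
      simp only [gwSizeEvent, Set.mem_ofPred_eq, Set.mem_iUnion, Subtype.exists, exists_prop]
      exact exists_congr fun T => and_comm
    rw [this]
    exact MeasurableSet.iUnion fun T => measurableSet_gwTree_eq hmeas T.1
  have hg : Measurable fun ω S => gwCount ξ S ω :=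
    measurable_pi_lambda _ fun S => measurable_gwCount hmeas S
  have hw : Measurable fun ω S => (wrappedCount (spine ξ) n S ω : ℝ) :=
    measurable_pi_lambda _ fun S => measurable_from_top.comp (measurable_wrappedCount hm n S)
  refine Measure.ext fun B hB => ?_
  rw [Measure.map_apply hg hB, Measure.map_apply hw hB, condGW, cond_apply hsize,
    cond_apply (measurableSet_bridgeEvent hm n)]
  have key := mul_measure_gwTree_eq hmeas hindep hident (n := n)
    {c | (fun S => (c S : ℝ)) ∈ B}
  have e1 : {ω | ∃ T, gwTree ξ ω = some T ∧ T.size = n ∧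
      (fun S => fringeCount S T) ∈ {c : PlaneTree → ℕ | (fun S => (c S : ℝ)) ∈ B}}
      = gwSizeEvent ξ n ∩ (fun ω S => gwCount ξ S ω) ⁻¹' B := by
    ext ω
    constructor
    · rintro ⟨T, hT, hs, hB⟩
      refine ⟨⟨T, hT, hs⟩, ?_⟩
      simpa [gwCount, hT] using hB
    · rintro ⟨⟨T, hT, hs⟩, hB⟩
      refine ⟨T, hT, hs, ?_⟩
      simpa [gwCount, hT] using hB
  have e2 : {ω | ∑ i ∈ Finset.range n, spine ξ i ω + 1 = n ∧
      (fun S => cyclicCount S (cyclicPrefix (spine ξ) n ω)) ∈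
        {c : PlaneTree → ℕ | (fun S => (c S : ℝ)) ∈ B}}
      = bridgeEvent (spine ξ) n ∩ (fun ω S => (wrappedCount (spine ξ) n S ω : ℝ)) ⁻¹' B := by
    ext ω
    simp only [bridgeEvent, wrappedCount_eq_cyclicCount]
    rfl
  rw [e1, e2] at key
  rw [← key, ← mul_measure_gwSizeEvent hmeas hindep hident n,
    ENNReal.mul_inv (Or.inl hn0) (Or.inl (ENNReal.natCast_ne_top n)), mul_comm (n : ENNReal)⁻¹,
    mul_assoc, ← mul_assoc (n : ENNReal)⁻¹, ENNReal.inv_mul_cancel hn0 (ENNReal.natCast_ne_top n),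
    one_mul]

end GaltonWatson

/-! ### Characteristic functions of lattice sums -/

/-- Independent copies of a random variable with values in `ℕ`, mean `1` and variance
`σ2 ∈ (0, ∞)`. -/
structure IsCriticalSequence {Ω : Type*} [MeasurableSpace Ω] (P : Measure Ω) (X : ℕ → Ω → ℕ)
    (σ2 : ℝ) : Prop where
  measurable : ∀ i, Measurable (X i)
  indep : iIndepFun X P
  ident : ∀ i, IdentDistrib (X i) (X 0) P P
  memLp : MemLp (fun ω => (X 0 ω : ℝ)) 2 P
  mean : ∫ ω, (X 0 ω : ℝ) ∂P = 1
  variance_eq : variance (fun ω => (X 0 ω : ℝ)) P = σ2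
  pos : 0 < σ2

/-- `d` is the span of the law of `Y`: it divides all values that `Y` takes with positive
probability, and no proper multiple of it does. The second property is stated through the characters
that are trivial on all values. -/
structure IsSpan {Ω : Type*} [MeasurableSpace Ω] (P : Measure Ω) (Y : Ω → ℕ) (d : ℕ) : Prop where
  pos : 0 < d
  dvd : ∀ k, P {ω | Y ω = k} ≠ 0 → d ∣ k
  eq_of_char : ∀ t : ℝ, (∀ k, P {ω | Y ω = k} ≠ 0 → Complex.exp (t * k * Complex.I) = 1) →
    ∃ m : ℤ, t * d = m * (2 * Real.pi)

section Lattice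

variable {Ω : Type*} [MeasurableSpace Ω] {P : Measure Ω} [IsProbabilityMeasure P]
  {X : ℕ → Ω → ℕ} {σ2 : ℝ}

/-- The characteristic function of a centred square integrable variable near `0`. -/
lemma charFun_sub_isLittleO {Y : Ω → ℝ} (hY : MemLp Y 2 P) (h0 : ∫ ω, Y ω ∂P = 0) :
    (fun t : ℝ => charFun (P.map Y) t - (1 - ((∫ ω, Y ω ^ 2 ∂P : ℝ) : ℂ) * t ^ 2 / 2))
      =o[𝓝 0] fun t : ℝ => t ^ 2 := by
  have hm := hY.aemeasurable
  have := Measure.isProbabilityMeasure_map hm (μ := P)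
  have hid : MemLp id (2 : ℕ) (P.map Y) := by
    rw [memLp_map_measure_iff (by fun_prop) hm]
    simpa using hY
  have h := taylor_isLittleO_univ (x₀ := (0 : ℝ)) (contDiff_charFun hid)
  have e : ∀ t, taylorWithinEval (charFun (P.map Y)) 2 Set.univ 0 t
      = 1 - ((∫ ω, Y ω ^ 2 ∂P : ℝ) : ℂ) * t ^ 2 / 2 := fun t => by
    rw [taylorWithinEval_charFun_two_zero hm hid, h0]
    simp
  simpa only [e, sub_zero] using h

namespace IsCriticalSequence

variable (hX : IsCriticalSequence P X σ2)
include hX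

lemma memLp_centered (i : ℕ) : MemLp (fun ω => (X i ω : ℝ) - 1) 2 P := by
  have h := (hX.ident i).comp (u := fun k : ℕ => (k : ℝ)) measurable_from_top
  exact (h.memLp_iff.2 hX.memLp).sub (memLp_const 1)

lemma integral_centered (i : ℕ) : ∫ ω, ((X i ω : ℝ) - 1) ∂P = 0 := by
  have h := (hX.ident i).comp (u := fun k : ℕ => (k : ℝ) - 1) measurable_from_top
  have h2 := h.integral_eq
  simp only [Function.comp_def] at h2
  rw [h2, integral_sub (hX.memLp.integrable one_le_two) (integrable_const 1), hX.mean]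
  simp

omit [IsProbabilityMeasure P] in
lemma integral_centered_sq (i : ℕ) : ∫ ω, ((X i ω : ℝ) - 1) ^ 2 ∂P = σ2 := by
  have h := (hX.ident i).comp (u := fun k : ℕ => ((k : ℝ) - 1) ^ 2) measurable_from_top
  have h2 := h.integral_eq
  simp only [Function.comp_def] at h2
  rw [h2, ← hX.variance_eq, variance_eq_integral hX.memLp.aemeasurable, hX.mean]

lemma measure_zero_ne_zero : P {ω | X 0 ω = 0} ≠ 0 := by
  intro h
  have h1 : ∀ᵐ ω ∂P, 0 ≤ (X 0 ω : ℝ) - 1 := by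
    filter_upwards [measure_eq_zero_iff_ae_notMem.1 h] with ω hω
    have : 1 ≤ X 0 ω := Nat.one_le_iff_ne_zero.2 hω
    have : (1 : ℝ) ≤ X 0 ω := by exact_mod_cast this
    linarith
  have h2 := (integral_eq_zero_iff_of_nonneg_ae h1
    ((hX.memLp_centered 0).integrable one_le_two)).1 (hX.integral_centered 0)
  have h3 : ∫ ω, ((X 0 ω : ℝ) - 1) ^ 2 ∂P = 0 := by
    rw [integral_eq_zero_of_ae]
    filter_upwards [h2] with ω hω
    simp [hω]
  rw [hX.integral_centered_sq] at h3
  exact hX.pos.ne' h3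

omit [IsProbabilityMeasure P] in
/-- The span is the generator of the subgroup of `ℤ` generated by the possible values. -/
lemma exists_isSpan : ∃ d, IsSpan P (X 0) d := by
  let A : Set ℤ := {k | ∃ m : ℕ, k = m ∧ P {ω | X 0 ω = m} ≠ 0}
  obtain ⟨a, ha⟩ := Int.subgroup_cyclic (AddSubgroup.closure A)
  have hdvd : ∀ k : ℕ, P {ω | X 0 ω = k} ≠ 0 → a.natAbs ∣ k := by
    intro k hk
    have : (k : ℤ) ∈ AddSubgroup.closure A := AddSubgroup.subset_closure ⟨k, rfl, hk⟩
    rw [ha, AddSubgroup.mem_closure_singleton] at this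
    obtain ⟨n, hn⟩ := this
    rw [← Int.natCast_dvd_natCast, Int.natAbs_dvd, ← hn]
    exact ⟨n, by simp [mul_comm]⟩
  refine ⟨a.natAbs, Nat.pos_of_ne_zero fun h0 => ?_, hdvd, fun t ht => ?_⟩
  · -- otherwise the variable vanishes almost surely
    have : ∀ k : ℕ, ∀ᵐ ω ∂P, X 0 ω = k → k = 0 := by
      intro k
      by_cases hk : P {ω | X 0 ω = k} = 0
      · filter_upwards [measure_eq_zero_iff_ae_notMem.1 hk] with ω hω h
        exact (hω h).elim
      · have := hdvd k hk
        rw [h0, zero_dvd_iff] at this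
        exact .of_forall fun _ _ => this
    have h1 : ∫ ω, (X 0 ω : ℝ) ∂P = 0 := by
      rw [integral_eq_zero_of_ae]
      filter_upwards [ae_all_iff.2 this] with ω hω
      simp [hω (X 0 ω) rfl]
    rw [hX.mean] at h1
    exact one_ne_zero h1
  · let K : AddSubgroup ℤ :=
      { carrier := {k | Complex.exp (t * k * Complex.I) = 1}
        zero_mem' := by simp
        add_mem' := by
          intro x y hx hy
          simp only [Set.mem_ofPred_eq] at hx hy ⊢
          rw [Int.cast_add, mul_add, add_mul, Complex.exp_add, hx, hy, one_mul]
        neg_mem' := by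
          intro x hx
          simp only [Set.mem_ofPred_eq] at hx ⊢
          rw [Int.cast_neg, mul_neg, neg_mul, Complex.exp_neg, hx, inv_one] }
    have hAK : AddSubgroup.closure A ≤ K := by
      rw [AddSubgroup.closure_le]
      rintro _ ⟨m, rfl, hm⟩
      have := ht m hm
      rwa [← Int.cast_natCast m] at this
    have hd : ((a.natAbs : ℕ) : ℤ) ∈ K := by
      refine hAK ?_
      rw [ha, AddSubgroup.mem_closure_singleton]
      rcases Int.natAbs_eq a with h | h
      · exact ⟨1, by rw [one_smul]; exact h⟩
      · exact ⟨-1, by rw [neg_smul, one_smul]; omega⟩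
    obtain ⟨m, hm⟩ := Complex.exp_eq_one_iff.1
      (show Complex.exp (t * ((a.natAbs : ℕ) : ℤ) * Complex.I) = 1 from hd)
    refine ⟨m, ?_⟩
    have : ((t * a.natAbs : ℝ) : ℂ) * Complex.I = ((m * (2 * Real.pi) : ℝ) : ℂ) * Complex.I := by
      rw [Int.cast_natCast] at hm
      push_cast
      rw [hm]
      ring
    exact_mod_cast mul_right_cancel₀ Complex.I_ne_zero this

omit hX in
/-- If the characteristic function has modulus one at `t`, the character is constant on the possible
values. Since `0` is one of them, the constant is `1`, and `t` is a multiple of `2π / d`. -/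
lemma _root_.norm_charFun_map_lt_one_of_span (hmeas : Measurable (X 0)) {d : ℕ}
    (hd : IsSpan P (X 0) d) (h0 : P {ω | X 0 ω = 0} ≠ 0) {t : ℝ} (ht : |t| ≤ Real.pi / d)
    (ht0 : t ≠ 0) : ‖charFun (P.map fun ω => (X 0 ω : ℝ) - 1) t‖ < 1 := by
  have hm : Measurable fun ω => (X 0 ω : ℝ) - 1 := by fun_prop
  rw [charFun_apply_real, integral_map hm.aemeasurable (by fun_prop)]
  set f : Ω → ℂ := fun ω => Complex.exp (t * ((X 0 ω : ℝ) - 1 : ℝ) * Complex.I) with hf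
  have hnorm : ∀ᵐ ω ∂P, ‖f ω‖ ≤ 1 := .of_forall fun ω => by
    simp only [hf]
    rw [← Complex.ofReal_mul, Complex.norm_exp_ofReal_mul_I]
  rcases ae_eq_const_or_norm_integral_lt_of_norm_le_const hnorm with h | h
  · exfalso
    have hval : ∀ k : ℕ, P {ω | X 0 ω = k} ≠ 0 →
        Complex.exp (t * ((k : ℝ) - 1 : ℝ) * Complex.I) = ⨍ ω, f ω ∂P := by
      intro k hk
      have : ∃ᵐ ω ∂P, X 0 ω = k := by
        rwa [frequently_ae_iff]
      obtain ⟨ω, h1, h2⟩ := (this.and_eventually h).exists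
      simpa [hf, h1] using h2
    obtain ⟨m, hm⟩ := hd.eq_of_char t fun k hk => by
      have h1 := (hval k hk).trans (hval 0 (by exact_mod_cast h0)).symm
      have h2 : Complex.exp (t * k * Complex.I)
          = Complex.exp (t * ((k : ℝ) - 1 : ℝ) * Complex.I)
            / Complex.exp (t * (((0 : ℕ) : ℝ) - 1 : ℝ) * Complex.I) := by
        rw [← Complex.exp_sub]
        congr 1
        push_cast
        ring
      rw [h2, h1, div_self (Complex.exp_ne_zero _)]
    have hdpos : (0 : ℝ) < d := by exact_mod_cast hd.pos
    have h3 : |t * d| ≤ Real.pi := by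
      rw [abs_mul, abs_of_pos hdpos]
      exact (le_div_iff₀ hdpos).1 ht
    rw [hm, abs_mul, abs_of_pos Real.two_pi_pos] at h3
    have h4 : |(m : ℝ)| < 1 := by nlinarith [Real.pi_pos]
    have h5 : m = 0 := by
      rw [← Int.cast_abs] at h4
      exact Int.abs_lt_one_iff.1 (by exact_mod_cast h4)
    rw [h5] at hm
    simp only [Int.cast_zero, zero_mul, mul_eq_zero] at hm
    rcases hm with hm | hm
    · exact ht0 hm
    · exact hdpos.ne' hm
  · simpa using h

/-- On its fundamental interval the characteristic function of a centred lattice variable is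
dominated by a Gaussian. -/
lemma exists_norm_charFun_le {d : ℕ} (hd : IsSpan P (X 0) d) :
    ∃ c > 0, ∀ t : ℝ, |t| ≤ Real.pi / d →
      ‖charFun (P.map fun ω => (X 0 ω : ℝ) - 1) t‖ ≤ Real.exp (-(c * t ^ 2)) := by
  set φ : ℝ → ℂ := charFun (P.map fun ω => (X 0 ω : ℝ) - 1) with hφ
  have hσ := hX.pos
  have hmc : Measurable fun ω => (X 0 ω : ℝ) - 1 := by
    have := hX.measurable 0
    fun_prop
  have := Measure.isProbabilityMeasure_map hmc.aemeasurable (μ := P)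
  have h1 := (charFun_sub_isLittleO (hX.memLp_centered 0) (hX.integral_centered 0)).def
    (show 0 < σ2 / 4 by positivity)
  rw [hX.integral_centered_sq, Metric.eventually_nhds_iff] at h1
  obtain ⟨δ₀, hδ₀, h1⟩ := h1
  set δ : ℝ := min (δ₀ / 2) (Real.sqrt (2 / σ2)) with hδ
  have hδpos : 0 < δ := lt_min (by positivity) (by positivity)
  have hsmall : ∀ t : ℝ, |t| ≤ δ → ‖φ t‖ ≤ Real.exp (-(σ2 / 4 * t ^ 2)) := by
    intro t ht
    have h2 := h1 (y := t) (by
      rw [Real.dist_eq, sub_zero]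
      have := min_le_left (δ₀ / 2) (Real.sqrt (2 / σ2))
      linarith)
    have h3 : σ2 * t ^ 2 ≤ 2 := by
      have h4 : |t| ≤ Real.sqrt (2 / σ2) := ht.trans (min_le_right _ _)
      have h5 : t ^ 2 ≤ 2 / σ2 := by
        rw [← sq_abs]
        exact (Real.le_sqrt (abs_nonneg t) (by positivity)).1 h4
      rw [le_div_iff₀ hσ] at h5
      linarith
    have h6 : ‖(1 - (σ2 : ℂ) * t ^ 2 / 2 : ℂ)‖ = 1 - σ2 * t ^ 2 / 2 := by
      have : (1 - (σ2 : ℂ) * t ^ 2 / 2 : ℂ) = ((1 - σ2 * t ^ 2 / 2 : ℝ) : ℂ) := by push_cast; rfl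
      rw [this, Complex.norm_real, Real.norm_of_nonneg (by linarith)]
    have h7 : ‖φ t‖ ≤ ‖φ t - (1 - (σ2 : ℂ) * t ^ 2 / 2)‖ + ‖(1 - (σ2 : ℂ) * t ^ 2 / 2 : ℂ)‖ := by
      have := norm_add_le (φ t - (1 - (σ2 : ℂ) * t ^ 2 / 2)) (1 - (σ2 : ℂ) * t ^ 2 / 2)
      rwa [sub_add_cancel] at this
    rw [Real.norm_of_nonneg (sq_nonneg t)] at h2
    have h8 := Real.add_one_le_exp (-(σ2 / 4 * t ^ 2))
    linarith
  have hcomp : IsCompact (Set.Icc (-(Real.pi / d)) (Real.pi / d) ∩ {t | δ ≤ |t|}) :=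
    isCompact_Icc.inter_right (isClosed_le continuous_const continuous_abs)
  have hlarge : ∃ r < 1, 0 < r ∧ ∀ t : ℝ, |t| ≤ Real.pi / d → δ ≤ |t| → ‖φ t‖ ≤ r := by
    rcases (Set.Icc (-(Real.pi / d)) (Real.pi / d) ∩ {t | δ ≤ |t|}).eq_empty_or_nonempty
      with he | hne
    · refine ⟨1 / 2, by norm_num, by norm_num, fun t ht1 ht2 => ?_⟩
      have : t ∈ (∅ : Set ℝ) := he ▸ ⟨abs_le.1 ht1, ht2⟩
      exact this.elim
    · obtain ⟨t₀, ht₀, hmax⟩ := hcomp.exists_isMaxOn hne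
        (f := fun t => ‖φ t‖) (by rw [hφ]; exact (continuous_charFun.norm).continuousOn)
      refine ⟨max ‖φ t₀‖ (1 / 2), max_lt ?_ (by norm_num), by positivity, fun t ht1 ht2 =>
        (hmax ⟨abs_le.1 ht1, ht2⟩).trans (le_max_left _ _)⟩
      refine norm_charFun_map_lt_one_of_span (hX.measurable 0) hd hX.measure_zero_ne_zero
        (abs_le.2 ht₀.1) fun h => ?_
      have : δ ≤ |t₀| := ht₀.2
      rw [h, abs_zero] at this
      linarith
  obtain ⟨r, hr1, hr0, hr⟩ := hlarge
  have hdpos : (0 : ℝ) < d := by exact_mod_cast hd.pos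
  set R : ℝ := Real.pi / d with hR
  have hRpos : 0 < R := div_pos Real.pi_pos hdpos
  have hlog : 0 < -Real.log r := neg_pos.2 (Real.log_neg hr0 hr1)
  refine ⟨min (σ2 / 4) (-Real.log r / R ^ 2), lt_min (by positivity) (by positivity),
    fun t ht => ?_⟩
  rcases le_total |t| δ with h | h
  · refine (hsmall t h).trans (Real.exp_le_exp.2 (neg_le_neg ?_))
    exact mul_le_mul_of_nonneg_right (min_le_left _ _) (sq_nonneg t)
  · refine (hr t ht h).trans ?_
    rw [← Real.log_le_iff_le_exp hr0, le_neg]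
    have h1 : t ^ 2 ≤ R ^ 2 := sq_le_sq' (by linarith [abs_le.1 ht]) (abs_le.1 ht).2
    calc _ ≤ -Real.log r / R ^ 2 * t ^ 2 :=
          mul_le_mul_of_nonneg_right (min_le_right _ _) (sq_nonneg t)
      _ ≤ -Real.log r / R ^ 2 * R ^ 2 := mul_le_mul_of_nonneg_left h1 (by positivity)
      _ = -Real.log r := div_mul_cancel₀ _ (by positivity)

end IsCriticalSequence

end Lattice

/-! ### Independent blocks and Fourier inversion -/

section Blocks

variable {Ω : Type*} [MeasurableSpace Ω] {P : Measure Ω} {X : ℕ → Ω → ℕ} {σ2 : ℝ}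

/-- Subfamilies with disjoint index sets of an independent family are independent. -/
lemma ProbabilityTheory.iIndepFun.curry {ι κ : Type*} {Y : ℕ → Ω → ℕ}
    (hY : ∀ i, Measurable (Y i)) (hind : iIndepFun Y P) {g : ι → κ → ℕ}
    (hg : Function.Injective fun p : ι × κ => g p.1 p.2) :
    iIndepFun (fun i ω j => Y (g i j) ω) P := by
  have := hind.isProbabilityMeasure
  have hp : ∀ i, IsProbabilityMeasure (P.map (Y i)) := fun i =>
    Measure.isProbabilityMeasure_map (hY i).aemeasurable
  have h1 : P.map (fun ω (p : ι × κ) => Y (g p.1 p.2) ω)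
      = Measure.infinitePi fun p : ι × κ => P.map (Y (g p.1 p.2)) :=
    (hind.precomp hg).map_fun_eq_infinitePi_map fun p => hY _
  have h2 : ∀ i, P.map (fun ω j => Y (g i j) ω) = Measure.infinitePi fun j => P.map (Y (g i j)) :=
    fun i => (hind.precomp (g := g i) fun a b hab => by
      have := @hg (i, a) (i, b) hab
      simpa using this).map_fun_eq_infinitePi_map fun j => hY _
  rw [iIndepFun_iff_map_fun_eq_infinitePi_map fun i => measurable_pi_lambda _ fun j => hY _]
  simp only [h2]
  rw [← Measure.infinitePi_map_curry (fun i j => P.map (Y (g i j))), ← h1, Measure.map_map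
    (MeasurableEquiv.measurable _) (measurable_pi_lambda _ fun p => hY _)]
  rfl

/-- If `Y` is independent of `U` and takes no value with probability more than `ε`, then the event
that `s(U) + Y` takes a given value changes the law of `U` by a density of at most `ε`. -/
lemma lintegral_setOf_add_eq_le [IsProbabilityMeasure P] {α : Type*} [MeasurableSpace α]
    {U : Ω → α} {Y : Ω → ℕ} (hU : Measurable U) (hY : Measurable Y) (hind : IndepFun U Y P)
    {s : α → ℕ} (hs : Measurable s) {g : α → ENNReal} (hg : Measurable g) {ε : ENNReal}
    (hε : ∀ b, P {ω | Y ω = b} ≤ ε) (a : ℕ) :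
    ∫⁻ ω in {ω | s (U ω) + Y ω = a}, g (U ω) ∂P ≤ ε * ∫⁻ ω, g (U ω) ∂P := by
  have hmap := (indepFun_iff_map_prod_eq_prod_map_map hU.aemeasurable hY.aemeasurable).1 hind
  have hset : MeasurableSet {p : α × ℕ | s p.1 + p.2 = a} :=
    measurableSet_eq_fun (by fun_prop) (by fun_prop)
  have h1 : ∫⁻ ω in {ω | s (U ω) + Y ω = a}, g (U ω) ∂P
      = ∫⁻ p, {p : α × ℕ | s p.1 + p.2 = a}.indicator (fun p => g p.1) p
        ∂(P.map fun ω => (U ω, Y ω)) := by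
    rw [lintegral_map (Measurable.indicator (by fun_prop) hset) (by fun_prop),
      ← lintegral_indicator (by exact hset.preimage (hU.prodMk hY))]
    rfl
  have := Measure.isProbabilityMeasure_map hY.aemeasurable (μ := P)
  rw [h1, hmap, lintegral_prod _ (Measurable.indicator (by fun_prop) hset).aemeasurable,
    lintegral_map (by
      exact Measurable.lintegral_prod_right' (Measurable.indicator (by fun_prop) hset)) hU,
    ← lintegral_const_mul _ (by fun_prop)]
  refine lintegral_mono fun ω => ?_
  have h2 : ∀ y, {p : α × ℕ | s p.1 + p.2 = a}.indicator (fun p => g p.1) (U ω, y)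
      = {y | s (U ω) + y = a}.indicator (fun _ => g (U ω)) y := fun y => rfl
  simp only [h2]
  rw [lintegral_indicator (by measurability), lintegral_const, Measure.restrict_apply_univ,
    mul_comm, Measure.map_apply hY (by measurability)]
  refine mul_le_mul_left ((measure_mono fun ω' hω' => ?_).trans (hε (a - s (U ω)))) _
  simp only [Set.mem_preimage, Set.mem_ofPred_eq] at hω' ⊢
  omega

end Blocks

section Fourier

variable {Ω : Type*} [MeasurableSpace Ω] {P : Measure Ω} [IsProbabilityMeasure P]

lemma integral_exp_int_mul {d : ℕ} (hd : 0 < d) (k : ℤ) :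
    ∫ t in (-(Real.pi / d))..(Real.pi / d), Complex.exp (t * (d * k : ℤ) * Complex.I)
      = if k = 0 then ((2 * Real.pi / d : ℝ) : ℂ) else 0 := by
  have hd' : (d : ℂ) ≠ 0 := by exact_mod_cast hd.ne'
  split_ifs with hk
  · simp only [hk, mul_zero, Int.cast_zero, zero_mul, Complex.exp_zero,
      intervalIntegral.integral_const, Complex.real_smul, mul_one]
    congr 1
    ring
  · have hc : (((d * k : ℤ) : ℂ) * Complex.I) ≠ 0 := by
      simp [hk, hd.ne']
    have : ∀ t : ℝ, Complex.exp (t * (d * k : ℤ) * Complex.I)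
        = Complex.exp (((d * k : ℤ) : ℂ) * Complex.I * t) := fun t => by ring_nf
    simp only [this]
    rw [integral_exp_mul_complex hc, div_eq_zero_iff, sub_eq_zero]
    left
    rw [Complex.exp_eq_exp_iff_exists_int]
    refine ⟨k, ?_⟩
    push_cast
    field_simp
    ring

/-- **Fourier inversion** on the lattice `dℤ`. -/
lemma setIntegral_eq_integral_exp {d : ℕ} (hd : 0 < d) {Y : Ω → ℤ} (hY : Measurable Y)
    (hdvd : ∀ᵐ ω ∂P, (d : ℤ) ∣ Y ω) {V : Ω → ℂ} (hV : Integrable V P) :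
    ∫ ω in {ω | Y ω = 0}, V ω ∂P = (d / (2 * Real.pi) : ℝ) *
      ∫ t in (-(Real.pi / d))..(Real.pi / d), ∫ ω, V ω * Complex.exp (t * Y ω * Complex.I) ∂P := by
  have hd0 : (0 : ℝ) < d := by exact_mod_cast hd
  rw [intervalIntegral_integral_swap]
  · have h1 : ∀ᵐ ω ∂P, ∫ t in (-(Real.pi / d))..(Real.pi / d),
        V ω * Complex.exp (t * Y ω * Complex.I)
        = ((2 * Real.pi / d : ℝ) : ℂ) * {ω | Y ω = 0}.indicator V ω := by
      filter_upwards [hdvd] with ω hω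
      obtain ⟨k, hk⟩ := hω
      rw [intervalIntegral.integral_const_mul, hk, integral_exp_int_mul hd]
      by_cases hk0 : k = 0
      · simp [hk, hk0, Set.indicator, mul_comm]
      · simp [hk, hk0, Set.indicator, hd.ne']
    rw [integral_congr_ae h1, integral_const_mul, integral_indicator (by measurability),
      ← mul_assoc, ← Complex.ofReal_mul]
    have : (d / (2 * Real.pi) * (2 * Real.pi / d) : ℝ) = 1 := by
      have := Real.pi_pos
      field_simp
    rw [this, Complex.ofReal_one, one_mul]
  · have : IsFiniteMeasure (volume.restrict (Set.uIoc (-(Real.pi / d)) (Real.pi / d))) :=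
      ⟨by simp [Set.uIoc]⟩
    have hb : Integrable (fun p : ℝ × Ω => V p.2)
        ((volume.restrict (Set.uIoc (-(Real.pi / d)) (Real.pi / d))).prod P) :=
      hV.comp_snd _
    refine hb.mono ?_ (.of_forall fun p => ?_)
    · refine hb.aestronglyMeasurable.mul ?_
      have hm : Measurable fun p : ℝ × Ω => Complex.exp (p.1 * Y p.2 * Complex.I) := by
        have : Measurable fun p : ℝ × Ω => ((Y p.2 : ℤ) : ℂ) :=
          (measurable_from_top (f := fun k : ℤ => (k : ℂ))).comp (hY.comp measurable_snd)
        fun_prop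
      exact hm.aestronglyMeasurable
    · simp only [Function.uncurry, norm_mul]
      rw [show (p.1 : ℂ) * (Y p.2 : ℂ) = ((p.1 * Y p.2 : ℝ) : ℂ) by push_cast; rfl,
        Complex.norm_exp_ofReal_mul_I, mul_one]

end Fourier

namespace IsCriticalSequence

variable {Ω : Type*} [MeasurableSpace Ω] {P : Measure Ω} [IsProbabilityMeasure P]
  {X : ℕ → Ω → ℕ} {σ2 : ℝ} (hX : IsCriticalSequence P X σ2)
include hX

omit [IsProbabilityMeasure P] in
lemma ae_dvd {d : ℕ} (hd : IsSpan P (X 0) d) : ∀ᵐ ω ∂P, ∀ i, d ∣ X i ω := by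
  refine ae_all_iff.2 fun i => ?_
  have h : ∀ k : ℕ, ∀ᵐ ω ∂P, X i ω = k → d ∣ k := by
    intro k
    by_cases hk : P {ω | X 0 ω = k} = 0
    · have : P {ω | X i ω = k} = 0 :=
        ((hX.ident i).measure_mem_eq (measurableSet_singleton k)).trans hk
      filter_upwards [measure_eq_zero_iff_ae_notMem.1 this] with ω hω h
      exact (hω h).elim
    · exact .of_forall fun _ _ => hd.dvd k hk
  filter_upwards [ae_all_iff.2 h] with ω hω
  exact hω _ rfl

omit [IsProbabilityMeasure P] in
lemma measurable_real (i : ℕ) : Measurable fun ω => (X i ω : ℝ) :=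
  (measurable_from_top (f := fun k : ℕ => (k : ℝ))).comp (hX.measurable i)

omit [IsProbabilityMeasure P] in
/-- The characteristic function of a sum of centred offspring variables. -/
lemma integral_exp_sum (A : Finset ℕ) (t : ℝ) :
    ∫ ω, Complex.exp (t * ((∑ i ∈ A, ((X i ω : ℝ) - 1) : ℝ) : ℂ) * Complex.I) ∂P
      = charFun (P.map fun ω => (X 0 ω : ℝ) - 1) t ^ A.card := by
  have hm : ∀ i, Measurable fun ω => (X i ω : ℝ) - 1 := fun i => (hX.measurable_real i).sub_const 1
  have hind : iIndepFun (fun i ω => (X i ω : ℝ) - 1) P :=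
    hX.indep.comp (fun _ (k : ℕ) => (k : ℝ) - 1) fun _ => measurable_from_top
  have h1 := congrFun ((hind.restrict A).charFun_map_fun_finsetSum_eq_prod (s := A)
    (fun i _ => (hm i).aemeasurable)) t
  rw [charFun_apply_real, integral_map
    (Finset.measurable_fun_sum _ fun i _ => hm i).aemeasurable (by fun_prop)] at h1
  rw [h1, Finset.prod_apply, Finset.prod_congr rfl (g := fun _ =>
    charFun (P.map fun ω => (X 0 ω : ℝ) - 1) t), Finset.prod_const]
  intro i _
  have := ((hX.ident i).comp (u := fun k : ℕ => (k : ℝ) - 1) measurable_from_top).map_eq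
  simp only [Function.comp_def] at this
  rw [this]

/-- A sum of `k` independent offspring variables takes no value with probability more than a
constant times `k ^ (-1/2)`. -/
lemma exists_measure_sum_eq_le :
    ∃ C : ℝ, 0 < C ∧ ∀ A : Finset ℕ, A.Nonempty → ∀ a : ℕ,
      P {ω | ∑ i ∈ A, X i ω = a} ≤ ENNReal.ofReal (C / Real.sqrt A.card) := by
  obtain ⟨d, hd⟩ := hX.exists_isSpan
  obtain ⟨c, hc, hφ⟩ := hX.exists_norm_charFun_le hd
  have hd0 : (0 : ℝ) < d := by exact_mod_cast hd.pos
  have hπ := Real.pi_pos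
  refine ⟨d / (2 * Real.pi) * Real.sqrt (Real.pi / c), by positivity, fun A hA a => ?_⟩
  have hcard : (0 : ℝ) < A.card := by exact_mod_cast hA.card_pos
  by_cases hda : d ∣ a
  swap
  · refine le_of_eq_of_le (measure_eq_zero_iff_ae_notMem.2 ?_) zero_le
    filter_upwards [hX.ae_dvd hd] with ω hω h
    exact hda (h ▸ Finset.dvd_sum fun i _ => hω i)
  let Y : Ω → ℤ := fun ω => ((∑ i ∈ A, X i ω : ℕ) : ℤ) - a
  have hYm : Measurable Y := by
    have : Measurable fun ω => ∑ i ∈ A, X i ω :=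
      Finset.measurable_fun_sum _ fun i _ => hX.measurable i
    exact (measurable_from_top (f := fun k : ℕ => (k : ℤ) - a)).comp this
  have hYd : ∀ᵐ ω ∂P, (d : ℤ) ∣ Y ω := by
    filter_upwards [hX.ae_dvd hd] with ω hω
    exact dvd_sub (Int.natCast_dvd_natCast.2 (Finset.dvd_sum fun i _ => hω i))
      (Int.natCast_dvd_natCast.2 hda)
  have hinv := setIntegral_eq_integral_exp hd.pos hYm hYd (integrable_const (1 : ℂ))
  have hset : {ω | Y ω = 0} = {ω | ∑ i ∈ A, X i ω = a} := by
    ext ω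
    simp only [Y, Set.mem_ofPred_eq, sub_eq_zero]
    exact_mod_cast Iff.rfl
  rw [hset, setIntegral_const] at hinv
  have hchar : ∀ t : ℝ, ∫ ω, (1 : ℂ) * Complex.exp (t * Y ω * Complex.I) ∂P
      = Complex.exp (t * (A.card - a : ℝ) * Complex.I)
        * charFun (P.map fun ω => (X 0 ω : ℝ) - 1) t ^ A.card := by
    intro t
    rw [← hX.integral_exp_sum A t, ← integral_const_mul]
    refine integral_congr_ae (.of_forall fun ω => ?_)
    simp only [one_mul, Y]
    rw [← Complex.exp_add]
    congr 1
    push_cast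
    rw [Finset.sum_sub_distrib]
    simp only [Finset.sum_const, nsmul_eq_mul, mul_one]
    ring
  simp only [hchar] at hinv
  have hbound : ‖∫ t in (-(Real.pi / d))..(Real.pi / d),
      Complex.exp (t * (A.card - a : ℝ) * Complex.I)
        * charFun (P.map fun ω => (X 0 ω : ℝ) - 1) t ^ A.card‖
      ≤ Real.sqrt (Real.pi / c) / Real.sqrt A.card := by
    have hle : -(Real.pi / d) ≤ Real.pi / d := by
      have : 0 < Real.pi / d := by positivity
      linarith
    have hint : Integrable fun t : ℝ => Real.exp (-(c * A.card) * t ^ 2) :=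
      integrable_exp_neg_mul_sq (by positivity)
    rw [intervalIntegral.integral_of_le hle]
    calc _ ≤ ∫ t in Set.Ioc (-(Real.pi / d)) (Real.pi / d), Real.exp (-(c * A.card) * t ^ 2) := by
          refine norm_integral_le_of_norm_le hint.integrableOn ?_
          refine (ae_restrict_iff' measurableSet_Ioc).2 (.of_forall fun t ht => ?_)
          rw [norm_mul, ← Complex.ofReal_mul, Complex.norm_exp_ofReal_mul_I, one_mul, norm_pow]
          calc _ ≤ Real.exp (-(c * t ^ 2)) ^ A.card :=
                pow_le_pow_left₀ (norm_nonneg _) (hφ t (abs_le.2 ⟨ht.1.le, ht.2⟩)) _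
            _ = _ := by
                rw [← Real.exp_nat_mul]
                congr 1
                ring
      _ ≤ ∫ t : ℝ, Real.exp (-(c * A.card) * t ^ 2) :=
          setIntegral_le_integral hint (.of_forall fun t => (Real.exp_pos _).le)
      _ = _ := by
          rw [integral_gaussian, ← div_div, Real.sqrt_div' _ hcard.le]
  have h2 : P.real {ω | ∑ i ∈ A, X i ω = a}
      ≤ d / (2 * Real.pi) * (Real.sqrt (Real.pi / c) / Real.sqrt A.card) := by
    have h3 := congrArg norm hinv
    rw [norm_mul, norm_smul, Complex.norm_real, norm_one, mul_one,
      Real.norm_of_nonneg measureReal_nonneg, Real.norm_of_nonneg (by positivity)] at h3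
    rw [h3]
    exact mul_le_mul_of_nonneg_left hbound (by positivity)
  rw [← mul_div_assoc] at h2
  exact (ENNReal.le_ofReal_iff_toReal_le (measure_ne_top _ _) (by positivity)).2 h2

end IsCriticalSequence

/-! ### Local functions of an independent sequence and their fourth moments -/

/-- The sequence of random variables `X`, read from position `i`. -/
def shiftSeq {Ω : Type*} (X : ℕ → Ω → ℕ) (i : ℕ) (ω : Ω) : ℕ → ℕ := fun k => X (i + k) ω

section Local

variable {Ω : Type*} [MeasurableSpace Ω] {P : Measure Ω} {X : ℕ → Ω → ℕ} {σ2 : ℝ}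
  {β γ : Type*} [MeasurableSpace β] [MeasurableSpace γ]

/-- The sequence that agrees with `x` on `A` and vanishes elsewhere. -/
def extendZero (A : Finset ℕ) (x : A → ℕ) : ℕ → ℕ := fun i => if h : i ∈ A then x ⟨i, h⟩ else 0

omit [MeasurableSpace β] in
lemma DependsOn.apply_extendZero {F : (ℕ → ℕ) → β} {A : Finset ℕ} (hF : DependsOn F (A : Set ℕ))
    (x : ℕ → ℕ) : F (extendZero A fun i => x i) = F x :=
  hF fun i hi => by
    have : i ∈ A := hi
    simp [extendZero, this]

/-- A function of finitely many discrete variables is measurable. -/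
lemma DependsOn.measurable_discrete {F : (ℕ → ℕ) → β} {A : Finset ℕ}
    (hF : DependsOn F (A : Set ℕ)) : Measurable F := by
  have h1 : F = (fun x : A → ℕ => F (extendZero A x)) ∘ fun (x : ℕ → ℕ) (i : A) => x i :=
    funext fun x => (hF.apply_extendZero x).symm
  rw [h1]
  exact (Measurable.of_discrete).comp (measurable_pi_lambda _ fun i => measurable_pi_apply _)

lemma indepFun_of_dependsOn {F : (ℕ → ℕ) → β} {G : (ℕ → ℕ) → γ} {A B : Finset ℕ}
    (hX : ∀ i, Measurable (X i)) (hind : iIndepFun X P) (hF : DependsOn F (A : Set ℕ))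
    (hG : DependsOn G (B : Set ℕ)) (hAB : Disjoint A B) :
    IndepFun (fun ω => F (X · ω)) (fun ω => G (X · ω)) P := by
  have h := (hind.indepFun_finset A B hAB hX).comp
    (φ := fun x => F (extendZero A x)) (ψ := fun x => G (extendZero B x))
    Measurable.of_discrete Measurable.of_discrete
  have e1 : (fun x => F (extendZero A x)) ∘ (fun (ω : Ω) (i : A) => X i ω)
      = fun ω => F (X · ω) := funext fun ω => hF.apply_extendZero (X · ω)
  have e2 : (fun x => G (extendZero B x)) ∘ (fun (ω : Ω) (i : B) => X i ω)
      = fun ω => G (X · ω) := funext fun ω => hG.apply_extendZero (X · ω)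
  rwa [e1, e2] at h

omit [MeasurableSpace β] [MeasurableSpace Ω] in
lemma DependsOn.comp_shift {F : (ℕ → ℕ) → β} {m : ℕ} (hF : DependsOn F (Set.Iio m)) (i : ℕ) :
    DependsOn (fun x : ℕ → ℕ => F fun k => x (i + k)) (Finset.Ico i (i + m) : Set ℕ) :=
  fun x y h => hF fun k hk => h _ (by
    have : k < m := hk
    simp only [Finset.coe_Ico, Set.mem_Ico]
    omega)

lemma DependsOn.measurable_shiftSeq {F : (ℕ → ℕ) → β} {m : ℕ} (hF : DependsOn F (Set.Iio m))
    (hX : ∀ i, Measurable (X i)) (i : ℕ) : Measurable fun ω => F (shiftSeq X i ω) := by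
  have h1 : DependsOn F ((Finset.range m : Finset ℕ) : Set ℕ) := by simpa using hF
  exact h1.measurable_discrete.comp (measurable_pi_lambda _ fun k => hX (i + k))

/-- Functions of disjoint blocks of length `m` are independent. -/
lemma iIndepFun_blocks {F : (ℕ → ℕ) → β} {m : ℕ} (hm : 0 < m) (hF : DependsOn F (Set.Iio m))
    (hX : ∀ i, Measurable (X i)) (hind : iIndepFun X P) (r : ℕ) :
    iIndepFun (fun j ω => F (shiftSeq X (r + j * m) ω)) P := by
  have hF' : DependsOn F ((Finset.range m : Finset ℕ) : Set ℕ) := by simpa using hF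
  have hinj : Function.Injective fun p : ℕ × Finset.range m => r + p.1 * m + p.2 := by
    rintro ⟨a, ⟨b, hb⟩⟩ ⟨a', ⟨b', hb'⟩⟩ h
    simp only [Finset.mem_range] at hb hb' h
    have h1 : a * m + b = a' * m + b' := by omega
    have h2 : a = a' := by
      have := congrArg (· / m) h1
      simpa [Nat.add_div hm, Nat.div_eq_of_lt hb, Nat.div_eq_of_lt hb', Nat.mod_eq_of_lt hb,
        Nat.mod_eq_of_lt hb', Nat.mul_div_cancel _ hm, hb.not_ge, hb'.not_ge] using this
    subst h2
    simp only [Prod.mk.injEq, Subtype.mk.injEq, true_and]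
    omega
  have h := (hind.curry hX (g := fun (j : ℕ) (k : Finset.range m) => r + j * m + k) hinj).comp
    (fun _ x => F (extendZero (Finset.range m) x)) fun _ => Measurable.of_discrete
  convert! h using 3 with j ω
  exact (hF'.apply_extendZero (shiftSeq X (r + j * m) ω)).symm

/-- An independent and identically distributed sequence is stationary. -/
lemma identDistrib_shiftSeq (hX : ∀ i, Measurable (X i)) (hind : iIndepFun X P)
    (hid : ∀ i, IdentDistrib (X i) (X 0) P P) (i : ℕ) :
    IdentDistrib (shiftSeq X i) (shiftSeq X 0) P P := by
  have h : ∀ i, P.map (shiftSeq X i) = Measure.infinitePi fun _ : ℕ => P.map (X 0) := by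
    intro i
    have := (hind.precomp (g := fun k => i + k) (add_right_injective i)).map_fun_eq_infinitePi_map
      fun k => hX (i + k)
    simp only [(hid _).map_eq] at this
    exact this
  exact ⟨(measurable_pi_lambda _ fun k => hX (i + k)).aemeasurable,
    (measurable_pi_lambda _ fun k => hX (0 + k)).aemeasurable, by rw [h, h]⟩

/-- `F` is a bounded function of the first `m` terms of a sequence, and its value at the random
sequence `X` has mean zero. -/
structure IsCenteredLocal (P : Measure Ω) (X : ℕ → Ω → ℕ) (F : (ℕ → ℕ) → ℝ) (m : ℕ) (M : ℝ) :
    Prop where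
  pos : 0 < m
  dependsOn : DependsOn F (Set.Iio m)
  bound_pos : 0 < M
  bound : ∀ x, |F x| ≤ M
  mean : ∫ ω, F (shiftSeq X 0 ω) ∂P = 0

end Local

section FourthMoment

variable {Ω : Type*} [MeasurableSpace Ω] {P : Measure Ω} [IsProbabilityMeasure P]

lemma pow_four_le_exp_add_exp_neg (x : ℝ) : x ^ 4 ≤ 24 * (Real.exp x + Real.exp (-x)) := by
  have h := Real.pow_div_factorial_le_exp |x| (abs_nonneg x) 4
  have h1 : |x| ^ 4 = x ^ 4 := by rw [show (4 : ℕ) = 2 * 2 from rfl, pow_mul, pow_mul, sq_abs]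
  rw [h1, show ((Nat.factorial 4 : ℕ) : ℝ) = 24 by norm_num [Nat.factorial]] at h
  have h2 : Real.exp |x| ≤ Real.exp x + Real.exp (-x) := by
    rcases abs_cases x with ⟨h, -⟩ | ⟨h, -⟩ <;> rw [h] <;>
      linarith [Real.exp_pos x, Real.exp_pos (-x)]
  linarith [(div_le_iff₀ (by norm_num : (0 : ℝ) < 24)).1 h]

omit [IsProbabilityMeasure P] in
/-- The fourth moment of a sub-Gaussian random variable. -/
lemma ProbabilityTheory.HasSubgaussianMGF.integral_pow_four_le {W : Ω → ℝ} {c : NNReal}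
    (h : HasSubgaussianMGF W c P) (hc : 0 < c) :
    Integrable (fun ω => W ω ^ 4) P ∧ ∫ ω, W ω ^ 4 ∂P ≤ 96 * (c : ℝ) ^ 2 := by
  set t : ℝ := (Real.sqrt c)⁻¹ with ht
  have hc' : (0 : ℝ) < c := hc
  have ht2 : t ^ 2 = (c : ℝ)⁻¹ := by rw [ht, inv_pow, Real.sq_sqrt hc'.le]
  have h1 : ∀ s : ℝ, s ^ 2 = (c : ℝ)⁻¹ → ∫ ω, Real.exp (s * W ω) ∂P ≤ 2 := by
    intro s hs
    refine (h.mgf_le s).trans ?_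
    rw [hs, mul_inv_cancel₀ hc'.ne']
    have h3 : Real.exp (1 / 2) ^ 2 = Real.exp 1 := by
      rw [← Real.exp_nat_mul]
      norm_num
    nlinarith [Real.exp_one_lt_d9, Real.exp_pos (1 / 2)]
  have hpt : ∀ ω, W ω ^ 4 ≤ 24 * c ^ 2 * (Real.exp (t * W ω) + Real.exp (-t * W ω)) := by
    intro ω
    have h3 := pow_four_le_exp_add_exp_neg (t * W ω)
    have h4 : (t * W ω) ^ 4 = (c : ℝ)⁻¹ ^ 2 * W ω ^ 4 := by rw [← ht2]; ring
    rw [h4] at h3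
    have h5 := mul_le_mul_of_nonneg_left h3 (sq_nonneg (c : ℝ))
    rw [← mul_assoc, ← mul_pow, mul_inv_cancel₀ hc'.ne', one_pow, one_mul] at h5
    rw [neg_mul]
    linarith
  have hint :=
    ((h.integrable_exp_mul t).add (h.integrable_exp_mul (-t))).const_mul (24 * (c : ℝ) ^ 2)
  have hint4 : Integrable (fun ω => W ω ^ 4) P := by
    refine hint.mono' (h.aemeasurable.pow_const 4).aestronglyMeasurable (.of_forall fun ω => ?_)
    rw [Real.norm_of_nonneg (by positivity)]
    exact hpt ω
  refine ⟨hint4, (integral_mono hint4 hint hpt).trans ?_⟩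
  rw [integral_const_mul]
  have h6 : ∫ ω, (Real.exp (t * W ω) + Real.exp (-t * W ω)) ∂P ≤ 4 := by
    rw [integral_add (h.integrable_exp_mul t) (h.integrable_exp_mul (-t))]
    linarith [h1 t ht2, h1 (-t) (by rw [neg_sq, ht2])]
  have := mul_le_mul_of_nonneg_left h6 (by positivity : (0 : ℝ) ≤ 24 * (c : ℝ) ^ 2)
  simp only [Pi.add_apply]
  linarith

lemma sum_pow_four_le {ι : Type*} (s : Finset ι) (f : ι → ℝ) :
    (∑ i ∈ s, f i) ^ 4 ≤ (s.card : ℝ) ^ 3 * ∑ i ∈ s, f i ^ 4 := by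
  have h1 := sq_sum_le_card_mul_sum_sq (s := s) (f := f)
  have h2 := sq_sum_le_card_mul_sum_sq (s := s) (f := fun i => f i ^ 2)
  have h3 : (∑ i ∈ s, f i) ^ 4 = ((∑ i ∈ s, f i) ^ 2) ^ 2 := by ring
  have h4 : ∑ i ∈ s, f i ^ 4 = ∑ i ∈ s, (f i ^ 2) ^ 2 :=
    Finset.sum_congr rfl fun i _ => by ring
  rw [h3, h4]
  calc _ ≤ ((s.card : ℝ) * ∑ i ∈ s, f i ^ 2) ^ 2 := pow_le_pow_left₀ (sq_nonneg _) h1 2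
    _ = (s.card : ℝ) ^ 2 * (∑ i ∈ s, f i ^ 2) ^ 2 := by ring
    _ ≤ (s.card : ℝ) ^ 2 * ((s.card : ℝ) * ∑ i ∈ s, (f i ^ 2) ^ 2) :=
        mul_le_mul_of_nonneg_left h2 (by positivity)
    _ = _ := by ring

namespace IsCenteredLocal

variable {X : ℕ → Ω → ℕ} {F : (ℕ → ℕ) → ℝ} {m : ℕ} {M : ℝ}

omit [IsProbabilityMeasure P] in
lemma measurable (hF : IsCenteredLocal P X F m M) (hX : ∀ i, Measurable (X i)) (i : ℕ) :
    Measurable fun ω => F (shiftSeq X i ω) := hF.dependsOn.measurable_shiftSeq hX i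

omit [IsProbabilityMeasure P] in
lemma measurable_fun (hF : IsCenteredLocal P X F m M) : Measurable F := by
  have h1 : DependsOn F ((Finset.range m : Finset ℕ) : Set ℕ) := by simpa using hF.dependsOn
  exact h1.measurable_discrete

omit [IsProbabilityMeasure P] in
lemma abs_sum_le (hF : IsCenteredLocal P X F m M) (B : Finset ℕ) (ω : Ω) :
    |∑ i ∈ B, F (shiftSeq X i ω)| ≤ B.card * M := by
  refine (Finset.abs_sum_le_sum_abs _ _).trans ?_
  simpa using Finset.sum_le_sum fun i (_ : i ∈ B) => hF.bound (shiftSeq X i ω)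

lemma integrable_sum_pow (hF : IsCenteredLocal P X F m M) (hX : ∀ i, Measurable (X i))
    (B : Finset ℕ) (k : ℕ) : Integrable (fun ω => (∑ i ∈ B, F (shiftSeq X i ω)) ^ k) P := by
  refine Integrable.of_bound (C := (B.card * M) ^ k) ?_ (.of_forall fun ω => ?_)
  · exact ((Finset.measurable_fun_sum _ fun i _ =>
      hF.measurable hX i).pow_const k).aestronglyMeasurable
  · rw [norm_pow]
    exact pow_le_pow_left₀ (norm_nonneg _) (hF.abs_sum_le B ω) k

/-- Sums of a centred local function over sets of positions have fourth moments of the order of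
the square of the number of positions: positions in the same residue class modulo the range give
independent variables. -/
lemma integral_sum_pow_four_le (hF : IsCenteredLocal P X F m M) (hX : ∀ i, Measurable (X i))
    (hind : iIndepFun X P) (hid : ∀ i, IdentDistrib (X i) (X 0) P P) (B : Finset ℕ) :
    ∫ ω, (∑ i ∈ B, F (shiftSeq X i ω)) ^ 4 ∂P
      ≤ (m : ℝ) ^ 4 * (96 * (M ^ 2) ^ 2) * (B.card : ℝ) ^ 2 := by
  classical
  -- the quotients `i / m` of the positions `i` with residue `r`
  let B' : ℕ → Finset ℕ := fun r => (B.filter fun i => i % m = r).image (· / m)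
  have hinj : ∀ r, Set.InjOn (· / m) ((B.filter fun i => i % m = r : Finset ℕ) : Set ℕ) := by
    intro r a ha b hb hab
    simp only [Finset.coe_filter, Set.mem_ofPred_eq] at ha hb hab
    rw [← Nat.div_add_mod a m, ← Nat.div_add_mod b m, ha.2, hb.2, hab]
  have hsplit : ∀ ω, ∑ i ∈ B, F (shiftSeq X i ω)
      = ∑ r ∈ Finset.range m, ∑ j ∈ B' r, F (shiftSeq X (r + j * m) ω) := by
    intro ω
    rw [← Finset.sum_fiberwise_of_maps_to (t := Finset.range m) (g := fun i => i % m)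
      fun i _ => Finset.mem_range.2 (Nat.mod_lt _ hF.pos)]
    refine Finset.sum_congr rfl fun r _ => ?_
    rw [Finset.sum_image (hinj r)]
    refine Finset.sum_congr rfl fun i hi => ?_
    rw [← (Finset.mem_filter.1 hi).2, mul_comm, Nat.mod_add_div]
  have hcard : ∀ r, (B' r).card ≤ B.card := fun r =>
    Finset.card_image_le.trans (Finset.card_filter_le _ _)
  have hM := hF.bound_pos
  have hr : ∀ r, Integrable (fun ω => (∑ j ∈ B' r, F (shiftSeq X (r + j * m) ω)) ^ 4) P ∧
      ∫ ω, (∑ j ∈ B' r, F (shiftSeq X (r + j * m) ω)) ^ 4 ∂P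
        ≤ 96 * (M ^ 2) ^ 2 * (B.card : ℝ) ^ 2 := by
    intro r
    rcases (B' r).eq_empty_or_nonempty with he | hne
    · simp only [he, Finset.sum_empty]
      refine ⟨by simp, ?_⟩
      simp only [ne_eq, OfNat.ofNat_ne_zero, not_false_eq_true, zero_pow, integral_zero]
      positivity
    have hsub : ∀ j ∈ B' r, HasSubgaussianMGF (fun ω => F (shiftSeq X (r + j * m) ω))
        ((‖M - -M‖₊ / 2) ^ 2) P := by
      intro j _
      refine hasSubgaussianMGF_of_mem_Icc_of_integral_eq_zero (hF.measurable hX _).aemeasurable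
        (.of_forall fun ω => abs_le.1 (hF.bound _)) ?_
      have := ((identDistrib_shiftSeq hX hind hid (r + j * m)).comp hF.measurable_fun).integral_eq
      exact this.trans hF.mean
    have h := HasSubgaussianMGF.sum_of_iIndepFun
      (iIndepFun_blocks hF.pos hF.dependsOn hX hind r) hsub
    have hnorm : ((‖M - -M‖₊ / 2 : NNReal) : ℝ) = M := by
      rw [NNReal.coe_div, coe_nnnorm, Real.norm_of_nonneg (by linarith)]
      norm_num
    have hcoe : ((∑ _j ∈ B' r, (‖M - -M‖₊ / 2) ^ 2 : NNReal) : ℝ) = (B' r).card * M ^ 2 := by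
      rw [Finset.sum_const, nsmul_eq_mul, NNReal.coe_mul, NNReal.coe_pow, hnorm,
        NNReal.coe_natCast]
    have hc : 0 < ∑ _j ∈ B' r, (‖M - -M‖₊ / 2) ^ 2 := by
      rw [← NNReal.coe_pos, hcoe]
      have : (0 : ℝ) < (B' r).card := by exact_mod_cast hne.card_pos
      positivity
    obtain ⟨h1, h2⟩ := h.integral_pow_four_le hc
    refine ⟨h1, h2.trans ?_⟩
    rw [hcoe, mul_pow, mul_comm (((B' r).card : ℝ) ^ 2), ← mul_assoc]
    refine mul_le_mul_of_nonneg_left ?_ (by positivity)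
    exact pow_le_pow_left₀ (by positivity) (by exact_mod_cast hcard r) 2
  have hsum : Integrable (fun ω => (m : ℝ) ^ 3 * ∑ r ∈ Finset.range m,
      (∑ j ∈ B' r, F (shiftSeq X (r + j * m) ω)) ^ 4) P :=
    (integrable_finsetSum _ fun r _ => (hr r).1).const_mul _
  calc _ ≤ ∫ ω, (m : ℝ) ^ 3 * ∑ r ∈ Finset.range m,
        (∑ j ∈ B' r, F (shiftSeq X (r + j * m) ω)) ^ 4 ∂P := by
        refine integral_mono (hF.integrable_sum_pow hX B 4) hsum fun ω => ?_
        simp only [hsplit]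
        simpa using sum_pow_four_le (Finset.range m)
          fun r => ∑ j ∈ B' r, F (shiftSeq X (r + j * m) ω)
    _ = (m : ℝ) ^ 3 * ∑ r ∈ Finset.range m,
        ∫ ω, (∑ j ∈ B' r, F (shiftSeq X (r + j * m) ω)) ^ 4 ∂P := by
        rw [integral_const_mul, integral_finsetSum _ fun r _ => (hr r).1]
    _ ≤ (m : ℝ) ^ 3 * ∑ r ∈ Finset.range m, 96 * (M ^ 2) ^ 2 * (B.card : ℝ) ^ 2 :=
        mul_le_mul_of_nonneg_left (Finset.sum_le_sum fun r _ => (hr r).2) (by positivity)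
    _ = _ := by
        rw [Finset.sum_const, Finset.card_range, nsmul_eq_mul]
        ring

end IsCenteredLocal

end FourthMoment

/-! ### Moments of local sums given the total sum -/

namespace IsCriticalSequence

variable {Ω : Type*} [MeasurableSpace Ω] {P : Measure Ω} [IsProbabilityMeasure P]
  {X : ℕ → Ω → ℕ} {σ2 : ℝ} (hX : IsCriticalSequence P X σ2)
include hX

/-- Restricted to the event that the total sum is `n - 1`, the law of the variables with index in
`A` has a density at most of order `|B| ^ (-1/2)` with respect to their unconditional law, where `B`
is the set of the remaining indices. The event has probability of order `n ^ (-1/2)`, so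
conditioning on it costs only a constant factor if `B` is a fixed proportion of the indices. -/
lemma exists_setIntegral_bridgeEvent_le :
    ∃ C : ℝ, 0 < C ∧ ∀ (n : ℕ) (A B : Finset ℕ), Disjoint A B → A ∪ B = Finset.range n →
      B.Nonempty → ∀ G : (ℕ → ℕ) → ℝ, DependsOn G (A : Set ℕ) → (∀ x, 0 ≤ G x) →
        Integrable (fun ω => G (X · ω)) P →
        ∫ ω in bridgeEvent X n, G (X · ω) ∂P
          ≤ C / Real.sqrt B.card * ∫ ω, G (X · ω) ∂P := by
  obtain ⟨C, hC, hbound⟩ := hX.exists_measure_sum_eq_le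
  refine ⟨C, hC, fun n A B hAB hn hB G hG hG0 hint => ?_⟩
  have hn0 : 0 < n := by
    obtain ⟨b, hb⟩ := hB
    have : b ∈ Finset.range n := hn ▸ Finset.mem_union_right _ hb
    exact (Nat.zero_le b).trans_lt (Finset.mem_range.1 this)
  let U : Ω → A → ℕ := fun ω i => X i ω
  let Y : Ω → ℕ := fun ω => ∑ i ∈ B, X i ω
  let s : (A → ℕ) → ℕ := fun u => ∑ i, u i
  let g : (A → ℕ) → ENNReal := fun u => ENNReal.ofReal (G (extendZero A u))
  have hU : Measurable U := measurable_pi_lambda _ fun i => hX.measurable i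
  have hY : Measurable Y := Finset.measurable_fun_sum _ fun i _ => hX.measurable i
  have hind : IndepFun U Y P := by
    have h := (hX.indep.indepFun_finset A B hAB hX.measurable).comp
      (φ := id) (ψ := fun u => ∑ i, u i) measurable_id Measurable.of_discrete
    have e : (fun u : B → ℕ => ∑ i, u i) ∘ (fun (ω : Ω) (i : B) => X i ω) = Y :=
      funext fun ω => Finset.sum_coe_sort B fun i => X i ω
    rwa [e] at h
  have hset : bridgeEvent X n = {ω | s (U ω) + Y ω = n - 1} := by
    ext ω
    simp only [bridgeEvent, s, U, Y, Set.mem_ofPred_eq]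
    rw [← hn, Finset.sum_union hAB, Finset.sum_coe_sort A fun i => X i ω]
    omega
  have hgU : ∀ ω, g (U ω) = ENNReal.ofReal (G (X · ω)) := fun ω => by
    simp only [g, U, hG.apply_extendZero (X · ω)]
  have key := lintegral_setOf_add_eq_le hU hY hind (s := s) Measurable.of_discrete (g := g)
    Measurable.of_discrete (hbound B hB) (n - 1)
  rw [← hset] at key
  simp only [hgU] at key
  rw [← ofReal_integral_eq_lintegral_ofReal hint.integrableOn (.of_forall fun ω => hG0 _),
    ← ofReal_integral_eq_lintegral_ofReal hint (.of_forall fun ω => hG0 _),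
    ← ENNReal.ofReal_mul (by positivity)] at key
  refine (ENNReal.ofReal_le_ofReal_iff ?_).1 key
  exact mul_nonneg (by positivity) (integral_nonneg fun ω => hG0 _)

/-- Fourth moments of local sums on the event that the total sum is `n - 1`. The windows inside one
half of the positions are independent of the other half, which smooths the total sum; the windows
that lie in neither half are boundedly many. -/
lemma exists_setIntegral_sum_pow_four_le {F : (ℕ → ℕ) → ℝ} {m : ℕ} {M : ℝ}
    (hF : IsCenteredLocal P X F m M) :
    ∃ C : ℝ, 0 < C ∧ ∀ n, 2 ≤ n → ∀ B ⊆ Finset.range n,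
      ∫ ω in bridgeEvent X n, (∑ i ∈ B, F (shiftSeq X i ω)) ^ 4 ∂P
        ≤ C * ((B.card : ℝ) ^ 2 + 1) / Real.sqrt n := by
  classical
  obtain ⟨C, hC, hdens⟩ := hX.exists_setIntegral_bridgeEvent_le
  obtain ⟨C', hC', hbound⟩ := hX.exists_measure_sum_eq_le
  set D : ℝ := (m : ℝ) ^ 4 * (96 * (M ^ 2) ^ 2) with hD
  have hm : (0 : ℝ) < m := by exact_mod_cast hF.pos
  have hM := hF.bound_pos
  have hD0 : 0 < D := by positivity
  refine ⟨27 * (2 * (C * 2 * D) + C' * (2 * m * M) ^ 4), by positivity, fun n hn B hB => ?_⟩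
  have hn0 : (0 : ℝ) < n := by exact_mod_cast (by omega : 0 < n)
  have hsq : 0 < Real.sqrt n := Real.sqrt_pos.2 hn0
  set h := n / 2 with hh
  -- windows inside the first half, windows inside the second half, and the few others
  set B₁ := B.filter fun i => i + m ≤ h with hB₁
  set B₂ := B.filter fun i => h ≤ i ∧ i + m ≤ n with hB₂
  set B₃ := B.filter fun i => ¬ (i + m ≤ h) ∧ ¬ (h ≤ i ∧ i + m ≤ n) with hB₃
  have hcard₃ : (B₃.card : ℝ) ≤ 2 * m := by
    have hsub : B₃ ⊆ Finset.Ico (h - m) h ∪ Finset.Ico (n - m) n := by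
      intro i hi
      simp only [hB₃, Finset.mem_filter] at hi
      have := Finset.mem_range.1 (hB hi.1)
      simp only [Finset.mem_union, Finset.mem_Ico]
      omega
    have h1 := (Finset.card_le_card hsub).trans (Finset.card_union_le _ _)
    rw [Nat.card_Ico, Nat.card_Ico] at h1
    have : B₃.card ≤ 2 * m := by omega
    exact_mod_cast this
  have hsplit : ∀ ω, ∑ i ∈ B, F (shiftSeq X i ω) = ∑ i ∈ B₁, F (shiftSeq X i ω)
      + ∑ i ∈ B₂, F (shiftSeq X i ω) + ∑ i ∈ B₃, F (shiftSeq X i ω) := by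
    intro ω
    simp only [hB₁, hB₂, hB₃, Finset.sum_filter, ← Finset.sum_add_distrib]
    refine Finset.sum_congr rfl fun i _ => ?_
    have := hF.pos
    by_cases h1 : i + m ≤ h
    · simp [h1, show ¬ (h ≤ i ∧ i + m ≤ n) by omega]
    · by_cases h2 : h ≤ i ∧ i + m ≤ n <;> simp [h1, h2]
  have hpow : ∀ a b c : ℝ, (a + b + c) ^ 4 ≤ 27 * (a ^ 4 + b ^ 4 + c ^ 4) := by
    intro a b c
    have := sum_pow_four_le Finset.univ ![a, b, c]
    simp only [Fin.sum_univ_three, Finset.card_univ, Fintype.card_fin] at this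
    norm_num at this
    exact this
  have hdep : ∀ (B' A : Finset ℕ), (∀ i ∈ B', Finset.Ico i (i + m) ⊆ A) →
      DependsOn (fun x : ℕ → ℕ => (∑ i ∈ B', F fun k => x (i + k)) ^ 4) (A : Set ℕ) := by
    intro B' A hA x y hxy
    simp only
    congr 1
    refine Finset.sum_congr rfl fun i hi => ?_
    exact hF.dependsOn.comp_shift i fun k hk => hxy k (hA i hi hk)
  have hcardB : ∀ B' ⊆ B, (B'.card : ℝ) ^ 2 ≤ (B.card : ℝ) ^ 2 := fun B' hB' =>
    pow_le_pow_left₀ (by positivity) (by exact_mod_cast Finset.card_le_card hB') 2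
  have hhalf : ∀ (B' A A' : Finset ℕ), B' ⊆ B → Disjoint A A' → A ∪ A' = Finset.range n →
      n ≤ 4 * A'.card → (∀ i ∈ B', Finset.Ico i (i + m) ⊆ A) →
      ∫ ω in bridgeEvent X n, (∑ i ∈ B', F (shiftSeq X i ω)) ^ 4 ∂P
        ≤ C * 2 * D * (B.card : ℝ) ^ 2 / Real.sqrt n := by
    intro B' A A' hB' hAA hun hle hsub
    have hpos : 0 < A'.card := by omega
    have h1 := hdens n A A' hAA hun (Finset.card_pos.1 hpos) _ (hdep B' A hsub)
      (fun x => by positivity) (hF.integrable_sum_pow hX.measurable B' 4)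
    have h2 := hF.integral_sum_pow_four_le hX.measurable hX.indep hX.ident B'
    have h3 : C / Real.sqrt A'.card ≤ C * 2 / Real.sqrt n := by
      have h4 : Real.sqrt n ≤ 2 * Real.sqrt A'.card := by
        rw [Real.sqrt_le_left (by positivity), mul_pow, Real.sq_sqrt (by positivity)]
        norm_num
        exact_mod_cast hle
      have h5 : 0 < Real.sqrt A'.card := Real.sqrt_pos.2 (by exact_mod_cast hpos)
      rw [div_le_div_iff₀ h5 hsq, mul_assoc]
      exact mul_le_mul_of_nonneg_left h4 hC.le
    calc _ ≤ C / Real.sqrt A'.card * ∫ ω, (∑ i ∈ B', F (shiftSeq X i ω)) ^ 4 ∂P := h1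
      _ ≤ C * 2 / Real.sqrt n * (D * (B.card : ℝ) ^ 2) := by
          refine mul_le_mul h3 (h2.trans ?_) (integral_nonneg fun ω => by positivity)
            (by positivity)
          exact mul_le_mul_of_nonneg_left (hcardB B' hB') hD0.le
      _ = _ := by ring
  have e₁ := hhalf B₁ (Finset.range h) (Finset.Ico h n) (Finset.filter_subset _ _)
    (by rw [Finset.range_eq_Ico]; exact Finset.Ico_disjoint_Ico_consecutive 0 h n)
    (by rw [Finset.range_eq_Ico, Finset.range_eq_Ico]
        exact Finset.Ico_union_Ico_eq_Ico (Nat.zero_le _) (by omega))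
    (by rw [Nat.card_Ico]; omega)
    (fun i hi k hk => by
      have := (Finset.mem_filter.1 hi).2
      rw [Finset.mem_Ico] at hk
      rw [Finset.mem_range]
      omega)
  have e₂ := hhalf B₂ (Finset.Ico h n) (Finset.range h) (Finset.filter_subset _ _)
    (by rw [Finset.range_eq_Ico]; exact (Finset.Ico_disjoint_Ico_consecutive 0 h n).symm)
    (by rw [Finset.union_comm, Finset.range_eq_Ico, Finset.range_eq_Ico]
        exact Finset.Ico_union_Ico_eq_Ico (Nat.zero_le _) (by omega))
    (by rw [Finset.card_range]; omega)
    (fun i hi k hk => by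
      have := (Finset.mem_filter.1 hi).2
      rw [Finset.mem_Ico] at hk ⊢
      omega)
  have e₃ : ∫ ω in bridgeEvent X n, (∑ i ∈ B₃, F (shiftSeq X i ω)) ^ 4 ∂P
      ≤ C' * (2 * m * M) ^ 4 / Real.sqrt n := by
    have h1 : ∀ ω, (∑ i ∈ B₃, F (shiftSeq X i ω)) ^ 4 ≤ (2 * m * M) ^ 4 := by
      intro ω
      have h2 : |∑ i ∈ B₃, F (shiftSeq X i ω)| ≤ 2 * m * M :=
        (hF.abs_sum_le B₃ ω).trans (mul_le_mul_of_nonneg_right hcard₃ hM.le)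
      have h3 := pow_le_pow_left₀ (abs_nonneg _) h2 4
      rwa [← abs_pow, abs_of_nonneg (by positivity)] at h3
    have h4 : P.real (bridgeEvent X n) ≤ C' / Real.sqrt n := by
      have h5 := hbound (Finset.range n) ⟨0, Finset.mem_range.2 (by omega)⟩ (n - 1)
      rw [Finset.card_range] at h5
      have h6 : {ω | ∑ i ∈ Finset.range n, X i ω = n - 1} = bridgeEvent X n := by
        ext ω
        simp only [bridgeEvent, Set.mem_ofPred_eq]
        omega
      rw [h6] at h5
      exact ENNReal.toReal_le_of_le_ofReal (by positivity) h5
    calc _ ≤ ∫ _ω in bridgeEvent X n, (2 * m * M) ^ 4 ∂P :=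
          setIntegral_mono (hF.integrable_sum_pow hX.measurable B₃ 4).integrableOn
            (integrable_const _).integrableOn h1
      _ = P.real (bridgeEvent X n) * (2 * m * M) ^ 4 := by rw [setIntegral_const, smul_eq_mul]
      _ ≤ C' / Real.sqrt n * (2 * m * M) ^ 4 := mul_le_mul_of_nonneg_right h4 (by positivity)
      _ = _ := by ring
  have hi : ∀ B', IntegrableOn (fun ω => (∑ i ∈ B', F (shiftSeq X i ω)) ^ 4) (bridgeEvent X n) P :=
    fun B' => (hF.integrable_sum_pow hX.measurable B' 4).integrableOn
  calc _ ≤ ∫ ω in bridgeEvent X n, 27 * ((∑ i ∈ B₁, F (shiftSeq X i ω)) ^ 4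
        + (∑ i ∈ B₂, F (shiftSeq X i ω)) ^ 4 + (∑ i ∈ B₃, F (shiftSeq X i ω)) ^ 4) ∂P := by
        refine setIntegral_mono (hi B) ((((hi B₁).add (hi B₂)).add (hi B₃)).const_mul 27)
          fun ω => ?_
        simp only [hsplit]
        exact hpow _ _ _
    _ = 27 * (∫ ω in bridgeEvent X n, (∑ i ∈ B₁, F (shiftSeq X i ω)) ^ 4 ∂P
        + ∫ ω in bridgeEvent X n, (∑ i ∈ B₂, F (shiftSeq X i ω)) ^ 4 ∂P
        + ∫ ω in bridgeEvent X n, (∑ i ∈ B₃, F (shiftSeq X i ω)) ^ 4 ∂P) := by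
        have h12 : IntegrableOn (fun ω => (∑ i ∈ B₁, F (shiftSeq X i ω)) ^ 4
          + (∑ i ∈ B₂, F (shiftSeq X i ω)) ^ 4) (bridgeEvent X n) P := (hi B₁).add (hi B₂)
        rw [integral_const_mul, integral_add h12 (hi B₃), integral_add (hi B₁) (hi B₂)]
    _ ≤ 27 * (C * 2 * D * (B.card : ℝ) ^ 2 / Real.sqrt n
        + C * 2 * D * (B.card : ℝ) ^ 2 / Real.sqrt n
        + C' * (2 * m * M) ^ 4 / Real.sqrt n) := by gcongr
    _ = 27 * (2 * (C * 2 * D) * (B.card : ℝ) ^ 2 + C' * (2 * m * M) ^ 4) / Real.sqrt n := by ring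
    _ ≤ _ := by
        refine div_le_div_of_nonneg_right ?_ hsq.le
        have h1 : (0 : ℝ) ≤ 2 * (C * 2 * D) := by positivity
        have h2 : (0 : ℝ) ≤ C' * (2 * m * M) ^ 4 * (B.card : ℝ) ^ 2 := by positivity
        nlinarith

end IsCriticalSequence

/-! ### Sums over independent blocks given the total sum -/

section CharFunPow

variable {Ω : Type*} [MeasurableSpace Ω] {P : Measure Ω} [IsProbabilityMeasure P]

/-- The central limit theorem for characteristic functions, with `k n ∼ κ n` summands and
scaling `√n`. -/
lemma tendsto_charFun_inv_sqrt_pow {Y : Ω → ℝ} (hY : MemLp Y 2 P) (h0 : ∫ ω, Y ω ∂P = 0)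
    {k : ℕ → ℕ} {κ : ℝ} (hk : Tendsto (fun n => (k n : ℝ) / n) atTop (𝓝 κ)) :
    Tendsto (fun n : ℕ => charFun (P.map Y) (Real.sqrt n)⁻¹ ^ k n) atTop
      (𝓝 (Complex.exp (-(κ * ∫ ω, Y ω ^ 2 ∂P : ℝ) / 2))) := by
  set v := ∫ ω, Y ω ^ 2 ∂P with hv
  set g : ℕ → ℂ := fun n => charFun (P.map Y) (Real.sqrt n)⁻¹ - 1 with hg
  have hr : Tendsto (fun n : ℕ => (Real.sqrt n)⁻¹) atTop (𝓝 0) :=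
    (Real.tendsto_sqrt_atTop.comp tendsto_natCast_atTop_atTop).inv_tendsto_atTop
  have hsq : ∀ n : ℕ, n ≠ 0 → (n : ℝ) * ((Real.sqrt n)⁻¹) ^ 2 = 1 := fun n hn => by
    rw [inv_pow, Real.sq_sqrt (by positivity), mul_inv_cancel₀ (by exact_mod_cast hn)]
  have hng : Tendsto (fun n : ℕ => (n : ℂ) * g n) atTop (𝓝 (-(v : ℂ) / 2)) := by
    have h1 := (charFun_sub_isLittleO hY h0).comp_tendsto hr
    have h2 : Tendsto (fun n : ℕ => (n : ℂ) * (charFun (P.map Y) (Real.sqrt n)⁻¹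
        - (1 - ((∫ ω, Y ω ^ 2 ∂P : ℝ) : ℂ) * ((Real.sqrt n)⁻¹ : ℝ) ^ 2 / 2))) atTop (𝓝 0) := by
      have h0 : (fun n : ℕ => (n : ℂ)) =O[atTop] fun n : ℕ => (n : ℝ) :=
        IsBigO.of_norm_le fun n => by simp
      have h3 := h0.mul_isLittleO h1
      have h4 : (fun n : ℕ => (n : ℝ) * ((fun t : ℝ => t ^ 2) ∘ fun n : ℕ => (Real.sqrt n)⁻¹) n)
          =ᶠ[atTop] fun _ => (1 : ℝ) := by
        filter_upwards [eventually_ne_atTop 0] with n hn using hsq n hn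
      exact (isLittleO_one_iff ℝ).1 (h3.congr' .rfl h4)
    have h3 := h2.sub_const ((v : ℂ) / 2)
    rw [zero_sub, ← neg_div] at h3
    refine h3.congr' ?_
    filter_upwards [eventually_ne_atTop 0] with n hn
    have h4 : (n : ℂ) * (((Real.sqrt n)⁻¹ : ℝ) : ℂ) ^ 2 = 1 := by exact_mod_cast hsq n hn
    simp only [hg, ← hv]
    linear_combination (v : ℂ) / 2 * h4
  have hlog := Complex.tendsto_nat_mul_log_one_add_of_tendsto hng
  have hkc : Tendsto (fun n => (((k n : ℝ) / n : ℝ) : ℂ)) atTop (𝓝 κ) :=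
    (Complex.continuous_ofReal.tendsto κ).comp hk
  have h1 := (Complex.continuous_exp.tendsto _).comp (hkc.mul hlog)
  have hgz : Tendsto (fun n : ℕ => charFun (P.map Y) (Real.sqrt n)⁻¹) atTop (𝓝 1) := by
    have := Measure.isProbabilityMeasure_map hY.aemeasurable (μ := P)
    have h2 := (continuous_charFun (μ := P.map Y)).tendsto 0
    rw [charFun_zero, probReal_univ] at h2
    exact h2.comp hr
  have e : (κ : ℂ) * (-(v : ℂ) / 2) = -(κ * v : ℝ) / 2 := by
    push_cast
    ring
  rw [e] at h1
  refine h1.congr' ?_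
  filter_upwards [hgz.eventually_ne one_ne_zero, eventually_ne_atTop 0] with n hn hn0
  have hn0' : (n : ℂ) ≠ 0 := by exact_mod_cast hn0
  simp only [Function.comp_apply, hg, add_sub_cancel]
  rw [Complex.ofReal_div, Complex.ofReal_natCast, Complex.ofReal_natCast, ← mul_assoc,
    div_mul_cancel₀ _ hn0', Complex.exp_nat_mul, Complex.exp_log hn]

end CharFunPow

lemma sum_range_mul_eq {α : Type*} [AddCommMonoid α] (f : ℕ → α) (K l : ℕ) :
    ∑ i ∈ Finset.range (K * l), f i
      = ∑ j ∈ Finset.range K, ∑ k ∈ Finset.range l, f (j * l + k) := by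
  induction K with
  | zero => simp
  | succ K ih => rw [Nat.succ_mul, Finset.sum_range_add, ih, Finset.sum_range_succ]

namespace IsCriticalSequence

variable {Ω : Type*} [MeasurableSpace Ω] {P : Measure Ω} [IsProbabilityMeasure P]
  {X : ℕ → Ω → ℕ} {σ2 : ℝ} (hX : IsCriticalSequence P X σ2)
include hX

lemma memLp_sum_centered (A : Finset ℕ) :
    MemLp (fun ω => ∑ k ∈ A, ((X k ω : ℝ) - 1)) 2 P :=
  memLp_finsetSum A fun k _ => hX.memLp_centered k

lemma integral_sum_centered (A : Finset ℕ) : ∫ ω, ∑ k ∈ A, ((X k ω : ℝ) - 1) ∂P = 0 := by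
  rw [integral_finsetSum A fun k _ => (hX.memLp_centered k).integrable one_le_two]
  exact Finset.sum_eq_zero fun k _ => hX.integral_centered k

lemma integral_sum_centered_sq (A : Finset ℕ) :
    ∫ ω, (∑ k ∈ A, ((X k ω : ℝ) - 1)) ^ 2 ∂P = A.card * σ2 := by
  have hind : iIndepFun (fun i ω => (X i ω : ℝ) - 1) P :=
    hX.indep.comp (fun _ (k : ℕ) => (k : ℝ) - 1) fun _ => measurable_from_top
  have h1 := IndepFun.variance_sum (μ := P) (X := fun i ω => (X i ω : ℝ) - 1) (s := A)
    (fun i _ => hX.memLp_centered i) fun i _ j _ hij => hind.indepFun hij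
  have h2 : (∑ i ∈ A, fun ω => (X i ω : ℝ) - 1) = fun ω => ∑ k ∈ A, ((X k ω : ℝ) - 1) := by
    ext ω
    simp
  rw [h2, variance_of_integral_eq_zero (hX.memLp_sum_centered A).aemeasurable
    (hX.integral_sum_centered A)] at h1
  rw [h1, Finset.sum_congr rfl (g := fun _ => σ2), Finset.sum_const, nsmul_eq_mul]
  intro i _
  rw [variance_of_integral_eq_zero (hX.memLp_centered i).aemeasurable (hX.integral_centered i),
    hX.integral_centered_sq]

/-- The characteristic function of a sum over blocks, together with the total sum. -/
lemma integral_exp_blocks {H : (ℕ → ℕ) → ℝ} {l : ℕ} (hl : 0 < l) (hH : DependsOn H (Set.Iio l))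
    {K n : ℕ} (hKn : K * l ≤ n) (x r : ℝ) :
    ∫ ω, Complex.exp (r * ((∑ j ∈ Finset.range K, H (shiftSeq X (j * l) ω)
        + x * ∑ i ∈ Finset.range n, ((X i ω : ℝ) - 1) : ℝ) : ℂ) * Complex.I) ∂P
      = charFun (P.map fun ω => H (shiftSeq X 0 ω)
          + x * ∑ k ∈ Finset.range l, ((X k ω : ℝ) - 1)) r ^ K
        * charFun (P.map fun ω => (X 0 ω : ℝ) - 1) (r * x) ^ (n - K * l) := by
  let Hx : (ℕ → ℕ) → ℝ := fun z => H z + x * ∑ k ∈ Finset.range l, ((z k : ℝ) - 1)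
  have hHx : DependsOn Hx (Set.Iio l) := fun z w hzw => by
    simp only [Hx, hH hzw]
    congr 2
    exact Finset.sum_congr rfl fun k hk => by rw [hzw k (Finset.mem_range.1 hk)]
  let R : (ℕ → ℕ) → ℝ := fun z => x * ∑ i ∈ Finset.Ico (K * l) n, ((z i : ℝ) - 1)
  let W : (ℕ → ℕ) → ℝ := fun z => ∑ j ∈ Finset.range K, Hx fun k => z (j * l + k)
  have hW : DependsOn W (Finset.range (K * l) : Set ℕ) := fun z w hzw => by
    refine Finset.sum_congr rfl fun j hj => hHx.comp_shift (j * l) fun k hk => hzw k ?_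
    have h1 := Finset.mem_range.1 hj
    have h2 : (j + 1) * l ≤ K * l := Nat.mul_le_mul_right l h1
    simp only [Finset.coe_Ico, Set.mem_Ico, Finset.coe_range, Set.mem_Iio] at hk ⊢
    rw [Nat.succ_mul] at h2
    omega
  have hR : DependsOn R (Finset.Ico (K * l) n : Set ℕ) := fun z w hzw => by
    change x * _ = x * _
    congr 1
    exact Finset.sum_congr rfl fun k hk => by rw [hzw k hk]
  have hsum : ∀ ω, ∑ j ∈ Finset.range K, H (shiftSeq X (j * l) ω)
      + x * ∑ i ∈ Finset.range n, ((X i ω : ℝ) - 1) = W (X · ω) + R (X · ω) := by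
    intro ω
    simp only [W, R, Hx, Finset.sum_add_distrib, ← Finset.mul_sum]
    rw [← Finset.sum_range_add_sum_Ico (fun i => (X i ω : ℝ) - 1) hKn,
      sum_range_mul_eq (fun i => (X i ω : ℝ) - 1)]
    have e : ∀ j, shiftSeq X j ω = fun k => X (j + k) ω := fun _ => rfl
    simp only [e]
    ring
  have hWm : Measurable fun ω => W (X · ω) :=
    hW.measurable_discrete.comp (measurable_pi_lambda _ fun i => hX.measurable i)
  have hRm : Measurable fun ω => R (X · ω) :=
    hR.measurable_discrete.comp (measurable_pi_lambda _ fun i => hX.measurable i)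
  have hind : IndepFun (fun ω => W (X · ω)) (fun ω => R (X · ω)) P :=
    indepFun_of_dependsOn hX.measurable hX.indep hW hR (by
      rw [Finset.range_eq_Ico]
      exact Finset.Ico_disjoint_Ico_consecutive 0 (K * l) n)
  have h1 := congrFun (hind.charFun_map_fun_add_eq_mul hWm.aemeasurable hRm.aemeasurable) r
  rw [charFun_apply_real, integral_map (hWm.fun_add hRm).aemeasurable (by fun_prop)] at h1
  simp only [hsum]
  rw [h1, Pi.mul_apply]
  congr 1
  · have hm : ∀ i, Measurable fun ω => Hx (shiftSeq X i ω) := hHx.measurable_shiftSeq hX.measurable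
    have hb := iIndepFun_blocks hl hHx hX.measurable hX.indep 0
    simp only [zero_add] at hb
    have h2 := congrFun ((hb.restrict (Finset.range K)).charFun_map_fun_finsetSum_eq_prod
      (s := Finset.range K) (fun i _ => (hm _).aemeasurable)) r
    have h3 : ∀ j, P.map (fun ω => Hx (shiftSeq X j ω)) = P.map fun ω => Hx (shiftSeq X 0 ω) := by
      intro j
      have hHm : Measurable Hx := by
        have h1 : DependsOn Hx ((Finset.range l : Finset ℕ) : Set ℕ) := by simpa using hHx
        exact h1.measurable_discrete
      exact ((identDistrib_shiftSeq hX.measurable hX.indep hX.ident j).comp hHm).map_eq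
    simp only [h3, Finset.prod_const, Finset.card_range, Pi.pow_apply] at h2
    have h4 : (fun ω => Hx (shiftSeq X 0 ω)) = fun ω => H (shiftSeq X 0 ω)
        + x * ∑ k ∈ Finset.range l, ((X k ω : ℝ) - 1) := by
      ext ω
      simp [Hx, shiftSeq]
    rw [h4] at h2
    exact h2
  · have hm := Finset.measurable_fun_sum (Finset.Ico (K * l) n)
      (f := fun i ω => (X i ω : ℝ) - 1) fun i _ => (hX.measurable_real i).sub_const 1
    have h2 := charFun_map_mul_comp (μ := P) hm.aemeasurable x r
    rw [show (fun ω => R (X · ω)) = fun ω => x * ∑ i ∈ Finset.Ico (K * l) n, ((X i ω : ℝ) - 1)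
      from rfl, h2, mul_comm x r, charFun_apply_real, integral_map hm.aemeasurable (by fun_prop),
      hX.integral_exp_sum, Nat.card_Ico]

/-- Fourier representation, on the scale `n ^ (-1/2)`, for sums over blocks given the total sum. -/
lemma sqrt_mul_setIntegral_exp_blocks {d : ℕ} (hd : IsSpan P (X 0) d) {H : (ℕ → ℕ) → ℝ} {l : ℕ}
    (hl : 0 < l) (hH : DependsOn H (Set.Iio l)) {K n : ℕ} (hKn : K * l ≤ n) (hn : 0 < n)
    (hdn : (d : ℤ) ∣ n - 1) :
    (Real.sqrt n : ℂ) * ∫ ω in bridgeEvent X n, Complex.exp (((Real.sqrt n)⁻¹ : ℝ)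
        * ((∑ j ∈ Finset.range K, H (shiftSeq X (j * l) ω) : ℝ) : ℂ) * Complex.I) ∂P
      = (d / (2 * Real.pi) : ℝ) * ∫ x, (Set.Ioc (-(Real.sqrt n * (Real.pi / d)))
          (Real.sqrt n * (Real.pi / d))).indicator (fun x =>
            Complex.exp ((((Real.sqrt n)⁻¹ * x : ℝ) : ℂ) * Complex.I)
            * (charFun (P.map fun ω => H (shiftSeq X 0 ω)
                + x * ∑ k ∈ Finset.range l, ((X k ω : ℝ) - 1)) (Real.sqrt n)⁻¹ ^ K
              * charFun (P.map fun ω => (X 0 ω : ℝ) - 1) ((Real.sqrt n)⁻¹ * x)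
                ^ (n - K * l))) x := by
  set r := (Real.sqrt n)⁻¹ with hr
  have hsq : 0 < Real.sqrt n := Real.sqrt_pos.2 (by exact_mod_cast hn)
  have hd0 : (0 : ℝ) < d := by exact_mod_cast hd.pos
  have hπ := Real.pi_pos
  let U : Ω → ℝ := fun ω => ∑ j ∈ Finset.range K, H (shiftSeq X (j * l) ω)
  have hUm : Measurable U :=
    Finset.measurable_fun_sum _ fun j _ => hH.measurable_shiftSeq hX.measurable _
  let Y : Ω → ℤ := fun ω => ((∑ i ∈ Finset.range n, X i ω : ℕ) : ℤ) - (n - 1)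
  have hYm : Measurable Y := by
    have : Measurable fun ω => ∑ i ∈ Finset.range n, X i ω :=
      Finset.measurable_fun_sum _ fun i _ => hX.measurable i
    exact (measurable_from_top (f := fun k : ℕ => (k : ℤ) - (n - 1))).comp this
  have hYd : ∀ᵐ ω ∂P, (d : ℤ) ∣ Y ω := by
    filter_upwards [hX.ae_dvd hd] with ω hω
    exact dvd_sub (Int.natCast_dvd_natCast.2 (Finset.dvd_sum fun i _ => hω i)) hdn
  have hV : Integrable (fun ω => Complex.exp ((r : ℂ) * (U ω : ℂ) * Complex.I)) P := by
    refine Integrable.of_bound (by fun_prop) 1 (.of_forall fun ω => ?_)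
    rw [← Complex.ofReal_mul, Complex.norm_exp_ofReal_mul_I]
  have hinv := setIntegral_eq_integral_exp hd.pos hYm hYd hV
  have hset : {ω | Y ω = 0} = bridgeEvent X n := by
    ext ω
    simp only [Y, bridgeEvent, Set.mem_ofPred_eq]
    omega
  rw [hset] at hinv
  have hchar : ∀ x : ℝ, ∫ ω, Complex.exp ((r : ℂ) * (U ω : ℂ) * Complex.I)
      * Complex.exp (((r * x : ℝ) : ℂ) * Y ω * Complex.I) ∂P
      = Complex.exp (((r * x : ℝ) : ℂ) * Complex.I) * (charFun (P.map fun ω => H (shiftSeq X 0 ω)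
          + x * ∑ k ∈ Finset.range l, ((X k ω : ℝ) - 1)) r ^ K
        * charFun (P.map fun ω => (X 0 ω : ℝ) - 1) (r * x) ^ (n - K * l)) := by
    intro x
    rw [← hX.integral_exp_blocks hl hH hKn x r, ← integral_const_mul]
    refine integral_congr_ae (.of_forall fun ω => ?_)
    simp only [Y, U]
    rw [← Complex.exp_add, ← Complex.exp_add]
    congr 1
    push_cast
    rw [Finset.sum_sub_distrib]
    simp only [Finset.sum_const, nsmul_eq_mul, mul_one, Finset.card_range]
    ring
  have hsub := intervalIntegral.smul_integral_comp_mul_left (c := r)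
    (a := -(Real.sqrt n * (Real.pi / d))) (b := Real.sqrt n * (Real.pi / d))
    (fun t : ℝ => ∫ ω, Complex.exp ((r : ℂ) * (U ω : ℂ) * Complex.I)
      * Complex.exp ((t : ℂ) * Y ω * Complex.I) ∂P)
  have e1 : r * -(Real.sqrt n * (Real.pi / d)) = -(Real.pi / d) := by
    rw [hr, mul_neg, inv_mul_cancel_left₀ hsq.ne']
  have e2 : r * (Real.sqrt n * (Real.pi / d)) = Real.pi / d := by
    rw [hr, inv_mul_cancel_left₀ hsq.ne']
  rw [e1, e2] at hsub
  simp only [hchar] at hsub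
  rw [hinv, ← hsub, integral_indicator measurableSet_Ioc, intervalIntegral.integral_of_le (by
    have : 0 ≤ Real.sqrt n * (Real.pi / d) := by positivity
    linarith), Complex.real_smul, mul_left_comm]
  congr 1
  rw [← mul_assoc, ← Complex.ofReal_mul, hr, mul_inv_cancel₀ hsq.ne', Complex.ofReal_one, one_mul]

end IsCriticalSequence

/-! ### The central limit theorem for block sums given the total sum -/

/-- The sizes `n` for which the total sum can be `n - 1`, as far as divisibility by the span `d`
is concerned, tending to infinity. -/
def latticeAtTop (d : ℕ) : Filter ℕ := atTop ⊓ 𝓟 {n : ℕ | (d : ℤ) ∣ n - 1}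

lemma latticeAtTop_le (d : ℕ) : latticeAtTop d ≤ atTop := inf_le_left

lemma latticeAtTop_neBot {d : ℕ} (hd : 0 < d) : (latticeAtTop d).NeBot := by
  refine frequently_mem_iff_neBot.1 (frequently_atTop.2 fun N => ⟨N * d + 1, ?_, ?_⟩)
  · exact (Nat.le_mul_of_pos_right N hd).trans (Nat.le_succ _)
  · simp

instance (d : ℕ) : (latticeAtTop d).IsCountablyGenerated := by
  unfold latticeAtTop
  infer_instance

namespace IsCriticalSequence

variable {Ω : Type*} [MeasurableSpace Ω] {P : Measure Ω} [IsProbabilityMeasure P]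
  {X : ℕ → Ω → ℕ} {σ2 : ℝ} (hX : IsCriticalSequence P X σ2)
include hX

lemma integrable_mul_sum_centered {F : (ℕ → ℕ) → ℝ} {m : ℕ} {M : ℝ}
    (hF : IsCenteredLocal P X F m M) (i : ℕ) (A : Finset ℕ) :
    Integrable (fun ω => F (shiftSeq X i ω) * ∑ k ∈ A, ((X k ω : ℝ) - 1)) P :=
  ((hX.memLp_sum_centered A).integrable one_le_two).bdd_mul
    (hF.measurable hX.measurable i).aestronglyMeasurable (.of_forall fun _ => hF.bound _)

lemma memLp_add_mul_sum {H : (ℕ → ℕ) → ℝ} {l : ℕ} {M : ℝ}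
    (hH : IsCenteredLocal P X H l M) (x : ℝ) :
    MemLp (fun ω => H (shiftSeq X 0 ω) + x * ∑ k ∈ Finset.range l, ((X k ω : ℝ) - 1)) 2 P :=
  (MemLp.of_bound (hH.measurable hX.measurable 0).aestronglyMeasurable M
    (.of_forall fun _ => hH.bound _)).add ((hX.memLp_sum_centered _).const_mul x)

lemma integral_add_mul_sum {H : (ℕ → ℕ) → ℝ} {l : ℕ} {M : ℝ}
    (hH : IsCenteredLocal P X H l M) (x : ℝ) :
    ∫ ω, (H (shiftSeq X 0 ω) + x * ∑ k ∈ Finset.range l, ((X k ω : ℝ) - 1)) ∂P = 0 := by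
  have hi : Integrable (fun ω => H (shiftSeq X 0 ω)) P :=
    Integrable.of_bound (hH.measurable hX.measurable 0).aestronglyMeasurable M
      (.of_forall fun _ => hH.bound _)
  rw [integral_add hi (((hX.memLp_sum_centered _).integrable one_le_two).const_mul x), hH.mean,
    integral_const_mul, hX.integral_sum_centered, mul_zero, add_zero]

lemma integral_add_mul_sum_sq {H : (ℕ → ℕ) → ℝ} {l : ℕ} {M : ℝ}
    (hH : IsCenteredLocal P X H l M) (x : ℝ) :
    ∫ ω, (H (shiftSeq X 0 ω) + x * ∑ k ∈ Finset.range l, ((X k ω : ℝ) - 1)) ^ 2 ∂P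
      = ∫ ω, H (shiftSeq X 0 ω) ^ 2 ∂P
        + 2 * x * ∫ ω, H (shiftSeq X 0 ω) * ∑ k ∈ Finset.range l, ((X k ω : ℝ) - 1) ∂P
        + x ^ 2 * (l * σ2) := by
  have h1 : Integrable (fun ω => H (shiftSeq X 0 ω) ^ 2) P :=
    (MemLp.of_bound (hH.measurable hX.measurable 0).aestronglyMeasurable M
      (.of_forall fun _ => hH.bound _) : MemLp _ 2 P).integrable_sq
  have h2 := (hX.integrable_mul_sum_centered hH 0 (Finset.range l)).const_mul (2 * x)
  have h3 := (hX.memLp_sum_centered (Finset.range l)).integrable_sq.const_mul (x ^ 2)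
  have h12 := h1.fun_add h2
  have e : ∀ ω, (H (shiftSeq X 0 ω) + x * ∑ k ∈ Finset.range l, ((X k ω : ℝ) - 1)) ^ 2
      = (H (shiftSeq X 0 ω) ^ 2
        + 2 * x * (H (shiftSeq X 0 ω) * ∑ k ∈ Finset.range l, ((X k ω : ℝ) - 1)))
        + x ^ 2 * (∑ k ∈ Finset.range l, ((X k ω : ℝ) - 1)) ^ 2 := fun ω => by ring
  simp only [e]
  rw [integral_add h12 h3, integral_add h1 h2, integral_const_mul, integral_const_mul,
    hX.integral_sum_centered_sq, Finset.card_range]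

/-- The local limit theorem with block sums: the Fourier integral is dominated by a Gaussian
because a positive proportion of the variables lies outside the blocks. -/
lemma tendsto_sqrt_mul_setIntegral_exp_blocks {d : ℕ} (hd : IsSpan P (X 0) d)
    {H : (ℕ → ℕ) → ℝ} {l : ℕ} {M : ℝ} (hH : IsCenteredLocal P X H l M) {K : ℕ → ℕ} {κ ε : ℝ}
    (hε : 0 < ε) (hK : Tendsto (fun n => (K n : ℝ) / n) atTop (𝓝 κ))
    (hKn : ∀ n, (K n * l : ℝ) ≤ (1 - ε) * n) :
    Tendsto (fun n : ℕ => (Real.sqrt n : ℂ) * ∫ ω in bridgeEvent X n,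
        Complex.exp (((Real.sqrt n)⁻¹ : ℝ)
          * ((∑ j ∈ Finset.range (K n), H (shiftSeq X (j * l) ω) : ℝ) : ℂ) * Complex.I) ∂P)
      (latticeAtTop d)
      (𝓝 ((d / (2 * Real.pi) : ℝ) * (Real.pi / -(-(σ2 : ℂ) / 2)) ^ (1 / 2 : ℂ)
        * Complex.exp (-((κ * ∫ ω, H (shiftSeq X 0 ω) ^ 2 ∂P - κ ^ 2
          * (∫ ω, H (shiftSeq X 0 ω) * ∑ k ∈ Finset.range l, ((X k ω : ℝ) - 1) ∂P) ^ 2 / σ2 : ℝ)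
            : ℂ) / 2))) := by
  obtain ⟨c, hc, hφ⟩ := hX.exists_norm_charFun_le hd
  set v := ∫ ω, H (shiftSeq X 0 ω) ^ 2 ∂P with hv
  set b := ∫ ω, H (shiftSeq X 0 ω) * ∑ k ∈ Finset.range l, ((X k ω : ℝ) - 1) ∂P with hb
  have hd0 : (0 : ℝ) < d := by exact_mod_cast hd.pos
  have hπ := Real.pi_pos
  have hσ := hX.pos
  have hKn' : ∀ n, K n * l ≤ n := fun n => by
    have h1 := hKn n
    have h2 : (0 : ℝ) ≤ ε * n := by positivity
    have h3 : ((K n * l : ℕ) : ℝ) ≤ n := by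
      push_cast
      linarith
    exact_mod_cast h3
  let Yf : ℝ → Ω → ℝ := fun x ω =>
    H (shiftSeq X 0 ω) + x * ∑ k ∈ Finset.range l, ((X k ω : ℝ) - 1)
  let f : ℕ → ℝ → ℂ := fun n => (Set.Ioc (-(Real.sqrt n * (Real.pi / d)))
          (Real.sqrt n * (Real.pi / d))).indicator (fun x =>
            Complex.exp ((((Real.sqrt n)⁻¹ * x : ℝ) : ℂ) * Complex.I)
            * (charFun (P.map (Yf x)) (Real.sqrt n)⁻¹ ^ K n
              * charFun (P.map fun ω => (X 0 ω : ℝ) - 1) ((Real.sqrt n)⁻¹ * x) ^ (n - K n * l)))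
  let g : ℝ → ℂ := fun x =>
    Complex.exp (-(σ2 : ℂ) / 2 * x ^ 2 + -(κ * b : ℝ) * x + -(κ * v : ℝ) / 2)
  have hsumm : Measurable fun ω => ∑ k ∈ Finset.range l, ((X k ω : ℝ) - 1) :=
    Finset.measurable_fun_sum _ fun k _ => (hX.measurable_real k).sub_const 1
  have hHm := hH.measurable hX.measurable 0
  have hYm : ∀ x, Measurable (Yf x) := fun x => hHm.add (hsumm.const_mul x)
  have hcont : ∀ r, Continuous fun x => charFun (P.map (Yf x)) r := by
    intro r
    have e : ∀ x, charFun (P.map (Yf x)) r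
        = ∫ ω, Complex.exp (r * (Yf x ω : ℂ) * Complex.I) ∂P := fun x => by
      rw [charFun_apply_real, integral_map (hYm x).aemeasurable (by fun_prop)]
    simp only [e]
    refine continuous_of_dominated (bound := fun _ => 1) (fun x => ?_) (fun x => ?_)
      (integrable_const _) (.of_forall fun ω => ?_)
    · have := hYm x
      exact Measurable.aestronglyMeasurable (by fun_prop)
    · refine .of_forall fun ω => ?_
      rw [← Complex.ofReal_mul, Complex.norm_exp_ofReal_mul_I]
    · simp only [Yf]
      fun_prop
  have hprob : IsProbabilityMeasure (P.map fun ω => (X 0 ω : ℝ) - 1) :=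
    Measure.isProbabilityMeasure_map ((hX.measurable_real 0).sub_const 1).aemeasurable
  have hfm : ∀ n, AEStronglyMeasurable (f n) volume := by
    intro n
    refine (Continuous.aestronglyMeasurable ?_).indicator measurableSet_Ioc
    have h1 := hcont (Real.sqrt n)⁻¹
    have h2 : Continuous (charFun (P.map fun ω => (X 0 ω : ℝ) - 1)) := continuous_charFun
    fun_prop
  have hr : Tendsto (fun n : ℕ => (Real.sqrt n)⁻¹) atTop (𝓝 0) :=
    (Real.tendsto_sqrt_atTop.comp tendsto_natCast_atTop_atTop).inv_tendsto_atTop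
  -- the blocks contribute a factor of modulus at most one, and each of the at least `ε * n`
  -- variables outside the blocks a factor of modulus at most `exp (-c * x ^ 2 / n)`
  have hbound : ∀ n x, ‖f n x‖ ≤ Real.exp (-(c * ε) * x ^ 2) := by
    intro n x
    by_cases hx : x ∈ Set.Ioc (-(Real.sqrt n * (Real.pi / d))) (Real.sqrt n * (Real.pi / d))
    swap
    · simp only [f, Set.indicator_of_notMem hx, norm_zero]
      exact (Real.exp_pos _).le
    have hn : (0 : ℝ) < Real.sqrt n := by
      by_contra h
      have h0 : Real.sqrt n = 0 := le_antisymm (not_lt.1 h) (Real.sqrt_nonneg _)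
      rw [h0] at hx
      simp at hx
    have hn' : (0 : ℝ) < n := Real.sqrt_pos.1 hn
    simp only [f, Set.indicator_of_mem hx]
    have := Measure.isProbabilityMeasure_map (hYm x).aemeasurable (μ := P)
    rw [norm_mul, norm_mul, Complex.norm_exp_ofReal_mul_I, one_mul, norm_pow, norm_pow]
    have h1 : |(Real.sqrt n)⁻¹ * x| ≤ Real.pi / d := by
      rw [abs_mul, abs_inv, abs_of_pos hn, inv_mul_le_iff₀ hn]
      exact abs_le.2 ⟨hx.1.le, hx.2⟩
    have h2 := pow_le_pow_left₀ (norm_nonneg _) (hφ _ h1) (n - K n * l)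
    rw [← Real.exp_nat_mul] at h2
    refine (mul_le_of_le_one_left (by positivity)
      (pow_le_one₀ (norm_nonneg _) (norm_charFun_le_one _))).trans (h2.trans ?_)
    refine Real.exp_le_exp.2 ?_
    rw [mul_pow, inv_pow, Real.sq_sqrt hn'.le, Nat.cast_sub (hKn' n)]
    push_cast
    have h3 : ε * n ≤ n - K n * l := by linarith [hKn n]
    have h4 : ε ≤ (n - K n * l) * (n : ℝ)⁻¹ := by
      rw [← div_eq_mul_inv, le_div_iff₀ hn']
      exact h3
    have h5 : 0 ≤ c * x ^ 2 := by positivity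
    nlinarith
  have hlim : ∀ x, Tendsto (fun n => f n x) atTop (𝓝 (g x)) := by
    intro x
    have h1 : Tendsto (fun n : ℕ => Complex.exp ((((Real.sqrt n)⁻¹ * x : ℝ) : ℂ) * Complex.I))
        atTop (𝓝 1) := by
      have h : Continuous fun t : ℝ => Complex.exp (((t * x : ℝ) : ℂ) * Complex.I) := by fun_prop
      have := (h.tendsto 0).comp hr
      simpa [Function.comp_def] using this
    have h2 := tendsto_charFun_inv_sqrt_pow (hX.memLp_add_mul_sum hH x)
      (hX.integral_add_mul_sum hH x) hK
    have hk2 : Tendsto (fun n : ℕ => ((n - K n * l : ℕ) : ℝ) / n) atTop (𝓝 (1 - κ * l)) := by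
      refine ((hK.mul_const (l : ℝ)).const_sub 1).congr' ?_
      filter_upwards [eventually_ne_atTop 0] with n hn
      have : (n : ℝ) ≠ 0 := by exact_mod_cast hn
      rw [Nat.cast_sub (hKn' n)]
      push_cast
      field_simp
    have h3 := tendsto_charFun_inv_sqrt_pow ((hX.memLp_centered 0).const_mul x)
      (by rw [integral_const_mul, hX.integral_centered, mul_zero]) hk2
    have e1 : ∀ n : ℕ, charFun (P.map fun ω => x * ((X 0 ω : ℝ) - 1)) (Real.sqrt n)⁻¹
        = charFun (P.map fun ω => (X 0 ω : ℝ) - 1) ((Real.sqrt n)⁻¹ * x) := fun n => by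
      rw [charFun_map_mul_comp ((hX.measurable_real 0).sub_const 1).aemeasurable, mul_comm]
    simp only [e1, mul_pow, integral_const_mul, hX.integral_centered_sq] at h3
    rw [hX.integral_add_mul_sum_sq hH x, ← hv, ← hb] at h2
    have h4 := h1.mul (h2.mul h3)
    have e2 : 1 * (Complex.exp (-((κ * (v + 2 * x * b + x ^ 2 * (l * σ2)) : ℝ) : ℂ) / 2)
        * Complex.exp (-(((1 - κ * l) * (x ^ 2 * σ2) : ℝ) : ℂ) / 2)) = g x := by
      rw [one_mul, ← Complex.exp_add]
      simp only [g]
      congr 1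
      push_cast
      ring
    rw [e2] at h4
    refine h4.congr' ?_
    have h5 : Tendsto (fun n : ℕ => Real.sqrt n * (Real.pi / d)) atTop atTop :=
      (Real.tendsto_sqrt_atTop.comp tendsto_natCast_atTop_atTop).atTop_mul_const (by positivity)
    filter_upwards [h5.eventually_gt_atTop |x|] with n hn
    have hx : x ∈ Set.Ioc (-(Real.sqrt n * (Real.pi / d))) (Real.sqrt n * (Real.pi / d)) :=
      ⟨(abs_lt.1 hn).1, (abs_lt.1 hn).2.le⟩
    simp only [f, Set.indicator_of_mem hx, Yf]
  have hdom : Tendsto (fun n => ∫ x, f n x) (latticeAtTop d) (𝓝 (∫ x, g x)) := by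
    refine tendsto_integral_filter_of_dominated_convergence
      (fun x => Real.exp (-(c * ε) * x ^ 2)) (.of_forall hfm)
      (.of_forall fun n => .of_forall (hbound n)) (integrable_exp_neg_mul_sq (by positivity))
      (.of_forall fun x => (hlim x).mono_left (latticeAtTop_le d))
  have hg : ∫ x, g x = (Real.pi / -(-(σ2 : ℂ) / 2)) ^ (1 / 2 : ℂ)
      * Complex.exp (-((κ * v - κ ^ 2 * b ^ 2 / σ2 : ℝ) : ℂ) / 2) := by
    simp only [g]
    rw [integral_cexp_quadratic]
    · congr 2
      have : (σ2 : ℂ) ≠ 0 := by exact_mod_cast hσ.ne'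
      push_cast
      field_simp
      ring
    · have : (-(σ2 : ℂ) / 2) = ((-σ2 / 2 : ℝ) : ℂ) := by push_cast; ring
      rw [this, Complex.ofReal_re]
      linarith
  rw [hg] at hdom
  rw [mul_assoc]
  refine (hdom.const_mul ((d / (2 * Real.pi) : ℝ) : ℂ)).congr' ?_
  have hev : ∀ᶠ n in latticeAtTop d, n ∈ {n : ℕ | (d : ℤ) ∣ n - 1} :=
    mem_inf_of_right (mem_principal_self _)
  filter_upwards [hev, (eventually_gt_atTop 0).filter_mono (latticeAtTop_le d)] with n hn hn0
  exact (hX.sqrt_mul_setIntegral_exp_blocks hd hH.pos hH.dependsOn (hKn' n) hn0 hn).symm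

omit [IsProbabilityMeasure P] in
lemma gaussian_constant_ne_zero {d : ℕ} (hd : IsSpan P (X 0) d) :
    ((d / (2 * Real.pi) : ℝ) : ℂ) * (Real.pi / -(-(σ2 : ℂ) / 2)) ^ (1 / 2 : ℂ) ≠ 0 := by
  have hσ : (σ2 : ℂ) ≠ 0 := by exact_mod_cast hX.pos.ne'
  have hd0 : (d : ℝ) ≠ 0 := by exact_mod_cast hd.pos.ne'
  have hπ := Real.pi_ne_zero
  have hπ' : (Real.pi : ℂ) ≠ 0 := by exact_mod_cast hπ
  refine mul_ne_zero ?_ ?_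
  · exact_mod_cast div_ne_zero hd0 (mul_ne_zero two_ne_zero hπ)
  · rw [Complex.cpow_ne_zero_iff]
    exact Or.inl (by simp [hπ', hσ])

omit hX [IsProbabilityMeasure P] in
lemma _root_.integral_cond_eq {E : Type*} [NormedAddCommGroup E] [NormedSpace ℝ E] (s : Set Ω)
    (f : Ω → E) : ∫ ω, f ω ∂(cond P s) = (P.real s)⁻¹ • ∫ ω in s, f ω ∂P := by
  rw [ProbabilityTheory.cond, integral_smul_measure, ENNReal.toReal_inv, Measure.real]

/-- The local limit theorem for the total sum: the case without blocks. -/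
lemma tendsto_sqrt_mul_measureReal_bridgeEvent {d : ℕ} (hd : IsSpan P (X 0) d) :
    Tendsto (fun n : ℕ => ((Real.sqrt n * P.real (bridgeEvent X n) : ℝ) : ℂ)) (latticeAtTop d)
      (𝓝 ((d / (2 * Real.pi) : ℝ) * (Real.pi / -(-(σ2 : ℂ) / 2)) ^ (1 / 2 : ℂ))) := by
  have h0 : IsCenteredLocal P X (fun _ => 0) 1 1 :=
    ⟨one_pos, fun _ _ _ => rfl, one_pos, fun _ => by simp, by simp⟩
  have h := hX.tendsto_sqrt_mul_setIntegral_exp_blocks hd h0 (K := fun _ => 0) (κ := 0) (ε := 1)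
    one_pos (by simp) (by simp)
  simpa using h

lemma exists_le_measureReal_bridgeEvent {d : ℕ} (hd : IsSpan P (X 0) d) :
    ∃ a : ℝ, 0 < a ∧ ∀ᶠ n : ℕ in latticeAtTop d, a / Real.sqrt n ≤ P.real (bridgeEvent X n) := by
  have h := (hX.tendsto_sqrt_mul_measureReal_bridgeEvent hd).norm
  have hpos := norm_pos_iff.2 (hX.gaussian_constant_ne_zero hd)
  refine ⟨_, half_pos hpos, ?_⟩
  filter_upwards [h.eventually_const_lt (half_lt_self hpos),
    (eventually_gt_atTop 0).filter_mono (latticeAtTop_le d)] with n hn hn0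
  have hsq : 0 < Real.sqrt n := Real.sqrt_pos.2 (by exact_mod_cast hn0)
  rw [div_le_iff₀ hsq, mul_comm (P.real _)]
  rw [Complex.norm_real, Real.norm_of_nonneg (by positivity)] at hn
  exact hn.le

lemma eventually_measure_bridgeEvent_ne_zero {d : ℕ} (hd : IsSpan P (X 0) d) :
    ∀ᶠ n : ℕ in latticeAtTop d, P (bridgeEvent X n) ≠ 0 := by
  obtain ⟨a, ha, h⟩ := hX.exists_le_measureReal_bridgeEvent hd
  filter_upwards [h, (eventually_gt_atTop 0).filter_mono (latticeAtTop_le d)] with n hn hn0 h0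
  have hsq : 0 < Real.sqrt n := Real.sqrt_pos.2 (by exact_mod_cast hn0)
  rw [Measure.real, h0, ENNReal.toReal_zero] at hn
  exact absurd hn (not_le.2 (by positivity))

/-- The central limit theorem for block sums given the total sum. -/
lemma tendsto_integral_exp_blocks_cond {d : ℕ} (hd : IsSpan P (X 0) d)
    {H : (ℕ → ℕ) → ℝ} {l : ℕ} {M : ℝ} (hH : IsCenteredLocal P X H l M) {K : ℕ → ℕ} {κ ε : ℝ}
    (hε : 0 < ε) (hK : Tendsto (fun n => (K n : ℝ) / n) atTop (𝓝 κ))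
    (hKn : ∀ n, (K n * l : ℝ) ≤ (1 - ε) * n) :
    Tendsto (fun n : ℕ => ∫ ω, Complex.exp (((Real.sqrt n)⁻¹ : ℝ)
          * ((∑ j ∈ Finset.range (K n), H (shiftSeq X (j * l) ω) : ℝ) : ℂ) * Complex.I)
          ∂(cond P (bridgeEvent X n)))
      (latticeAtTop d)
      (𝓝 (Complex.exp (-((κ * ∫ ω, H (shiftSeq X 0 ω) ^ 2 ∂P - κ ^ 2
          * (∫ ω, H (shiftSeq X 0 ω) * ∑ k ∈ Finset.range l, ((X k ω : ℝ) - 1) ∂P) ^ 2 / σ2 : ℝ)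
            : ℂ) / 2))) := by
  have hne := hX.gaussian_constant_ne_zero hd
  have h := (hX.tendsto_sqrt_mul_setIntegral_exp_blocks hd hH hε hK hKn).div
    (hX.tendsto_sqrt_mul_measureReal_bridgeEvent hd) hne
  rw [mul_div_cancel_left₀ _ hne] at h
  refine h.congr' ?_
  filter_upwards [hX.eventually_measure_bridgeEvent_ne_zero hd,
    (eventually_gt_atTop 0).filter_mono (latticeAtTop_le d)] with n hn hn0
  have hsq : ((Real.sqrt n : ℝ) : ℂ) ≠ 0 := by
    exact_mod_cast (Real.sqrt_pos.2 (by exact_mod_cast hn0)).ne'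
  simp only [Pi.div_apply]
  rw [integral_cond_eq, Complex.ofReal_mul, mul_div_mul_left _ _ hsq, Complex.real_smul,
    div_eq_inv_mul]
  push_cast
  rfl

/-- The fourth moments of local sums given the total sum. -/
lemma exists_integral_cond_sum_pow_four_le {d : ℕ} (hd : IsSpan P (X 0) d)
    {F : (ℕ → ℕ) → ℝ} {m : ℕ} {M : ℝ} (hF : IsCenteredLocal P X F m M) :
    ∃ C : ℝ, 0 < C ∧ ∀ᶠ n : ℕ in latticeAtTop d, ∀ B ⊆ Finset.range n,
      ∫ ω, (∑ i ∈ B, F (shiftSeq X i ω)) ^ 4 ∂(cond P (bridgeEvent X n))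
        ≤ C * ((B.card : ℝ) ^ 2 + 1) := by
  obtain ⟨C, hC, h⟩ := hX.exists_setIntegral_sum_pow_four_le hF
  obtain ⟨a, ha, h'⟩ := hX.exists_le_measureReal_bridgeEvent hd
  refine ⟨C / a, by positivity, ?_⟩
  filter_upwards [h', (eventually_ge_atTop 2).filter_mono (latticeAtTop_le d)] with n hn hn2 B hB
  have hsq : 0 < Real.sqrt n := Real.sqrt_pos.2 (by exact_mod_cast (by omega : 0 < n))
  have hp : 0 < P.real (bridgeEvent X n) := lt_of_lt_of_le (by positivity) hn
  rw [integral_cond_eq, smul_eq_mul, inv_mul_le_iff₀ hp]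
  refine (h n hn2 B hB).trans ?_
  have h1 : (0 : ℝ) ≤ C / a * ((B.card : ℝ) ^ 2 + 1) := by positivity
  refine le_trans (le_of_eq ?_) (mul_le_mul_of_nonneg_right hn h1)
  field_simp

end IsCriticalSequence

/-! ### The central limit theorem for local sums given the total sum -/

lemma norm_integral_exp_sub_le {Ω : Type*} [MeasurableSpace Ω] {μ : Measure Ω} {f g : Ω → ℝ}
    [IsFiniteMeasure μ] (hf : Measurable f) (hg : Measurable g) {h : Ω → ℝ} (hh : Integrable h μ)
    (hle : ∀ ω, |f ω - g ω| ≤ h ω) :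
    ‖∫ ω, Complex.exp (f ω * Complex.I) ∂μ - ∫ ω, Complex.exp (g ω * Complex.I) ∂μ‖
      ≤ ∫ ω, h ω ∂μ := by
  have hi : ∀ f : Ω → ℝ, Measurable f → Integrable (fun ω => Complex.exp (f ω * Complex.I)) μ :=
    fun f hf => Integrable.of_bound (by fun_prop) 1
      (.of_forall fun ω => (Complex.norm_exp_ofReal_mul_I _).le)
  rw [← integral_sub (hi f hf) (hi g hg)]
  refine norm_integral_le_of_norm_le hh (.of_forall fun ω => le_trans ?_ (hle ω))
  have h1 : Complex.exp (f ω * Complex.I) - Complex.exp (g ω * Complex.I)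
      = Complex.exp (g ω * Complex.I)
        * (Complex.exp (Complex.I * ((f ω - g ω : ℝ) : ℂ)) - 1) := by
    rw [mul_sub, mul_one, ← Complex.exp_add]
    congr 2
    push_cast
    ring
  rw [h1, norm_mul, Complex.norm_exp_ofReal_mul_I, one_mul, ← Real.norm_eq_abs]
  exact Real.norm_exp_I_mul_ofReal_sub_one_le

lemma MeasureTheory.Integrable.cond {Ω E : Type*} [MeasurableSpace Ω] [NormedAddCommGroup E]
    {μ : Measure Ω} {s : Set Ω} {f : Ω → E} (hf : Integrable f μ) (hs : μ s ≠ 0) :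
    Integrable f (ProbabilityTheory.cond μ s) :=
  hf.integrableOn.smul_measure (ENNReal.inv_ne_top.2 hs)

/-- Truncation at `δ`: the excess over `δ` is controlled by the fourth moment. -/
lemma abs_le_add_pow_four_div {δ : ℝ} (hδ : 0 < δ) (y : ℝ) : |y| ≤ δ + y ^ 4 / δ ^ 3 := by
  rcases le_total |y| δ with h | h
  · have : 0 ≤ y ^ 4 / δ ^ 3 := by positivity
    linarith
  · have h1 : |y| ≤ y ^ 4 / δ ^ 3 := by
      rw [le_div_iff₀ (by positivity)]
      have h2 := mul_le_mul_of_nonneg_left (pow_le_pow_left₀ hδ.le h 3) (abs_nonneg y)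
      calc |y| * δ ^ 3 ≤ |y| * |y| ^ 3 := h2
        _ = |y| ^ 4 := by ring
        _ = y ^ 4 := by rw [← abs_pow, abs_of_nonneg (by positivity)]
    linarith

/-- The sum of `F` over all windows of the cyclic arrangement of the first `n` variables. -/
def wrappedSum {Ω : Type*} (X : ℕ → Ω → ℕ) (n : ℕ) (F : (ℕ → ℕ) → ℝ) (ω : Ω) : ℝ :=
  ∑ i ∈ Finset.range n, F fun k => X ((i + k) % n) ω

/-- The sum of `F` over the windows that start at one of the first `L` positions. -/
def blockSum (F : (ℕ → ℕ) → ℝ) (L : ℕ) (x : ℕ → ℕ) : ℝ :=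
  ∑ i ∈ Finset.range L, F fun k => x (i + k)

lemma blockSum_shiftSeq {Ω : Type*} (X : ℕ → Ω → ℕ) (F : (ℕ → ℕ) → ℝ) (L j : ℕ) (ω : Ω) :
    blockSum F L (shiftSeq X j ω) = ∑ i ∈ Finset.range L, F (shiftSeq X (j + i) ω) := by
  refine Finset.sum_congr rfl fun i _ => congrArg F (funext fun k => ?_)
  rw [shiftSeq, shiftSeq, add_assoc]

/-- The windows that start in the first `L` positions of a block make up all of a local sum, up to
a few remaining windows. -/
lemma exists_sum_eq_sum_blocks_add {Ω : Type*} (X : ℕ → Ω → ℕ) {m L K n : ℕ} (h : K * (L + m) ≤ n) :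
    ∃ B ⊆ Finset.range n, B.card = n - K * L ∧ ∀ (F : (ℕ → ℕ) → ℝ) (ω : Ω),
      ∑ i ∈ Finset.range n, F (shiftSeq X i ω)
        = ∑ j ∈ Finset.range K, blockSum F L (shiftSeq X (j * (L + m)) ω)
          + ∑ i ∈ B, F (shiftSeq X i ω) := by
  classical
  let G := (Finset.range K ×ˢ Finset.range L).image fun p => p.1 * (L + m) + p.2
  have hinj : Set.InjOn (fun p : ℕ × ℕ => p.1 * (L + m) + p.2)
      (Finset.range K ×ˢ Finset.range L : Finset (ℕ × ℕ)) := by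
    rintro ⟨a, b⟩ hab ⟨a', b'⟩ hab' e
    simp only [Finset.coe_product, Finset.coe_range, Set.mem_prod, Set.mem_Iio] at hab hab' e
    have h1 : a = a' := by
      have : (a * (L + m) + b) / (L + m) = (a' * (L + m) + b') / (L + m) := by rw [e]
      rwa [mul_comm a, mul_comm a', Nat.mul_add_div (by omega), Nat.mul_add_div (by omega),
        Nat.div_eq_of_lt (by omega), Nat.div_eq_of_lt (by omega), add_zero, add_zero] at this
    subst h1
    simp only [Prod.mk.injEq, true_and]
    omega
  have hG : G ⊆ Finset.range n := by
    intro i hi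
    simp only [G, Finset.mem_image, Finset.mem_product, Finset.mem_range] at hi
    obtain ⟨⟨a, b⟩, ⟨h1, h2⟩, rfl⟩ := hi
    have h3 : (a + 1) * (L + m) ≤ K * (L + m) := Nat.mul_le_mul_right _ h1
    rw [Nat.succ_mul] at h3
    rw [Finset.mem_range]
    change a * (L + m) + b < n
    omega
  refine ⟨Finset.range n \ G, Finset.sdiff_subset, ?_, fun F ω => ?_⟩
  · rw [Finset.card_sdiff_of_subset hG, Finset.card_image_of_injOn hinj]
    simp
  · rw [← Finset.sum_sdiff hG, add_comm, Finset.sum_image hinj, Finset.sum_product]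
    simp only [blockSum_shiftSeq]

namespace IsCenteredLocal

variable {Ω : Type*} [MeasurableSpace Ω] {P : Measure Ω} [IsProbabilityMeasure P]
  {X : ℕ → Ω → ℕ} {F : (ℕ → ℕ) → ℝ} {m : ℕ} {M : ℝ}

omit [IsProbabilityMeasure P] in
lemma integral_shiftSeq (hF : IsCenteredLocal P X F m M) (hX : ∀ i, Measurable (X i))
    (hind : iIndepFun X P) (hid : ∀ i, IdentDistrib (X i) (X 0) P P) (i : ℕ) :
    ∫ ω, F (shiftSeq X i ω) ∂P = 0 := by
  rw [← hF.mean]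
  exact ((identDistrib_shiftSeq hX hind hid i).comp hF.measurable_fun).integral_eq

lemma integrable (hF : IsCenteredLocal P X F m M) (hX : ∀ i, Measurable (X i)) (i : ℕ) :
    Integrable (fun ω => F (shiftSeq X i ω)) P :=
  Integrable.of_bound (hF.measurable hX i).aestronglyMeasurable M (.of_forall fun _ => hF.bound _)

lemma blockSum (hF : IsCenteredLocal P X F m M) (hX : ∀ i, Measurable (X i))
    (hind : iIndepFun X P) (hid : ∀ i, IdentDistrib (X i) (X 0) P P) {L : ℕ} (hL : 0 < L) :
    IsCenteredLocal P X (blockSum F L) (L + m) (L * M) where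
  pos := by omega
  dependsOn := fun x y h => by
    refine Finset.sum_congr rfl fun i hi => hF.dependsOn fun k hk => h _ ?_
    have := Finset.mem_range.1 hi
    simp only [Set.mem_Iio] at hk ⊢
    omega
  bound_pos := mul_pos (by exact_mod_cast hL) hF.bound_pos
  bound := fun x => by
    refine (Finset.abs_sum_le_sum_abs _ _).trans
      ((Finset.sum_le_sum fun i _ => hF.bound _).trans ?_)
    simp
  mean := by
    simp only [blockSum_shiftSeq]
    rw [integral_finsetSum _ fun i _ => hF.integrable hX _]
    exact Finset.sum_eq_zero fun i _ => hF.integral_shiftSeq hX hind hid _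

omit [IsProbabilityMeasure P] in
lemma measurable_wrappedSum (hF : IsCenteredLocal P X F m M) (hX : ∀ i, Measurable (X i)) (n : ℕ) :
    Measurable (wrappedSum X n F) :=
  Finset.measurable_fun_sum _ fun _ _ =>
    hF.measurable_fun.comp (measurable_pi_lambda _ fun _ => hX _)

omit [IsProbabilityMeasure P] in
/-- Only the windows that cross the end of the sequence distinguish the cyclic sum from the linear
one. -/
lemma abs_wrappedSum_sub_le (hF : IsCenteredLocal P X F m M) (n : ℕ) (ω : Ω) :
    |wrappedSum X n F ω - ∑ i ∈ Finset.range n, F (shiftSeq X i ω)| ≤ 2 * m * M := by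
  have hM := hF.bound_pos
  rw [wrappedSum, ← Finset.sum_sub_distrib]
  have h1 : ∀ i ∈ Finset.range n, |F (fun k => X ((i + k) % n) ω) - F (shiftSeq X i ω)|
      ≤ if n < i + m then 2 * M else 0 := by
    intro i hi
    split_ifs with h
    · have h2 := abs_le.1 (hF.bound fun k => X ((i + k) % n) ω)
      have h3 := abs_le.1 (hF.bound (shiftSeq X i ω))
      rw [abs_le]
      constructor <;> linarith
    · rw [hF.dependsOn (y := shiftSeq X i ω), sub_self, abs_zero]
      intro k hk
      simp only [Set.mem_Iio] at hk
      rw [shiftSeq, Nat.mod_eq_of_lt (by omega)]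
  refine (Finset.abs_sum_le_sum_abs _ _).trans ((Finset.sum_le_sum h1).trans ?_)
  rw [← Finset.sum_filter, Finset.sum_const, nsmul_eq_mul]
  have h2 : (Finset.range n).filter (fun i => n < i + m) ⊆ Finset.Ico (n - m) n := by
    intro i hi
    simp only [Finset.mem_filter, Finset.mem_range, Finset.mem_Ico] at hi ⊢
    omega
  have h3 : (((Finset.range n).filter fun i => n < i + m).card : ℝ) ≤ m := by
    have := Finset.card_le_card h2
    rw [Nat.card_Ico] at this
    exact_mod_cast this.trans (by omega)
  nlinarith

end IsCenteredLocal

namespace IsCriticalSequence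

variable {Ω : Type*} [MeasurableSpace Ω] {P : Measure Ω} [IsProbabilityMeasure P]
  {X : ℕ → Ω → ℕ} {σ2 : ℝ} (hX : IsCriticalSequence P X σ2)
include hX

/-- The covariance of a local function with the partial sums of the sequence. -/
lemma integral_mul_sum_centered {F : (ℕ → ℕ) → ℝ} {m : ℕ} {M : ℝ}
    (hF : IsCenteredLocal P X F m M) {i n : ℕ} (hi : i + m ≤ n) :
    ∫ ω, F (shiftSeq X i ω) * ∑ k ∈ Finset.range n, ((X k ω : ℝ) - 1) ∂P
      = ∫ ω, F (shiftSeq X 0 ω) * ∑ k ∈ Finset.range m, ((X k ω : ℝ) - 1) ∂P := by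
  classical
  let S : (ℕ → ℕ) → ℝ := fun x => ∑ k ∈ Finset.range m, ((x k : ℝ) - 1)
  let A := Finset.range n \ Finset.Ico i (i + m)
  let R : (ℕ → ℕ) → ℝ := fun x => ∑ k ∈ A, ((x k : ℝ) - 1)
  have hsub : Finset.Ico i (i + m) ⊆ Finset.range n := fun k hk => by
    rw [Finset.mem_Ico] at hk
    rw [Finset.mem_range]
    omega
  have hsplit : ∀ ω, F (shiftSeq X i ω) * ∑ k ∈ Finset.range n, ((X k ω : ℝ) - 1)
      = F (shiftSeq X i ω) * R (X · ω) + F (shiftSeq X i ω) * S (shiftSeq X i ω) := by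
    intro ω
    rw [← mul_add, ← Finset.sum_sdiff hsub]
    congr 2
    rw [Finset.sum_Ico_eq_sum_range, Nat.add_sub_cancel_left]
    rfl
  have hSi : ∀ ω, S (shiftSeq X i ω) = ∑ k ∈ Finset.Ico i (i + m), ((X k ω : ℝ) - 1) := by
    intro ω
    rw [Finset.sum_Ico_eq_sum_range, Nat.add_sub_cancel_left]
    rfl
  have hi1 := hX.integrable_mul_sum_centered hF i A
  have hi2 := hX.integrable_mul_sum_centered hF i (Finset.Ico i (i + m))
  simp only [← hSi] at hi2
  simp only [hsplit]
  rw [integral_add hi1 hi2]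
  have hind : IndepFun (fun ω => F (shiftSeq X i ω)) (fun ω => R (X · ω)) P := by
    refine indepFun_of_dependsOn (A := Finset.Ico i (i + m)) (B := A) hX.measurable hX.indep
      (F := fun x => F fun k => x (i + k)) (hF.dependsOn.comp_shift i) ?_ Finset.disjoint_sdiff
    intro x y h
    exact Finset.sum_congr rfl fun k hk => by rw [h k hk]
  have h0 : ∫ ω, F (shiftSeq X i ω) * R (X · ω) ∂P = 0 := by
    rw [hind.integral_fun_mul_eq_mul_integral (hF.measurable hX.measurable i).aestronglyMeasurable
      (hX.memLp_sum_centered A).aestronglyMeasurable, hX.integral_sum_centered, mul_zero]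
  rw [h0, zero_add]
  have hSm : Measurable S := by
    refine Finset.measurable_fun_sum _ fun k _ => ?_
    exact (measurable_from_top (f := fun j : ℕ => (j : ℝ) - 1)).comp (measurable_pi_apply k)
  have h1 := ((identDistrib_shiftSeq hX.measurable hX.indep hX.ident i).comp
    (hF.measurable_fun.mul hSm)).integral_eq
  refine h1.trans (integral_congr_ae (.of_forall fun ω => ?_))
  simp only [Function.comp_apply, Pi.mul_apply, S, shiftSeq, zero_add]

lemma integral_blockSum_mul_sum_centered {F : (ℕ → ℕ) → ℝ} {m : ℕ} {M : ℝ}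
    (hF : IsCenteredLocal P X F m M) (L : ℕ) :
    ∫ ω, blockSum F L (shiftSeq X 0 ω) * ∑ k ∈ Finset.range (L + m), ((X k ω : ℝ) - 1) ∂P
      = L * ∫ ω, F (shiftSeq X 0 ω) * ∑ k ∈ Finset.range m, ((X k ω : ℝ) - 1) ∂P := by
  simp only [blockSum_shiftSeq, zero_add, Finset.sum_mul]
  rw [integral_finsetSum _ fun i _ => hX.integrable_mul_sum_centered hF i _,
    Finset.sum_congr rfl fun i hi => hX.integral_mul_sum_centered hF (i := i) (n := L + m) (by
      have := Finset.mem_range.1 hi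
      omega)]
  simp

/-- **Central limit theorem** for local sums given the total sum. Up to a small proportion of
windows, which the fourth moment bound controls, a local sum is a sum over independent blocks. -/
theorem tendsto_integral_exp_sum_cond {d : ℕ} (hd : IsSpan P (X 0) d) {F : (ℕ → ℕ) → ℝ} {m : ℕ}
    {M V : ℝ} (hF : IsCenteredLocal P X F m M)
    (hV : Tendsto (fun L : ℕ => (∫ ω, blockSum F L (shiftSeq X 0 ω) ^ 2 ∂P) / L) atTop (𝓝 V)) :
    Tendsto (fun n : ℕ => ∫ ω, Complex.exp (((Real.sqrt n)⁻¹ * ∑ i ∈ Finset.range n,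
        F (shiftSeq X i ω) : ℝ) * Complex.I) ∂(cond P (bridgeEvent X n)))
      (latticeAtTop d)
      (𝓝 (Complex.exp (-((V - (∫ ω, F (shiftSeq X 0 ω)
        * ∑ k ∈ Finset.range m, ((X k ω : ℝ) - 1) ∂P) ^ 2 / σ2 : ℝ) : ℂ) / 2))) := by
  obtain ⟨C, hC, hmom⟩ := hX.exists_integral_cond_sum_pow_four_le hd hF
  set b := ∫ ω, F (shiftSeq X 0 ω) * ∑ k ∈ Finset.range m, ((X k ω : ℝ) - 1) ∂P with hb
  let v : ℕ → ℝ := fun L => ∫ ω, blockSum F L (shiftSeq X 0 ω) ^ 2 ∂P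
  -- there are about `κ L * n` blocks of length `L + m`; they leave out a proportion `1 / L` of the
  -- variables, and at most a proportion `η L` of the windows
  let κ : ℕ → ℝ := fun L => (L - 1) / (L * (L + m))
  let η : ℕ → ℝ := fun L => (m + 2) / (L + m)
  have hLm : Tendsto (fun L : ℕ => (L : ℝ) + m) atTop atTop :=
    tendsto_atTop_add_const_right _ _ tendsto_natCast_atTop_atTop
  have hη : Tendsto η atTop (𝓝 0) := hLm.const_div_atTop _
  have hκ : Tendsto (fun L : ℕ => κ L * L) atTop (𝓝 1) := by
    have h1 := (hLm.const_div_atTop ((m : ℝ) + 1)).const_sub 1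
    rw [sub_zero] at h1
    refine h1.congr' ?_
    filter_upwards [eventually_gt_atTop 0] with L hL
    have hL' : (0 : ℝ) < L := by exact_mod_cast hL
    simp only [κ]
    field_simp
    ring
  have hlimL : Tendsto (fun L : ℕ => Complex.exp (-((κ L * v L
      - κ L ^ 2 * (L * b) ^ 2 / σ2 : ℝ) : ℂ) / 2)) atTop
      (𝓝 (Complex.exp (-((V - b ^ 2 / σ2 : ℝ) : ℂ) / 2))) := by
    have h1 : Tendsto (fun L : ℕ => κ L * L * (v L / L) - (κ L * L) ^ 2 * b ^ 2 / σ2) atTop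
        (𝓝 (1 * V - 1 ^ 2 * b ^ 2 / σ2)) :=
      (hκ.mul hV).sub (((hκ.pow 2).mul_const _).div_const _)
    rw [one_mul, one_pow, one_mul] at h1
    have h2 : Continuous fun x : ℝ => Complex.exp (-(x : ℂ) / 2) := by fun_prop
    refine ((h2.tendsto _).comp h1).congr' ?_
    filter_upwards [eventually_gt_atTop 0] with L hL
    have hL' : (L : ℝ) ≠ 0 := by exact_mod_cast hL.ne'
    simp only [Function.comp_apply]
    congr 4
    field_simp
  have herr : Tendsto (fun L : ℕ => Real.sqrt (η L) + 2 * C * Real.sqrt (η L)) atTop (𝓝 0) := by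
    have h1 := (Real.continuous_sqrt.tendsto 0).comp hη
    rw [Real.sqrt_zero] at h1
    simpa using h1.add (h1.const_mul (2 * C))
  rw [Metric.tendsto_nhds]
  intro e he
  obtain ⟨L, hL1, hL2, hL3⟩ := ((eventually_gt_atTop 0).and
    (((Metric.tendsto_nhds.1 hlimL (e / 3) (by positivity))).and
      (herr.eventually_lt_const (by positivity : 0 < e / 3)))).exists
  have hL0 : (0 : ℝ) < L := by exact_mod_cast hL1
  have hL1' : (1 : ℝ) ≤ L := by exact_mod_cast hL1
  have hm0 : (0 : ℝ) < m := by exact_mod_cast hF.pos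
  have hκ0 : 0 ≤ κ L := div_nonneg (by linarith) (by positivity)
  have hη0 : 0 < η L := by simp only [η]; positivity
  let K : ℕ → ℕ := fun n => ⌊κ L * n⌋₊
  have hKle : ∀ n, (K n : ℝ) ≤ κ L * n := fun n => Nat.floor_le (by positivity)
  have hKl : ∀ n, (K n * ((L + m : ℕ) : ℝ) : ℝ) ≤ (1 - 1 / L) * n := by
    intro n
    have h1 := mul_le_mul_of_nonneg_right (hKle n) (by positivity : (0 : ℝ) ≤ ((L + m : ℕ) : ℝ))
    refine h1.trans (le_of_eq ?_)
    simp only [κ]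
    push_cast
    field_simp
  have hKn : ∀ n, K n * (L + m) ≤ n := by
    intro n
    have h1 := hKl n
    have h2 : (0 : ℝ) ≤ 1 / L * n := by positivity
    have h3 : ((K n * (L + m) : ℕ) : ℝ) ≤ n := by
      push_cast at h1 ⊢
      linarith
    exact_mod_cast h3
  have hKlim : Tendsto (fun n => (K n : ℝ) / n) atTop (𝓝 (κ L)) :=
    (tendsto_nat_floor_mul_div_atTop hκ0).comp tendsto_natCast_atTop_atTop
  have hblock := hX.tendsto_integral_exp_blocks_cond hd
    (hF.blockSum hX.measurable hX.indep hX.ident hL1) (by positivity : 0 < 1 / (L : ℝ)) hKlim hKl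
  rw [hX.integral_blockSum_mul_sum_centered hF L, ← hb] at hblock
  have hsmall : ∀ᶠ n : ℕ in atTop, ((n : ℝ) ^ 2)⁻¹ ≤ η L ^ 2 := by
    have h1 : Tendsto (fun n : ℕ => ((n : ℝ) ^ 2)⁻¹) atTop (𝓝 0) :=
      ((tendsto_pow_atTop two_ne_zero).comp tendsto_natCast_atTop_atTop).inv_tendsto_atTop
    exact (h1.eventually_lt_const (by positivity)).mono fun n hn => hn.le
  filter_upwards [hmom, hX.eventually_measure_bridgeEvent_ne_zero hd,
    Metric.tendsto_nhds.1 hblock (e / 3) (by positivity),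
    (eventually_gt_atTop (L * (L + m))).filter_mono (latticeAtTop_le d),
    hsmall.filter_mono (latticeAtTop_le d)] with n hn1 hn2 hn3 hn4 hn5
  have : IsProbabilityMeasure (cond P (bridgeEvent X n)) := cond_isProbabilityMeasure hn2
  have hn0 : (0 : ℝ) < n := by exact_mod_cast (Nat.zero_le _).trans_lt hn4
  obtain ⟨B, hB, hcard, hsum⟩ := exists_sum_eq_sum_blocks_add X (hKn n)
  set r := (Real.sqrt n)⁻¹ with hr
  have hr4 : r ^ 4 = ((n : ℝ) ^ 2)⁻¹ := by
    rw [hr, inv_pow, show 4 = 2 * 2 from rfl, pow_mul, Real.sq_sqrt hn0.le]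
  have hcard' : (B.card : ℝ) ≤ η L * n := by
    have h1 : K n * L ≤ n := (Nat.mul_le_mul_left _ (Nat.le_add_right L m)).trans (hKn n)
    rw [hcard, Nat.cast_sub h1]
    push_cast
    have h2 : κ L * n - 1 ≤ K n := (Nat.sub_one_lt_floor _).le
    have h3 := mul_le_mul_of_nonneg_right h2 hL0.le
    have h4 : (L : ℝ) * (L + m) ≤ n := by exact_mod_cast hn4.le
    have h5 : (L : ℝ) ≤ n / (L + m) := by
      rw [le_div_iff₀ (by positivity)]
      exact h4
    have h6 : η L * n = n - κ L * n * L + n / (L + m) := by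
      simp only [η, κ]
      field_simp
      ring
    rw [h6]
    linarith
  set δ := Real.sqrt (η L) with hδ
  have hδ0 : 0 < δ := Real.sqrt_pos.2 hη0
  have hδ2 : δ ^ 2 = η L := Real.sq_sqrt hη0.le
  have hpow : Integrable (fun ω => (∑ i ∈ B, F (shiftSeq X i ω)) ^ 4) (cond P (bridgeEvent X n)) :=
    (hF.integrable_sum_pow hX.measurable B 4).cond hn2
  have hdiff : ‖∫ ω, Complex.exp ((r * ∑ i ∈ Finset.range n, F (shiftSeq X i ω) : ℝ) * Complex.I)
        ∂(cond P (bridgeEvent X n))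
      - ∫ ω, Complex.exp ((r * ∑ j ∈ Finset.range (K n),
          blockSum F L (shiftSeq X (j * (L + m)) ω) : ℝ) * Complex.I) ∂(cond P (bridgeEvent X n))‖
      ≤ δ + 2 * C * δ := by
    have hBl := hF.blockSum hX.measurable hX.indep hX.ident hL1
    refine (norm_integral_exp_sub_le
      (h := fun ω => δ + r ^ 4 / δ ^ 3 * (∑ i ∈ B, F (shiftSeq X i ω)) ^ 4)
      ((Finset.measurable_fun_sum _ fun i _ => hF.measurable hX.measurable i).const_mul r)
      ((Finset.measurable_fun_sum _ fun j _ => hBl.measurable hX.measurable _).const_mul r)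
      ((integrable_const _).add (hpow.const_mul _)) fun ω => ?_).trans ?_
    · rw [hsum, ← mul_sub, add_sub_cancel_left]
      refine (abs_le_add_pow_four_div hδ0 _).trans (le_of_eq ?_)
      ring
    · rw [integral_add (integrable_const _) (hpow.const_mul _), integral_const, probReal_univ,
        one_smul, integral_const_mul]
      have h1 := mul_le_mul_of_nonneg_left (hn1 B hB) (by positivity : 0 ≤ r ^ 4 / δ ^ 3)
      have h2 : (B.card : ℝ) ^ 2 ≤ (η L * n) ^ 2 := pow_le_pow_left₀ (by positivity) hcard' 2
      have h3 : r ^ 4 * ((B.card : ℝ) ^ 2 + 1) ≤ 2 * η L ^ 2 := by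
        rw [hr4, mul_add, mul_one]
        have h4 := mul_le_mul_of_nonneg_left h2 (by positivity : 0 ≤ ((n : ℝ) ^ 2)⁻¹)
        have h5 : ((n : ℝ) ^ 2)⁻¹ * (η L * n) ^ 2 = η L ^ 2 := by field_simp
        linarith
      have h4 : r ^ 4 / δ ^ 3 * (C * ((B.card : ℝ) ^ 2 + 1))
          = C / δ ^ 3 * (r ^ 4 * ((B.card : ℝ) ^ 2 + 1)) := by ring
      have h5 := mul_le_mul_of_nonneg_left h3 (by positivity : 0 ≤ C / δ ^ 3)
      have h6 : C / δ ^ 3 * (2 * η L ^ 2) = 2 * C * δ := by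
        rw [← hδ2]
        field_simp
      linarith
  have hn3' : dist (∫ ω, Complex.exp ((r * ∑ j ∈ Finset.range (K n),
          blockSum F L (shiftSeq X (j * (L + m)) ω) : ℝ) * Complex.I) ∂(cond P (bridgeEvent X n)))
      (Complex.exp (-((κ L * v L - κ L ^ 2 * (L * b) ^ 2 / σ2 : ℝ) : ℂ) / 2)) < e / 3 := by
    simpa only [Complex.ofReal_mul] using hn3
  rw [← dist_eq_norm] at hdiff
  calc _ ≤ _ := dist_triangle4 _ _ _ _
    _ < e / 3 + e / 3 + e / 3 := add_lt_add (add_lt_add (hdiff.trans_lt hL3) hn3') hL2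
    _ = e := by ring

/-- The central limit theorem for local sums in the cyclic arrangement. -/
theorem tendsto_integral_exp_wrappedSum_cond {d : ℕ} (hd : IsSpan P (X 0) d) {F : (ℕ → ℕ) → ℝ}
    {m : ℕ} {M V : ℝ} (hF : IsCenteredLocal P X F m M)
    (hV : Tendsto (fun L : ℕ => (∫ ω, blockSum F L (shiftSeq X 0 ω) ^ 2 ∂P) / L) atTop (𝓝 V)) :
    Tendsto (fun n : ℕ => ∫ ω, Complex.exp (((Real.sqrt n)⁻¹ * wrappedSum X n F ω : ℝ)
        * Complex.I) ∂(cond P (bridgeEvent X n)))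
      (latticeAtTop d)
      (𝓝 (Complex.exp (-((V - (∫ ω, F (shiftSeq X 0 ω)
        * ∑ k ∈ Finset.range m, ((X k ω : ℝ) - 1) ∂P) ^ 2 / σ2 : ℝ) : ℂ) / 2))) := by
  refine (hX.tendsto_integral_exp_sum_cond hd hF hV).congr_dist ?_
  have hr : Tendsto (fun n : ℕ => (Real.sqrt n)⁻¹) atTop (𝓝 0) :=
    (Real.tendsto_sqrt_atTop.comp tendsto_natCast_atTop_atTop).inv_tendsto_atTop
  have h0 : Tendsto (fun n : ℕ => (Real.sqrt n)⁻¹ * (2 * m * M)) (latticeAtTop d) (𝓝 0) := by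
    simpa using (hr.mul_const (2 * (m : ℝ) * M)).mono_left (latticeAtTop_le d)
  refine squeeze_zero' (.of_forall fun n => dist_nonneg) ?_ h0
  filter_upwards [hX.eventually_measure_bridgeEvent_ne_zero hd] with n hn
  have : IsProbabilityMeasure (cond P (bridgeEvent X n)) := cond_isProbabilityMeasure hn
  rw [dist_comm, dist_eq_norm]
  refine (norm_integral_exp_sub_le ((hF.measurable_wrappedSum hX.measurable n).const_mul _)
    ((Finset.measurable_fun_sum _ fun i _ => hF.measurable hX.measurable i).const_mul _)
    (integrable_const ((Real.sqrt n)⁻¹ * (2 * m * M))) fun ω => ?_).trans (by simp)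
  rw [← mul_sub, abs_mul, abs_of_nonneg (by positivity)]
  exact mul_le_mul_of_nonneg_left (hF.abs_wrappedSum_sub_le n ω) (by positivity)

/-- The fourth moments of normalized cyclic local sums given the total sum. -/
lemma exists_integral_wrappedSum_pow_four_le {d : ℕ} (hd : IsSpan P (X 0) d) {F : (ℕ → ℕ) → ℝ}
    {m : ℕ} {M : ℝ} (hF : IsCenteredLocal P X F m M) :
    ∃ C : ℝ, 0 < C ∧ ∀ᶠ n : ℕ in latticeAtTop d,
      ∫ ω, ((Real.sqrt n)⁻¹ * wrappedSum X n F ω) ^ 4 ∂(cond P (bridgeEvent X n)) ≤ C := by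
  obtain ⟨C, hC, hmom⟩ := hX.exists_integral_cond_sum_pow_four_le hd hF
  have hM := hF.bound_pos
  refine ⟨8 * (2 * C + (2 * m * M) ^ 4), by positivity, ?_⟩
  filter_upwards [hmom, hX.eventually_measure_bridgeEvent_ne_zero hd,
    (eventually_ge_atTop 1).filter_mono (latticeAtTop_le d)] with n hn hn2 hn1
  have : IsProbabilityMeasure (cond P (bridgeEvent X n)) := cond_isProbabilityMeasure hn2
  have hn0 : (1 : ℝ) ≤ n := by exact_mod_cast hn1
  set S : Ω → ℝ := fun ω => ∑ i ∈ Finset.range n, F (shiftSeq X i ω) with hS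
  have hpow : Integrable (fun ω => S ω ^ 4) (cond P (bridgeEvent X n)) :=
    (hF.integrable_sum_pow hX.measurable (Finset.range n) 4).cond hn2
  have hr4 : (Real.sqrt n)⁻¹ ^ 4 = ((n : ℝ) ^ 2)⁻¹ := by
    rw [inv_pow, show 4 = 2 * 2 from rfl, pow_mul, Real.sq_sqrt (by positivity)]
  have hpt : ∀ ω, ((Real.sqrt n)⁻¹ * wrappedSum X n F ω) ^ 4
      ≤ ((n : ℝ) ^ 2)⁻¹ * (8 * (S ω ^ 4 + (2 * m * M) ^ 4)) := by
    intro ω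
    rw [mul_pow, hr4]
    refine mul_le_mul_of_nonneg_left ?_ (by positivity)
    have h1 := sum_pow_four_le Finset.univ ![S ω, wrappedSum X n F ω - S ω]
    simp only [Fin.sum_univ_two, Finset.card_univ, Fintype.card_fin] at h1
    norm_num at h1
    have h2 := pow_le_pow_left₀ (abs_nonneg _) (hF.abs_wrappedSum_sub_le n ω) 4
    rw [← abs_pow, abs_of_nonneg (by positivity)] at h2
    linarith
  refine (integral_mono_of_nonneg (.of_forall fun ω => by positivity)
    (((hpow.fun_add (integrable_const _)).const_mul 8).const_mul _) (.of_forall hpt)).trans ?_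
  rw [integral_const_mul, integral_const_mul, integral_add hpow (integrable_const _),
    integral_const, probReal_univ, one_smul]
  have h1 := hn (Finset.range n) subset_rfl
  rw [Finset.card_range] at h1
  have h2 : (1 : ℝ) ≤ n ^ 2 := one_le_pow₀ hn0
  rw [inv_mul_le_iff₀ (by positivity)]
  have h3 : C ≤ n ^ 2 * C := le_mul_of_one_le_left hC.le h2
  have h4 : (2 * m * M) ^ 4 ≤ n ^ 2 * (2 * m * M) ^ 4 := le_mul_of_one_le_left (by positivity) h2
  simp only [hS]
  linarith

end IsCriticalSequence

/-! ### Asymptotic variances of local sums -/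

namespace IsCenteredLocal

variable {Ω : Type*} [MeasurableSpace Ω] {P : Measure Ω} [IsProbabilityMeasure P]
  {X : ℕ → Ω → ℕ} {F G : (ℕ → ℕ) → ℝ} {m m' : ℕ} {M M' : ℝ}

lemma integrable_mul (hF : IsCenteredLocal P X F m M) (hG : IsCenteredLocal P X G m' M')
    (hX : ∀ i, Measurable (X i)) (i j : ℕ) :
    Integrable (fun ω => F (shiftSeq X i ω) * G (shiftSeq X j ω)) P :=
  (hG.integrable hX j).bdd_mul (hF.measurable hX i).aestronglyMeasurable
    (.of_forall fun _ => hF.bound _)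

omit [IsProbabilityMeasure P] in
/-- The covariance of two local functions depends on the distance of their positions only. -/
lemma integral_mul_shiftSeq (hF : IsCenteredLocal P X F m M) (hG : IsCenteredLocal P X G m' M')
    (hX : ∀ i, Measurable (X i)) (hind : iIndepFun X P)
    (hid : ∀ i, IdentDistrib (X i) (X 0) P P) (i k : ℕ) :
    ∫ ω, F (shiftSeq X i ω) * G (shiftSeq X (i + k) ω) ∂P
      = ∫ ω, F (shiftSeq X 0 ω) * G (shiftSeq X k ω) ∂P := by
  have hG' : Measurable fun x : ℕ → ℕ => G fun r => x (k + r) :=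
    hG.measurable_fun.comp (measurable_pi_lambda _ fun r => measurable_pi_apply _)
  have h := ((identDistrib_shiftSeq hX hind hid i).comp (hF.measurable_fun.mul hG')).integral_eq
  have e : ∀ (i : ℕ) (ω : Ω), (fun r => shiftSeq X i ω (k + r)) = shiftSeq X (i + k) ω :=
    fun i ω => funext fun r => by rw [shiftSeq, shiftSeq, add_assoc]
  simpa only [Function.comp_def, Pi.mul_apply, e, zero_add] using h

omit [IsProbabilityMeasure P] in
lemma integral_mul_eq_zero (hF : IsCenteredLocal P X F m M) (hG : IsCenteredLocal P X G m' M')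
    (hX : ∀ i, Measurable (X i)) (hind : iIndepFun X P) {k : ℕ} (hk : m ≤ k) :
    ∫ ω, F (shiftSeq X 0 ω) * G (shiftSeq X k ω) ∂P = 0 := by
  have h : IndepFun (fun ω => F (shiftSeq X 0 ω)) (fun ω => G (shiftSeq X k ω)) P := by
    refine indepFun_of_dependsOn (A := Finset.Ico 0 (0 + m)) (B := Finset.Ico k (k + m'))
      hX hind (hF.dependsOn.comp_shift 0) (hG.dependsOn.comp_shift k) ?_
    rw [zero_add]
    exact Finset.disjoint_left.2 fun a ha hb => by
      rw [Finset.mem_Ico] at ha hb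
      omega
  rw [h.integral_fun_mul_eq_mul_integral (hF.measurable hX 0).aestronglyMeasurable
    (hG.measurable hX k).aestronglyMeasurable, hF.mean, zero_mul]

/-- The variance of a sum of `L` windows grows like `L` times the sum of all covariances. -/
lemma tendsto_integral_blockSum_sq_div (hF : IsCenteredLocal P X F m M)
    (hX : ∀ i, Measurable (X i)) (hind : iIndepFun X P)
    (hid : ∀ i, IdentDistrib (X i) (X 0) P P) :
    Tendsto (fun L : ℕ => (∫ ω, _root_.blockSum F L (shiftSeq X 0 ω) ^ 2 ∂P) / L) atTop
      (𝓝 (2 * ∑ k ∈ Finset.range m, ∫ ω, F (shiftSeq X 0 ω) * F (shiftSeq X k ω) ∂P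
        - ∫ ω, F (shiftSeq X 0 ω) * F (shiftSeq X 0 ω) ∂P)) := by
  set ρ : ℕ → ℝ := fun k => ∫ ω, F (shiftSeq X 0 ω) * F (shiftSeq X k ω) ∂P with hρ
  have hB : ∀ L ω, _root_.blockSum F L (shiftSeq X 0 ω)
      = ∑ i ∈ Finset.range L, F (shiftSeq X i ω) := fun L ω => by
    rw [blockSum_shiftSeq]
    simp only [zero_add]
  have hsum : ∀ L : ℕ, ∫ ω, _root_.blockSum F L (shiftSeq X 0 ω) ^ 2 ∂P
      = ∑ r ∈ Finset.range L, (2 * ∑ k ∈ Finset.range (r + 1), ρ k - ρ 0) := by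
    intro L
    simp only [hB]
    induction L with
    | zero => simp
    | succ L ih =>
      have h1 := hF.integrable_sum_pow hX (Finset.range L) 2
      have h2 : ∀ i ∈ Finset.range L,
          Integrable (fun ω => F (shiftSeq X i ω) * F (shiftSeq X L ω)) P :=
        fun i _ => hF.integrable_mul hF hX i L
      have h2' := (integrable_finsetSum _ h2).const_mul 2
      have h3 := hF.integrable_mul hF hX L L
      have h12 := h1.fun_add h2'
      have e : ∀ ω, (∑ i ∈ Finset.range (L + 1), F (shiftSeq X i ω)) ^ 2
          = ((∑ i ∈ Finset.range L, F (shiftSeq X i ω)) ^ 2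
            + 2 * ∑ i ∈ Finset.range L, F (shiftSeq X i ω) * F (shiftSeq X L ω))
            + F (shiftSeq X L ω) * F (shiftSeq X L ω) := fun ω => by
        rw [Finset.sum_range_succ, ← Finset.sum_mul]
        ring
      simp only [e]
      rw [integral_add h12 h3, integral_add h1 h2', integral_const_mul, integral_finsetSum _ h2,
        ih, Finset.sum_range_succ _ L]
      have h4 : ∀ i ∈ Finset.range L, ∫ ω, F (shiftSeq X i ω) * F (shiftSeq X L ω) ∂P
          = ρ (L - 1 - i + 1) := by
        intro i hi
        have hi := Finset.mem_range.1 hi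
        have := hF.integral_mul_shiftSeq hF hX hind hid i (L - 1 - i + 1)
        rwa [show i + (L - 1 - i + 1) = L by omega] at this
      have h5 : ∫ ω, F (shiftSeq X L ω) * F (shiftSeq X L ω) ∂P = ρ 0 := by
        simpa using hF.integral_mul_shiftSeq hF hX hind hid L 0
      rw [Finset.sum_congr rfl h4, Finset.sum_range_reflect (fun k => ρ (k + 1)), h5,
        Finset.sum_range_succ' ρ L]
      ring
  have hconst : Tendsto (fun r : ℕ => 2 * ∑ k ∈ Finset.range (r + 1), ρ k - ρ 0) atTop
      (𝓝 (2 * ∑ k ∈ Finset.range m, ρ k - ρ 0)) := by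
    refine tendsto_const_nhds.congr' ?_
    filter_upwards [eventually_ge_atTop m] with r hr
    congr 2
    refine Finset.sum_subset (fun k hk => ?_) fun k _ hk => ?_
    · rw [Finset.mem_range] at hk ⊢
      omega
    · rw [Finset.mem_range, not_lt] at hk
      exact hF.integral_mul_eq_zero hF hX hind hk
  refine hconst.cesaro.congr fun L => ?_
  rw [hsum, div_eq_inv_mul]

end IsCenteredLocal

/-! ### Tree patterns -/

namespace PlaneTree

lemma fringeCount_self (S : PlaneTree) : fringeCount S S = 1 := by
  classical
  let x : ℕ → ℕ := fun k => (word S).getD k 0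
  have hx : StartsWith x (word S) := fun k hk => by simp [x, hk]
  rw [← card_startsWith_eq_fringeCount S S hx, Finset.card_eq_one]
  refine ⟨0, Finset.ext fun i => ?_⟩
  simp only [Finset.mem_filter, Finset.mem_range, Finset.mem_singleton]
  constructor
  · rintro ⟨h1, h2⟩
    have := add_size_le_of_startsWith hx h1 h2
    omega
  · rintro rfl
    exact ⟨size_pos S, by simpa using hx⟩

open Classical in
/-- The indicator of the event that a sequence starts with the word of `S`, minus the number
`q S`. -/
noncomputable def pattern (q : PlaneTree → ℝ) (S : PlaneTree) (x : ℕ → ℕ) : ℝ :=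
  (if StartsWith x (word S) then 1 else 0) - q S

end PlaneTree

open PlaneTree

namespace IsCriticalSequence

variable {Ω : Type*} [MeasurableSpace Ω] {P : Measure Ω} [IsProbabilityMeasure P]
  {X : ℕ → Ω → ℕ} {σ2 : ℝ} (hX : IsCriticalSequence P X σ2)
  {q : PlaneTree → ℝ} (hq : ∀ S, q S = P.real {ω | StartsWith (shiftSeq X 0 ω) (word S)})
include hX

omit [IsProbabilityMeasure P] in
lemma measurableSet_startsWith (l : List ℕ) :
    MeasurableSet {ω | StartsWith (shiftSeq X 0 ω) l} := by
  have : {ω | StartsWith (shiftSeq X 0 ω) l} = ⋂ k, ⋂ hk : k < l.length, X (0 + k) ⁻¹' {l[k]} := by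
    ext ω
    simp [StartsWith, shiftSeq]
  rw [this]
  exact MeasurableSet.iInter fun k => MeasurableSet.iInter fun hk =>
    hX.measurable _ (measurableSet_singleton _)

include hq

omit [IsProbabilityMeasure P] in
lemma integral_startsWith_mul (S : PlaneTree) (c : ℝ) :
    ∫ ω, {ω | StartsWith (shiftSeq X 0 ω) (word S)}.indicator (fun _ => c) ω ∂P = q S * c := by
  rw [integral_indicator (hX.measurableSet_startsWith _), setIntegral_const, hq, smul_eq_mul]

lemma isCenteredLocal_pattern (S : PlaneTree) : IsCenteredLocal P X (pattern q S) S.size 1 where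
  pos := size_pos S
  dependsOn := fun x y h => by
    have : StartsWith x (word S) ↔ StartsWith y (word S) := by
      refine forall_congr' fun k => forall_congr' fun hk => ?_
      rw [h k (by simpa [length_word] using hk)]
    by_cases hx : StartsWith x (word S)
    · simp [pattern, hx, this.1 hx]
    · simp [pattern, hx, mt this.2 hx]
  bound_pos := one_pos
  bound := fun x => by
    have h0 : 0 ≤ q S := by rw [hq]; exact measureReal_nonneg
    have h1 : q S ≤ 1 := by rw [hq]; exact measureReal_le_one
    rw [pattern, abs_le]
    split_ifs <;> constructor <;> linarith
  mean := by
    have e : ∀ ω, pattern q S (shiftSeq X 0 ω)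
        = {ω | StartsWith (shiftSeq X 0 ω) (word S)}.indicator (fun _ => (1 : ℝ)) ω - q S :=
      fun ω => by
        by_cases h : StartsWith (shiftSeq X 0 ω) (word S) <;> simp [pattern, h]
    simp only [e]
    rw [integral_sub ((integrable_const _).indicator (hX.measurableSet_startsWith _))
      (integrable_const _), hX.integral_startsWith_mul hq, integral_const]
    simp

/-- To integrate a centred random variable against a pattern, only its values on the event that
the pattern occurs matter. -/
lemma integral_pattern_mul {S : PlaneTree} {W : Ω → ℝ} (hW : Integrable W P)
    (h0 : ∫ ω, W ω ∂P = 0) {c : ℝ}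
    (hc : ∀ ω, StartsWith (shiftSeq X 0 ω) (word S) → W ω = c) :
    ∫ ω, pattern q S (shiftSeq X 0 ω) * W ω ∂P = q S * c := by
  have e : ∀ ω, pattern q S (shiftSeq X 0 ω) * W ω
      = {ω | StartsWith (shiftSeq X 0 ω) (word S)}.indicator (fun _ => c) ω - q S * W ω := by
    intro ω
    rw [pattern, sub_mul]
    by_cases h : StartsWith (shiftSeq X 0 ω) (word S)
    · simp [h, hc ω h]
    · simp [h]
  simp only [e]
  rw [integral_sub ((integrable_const _).indicator (hX.measurableSet_startsWith _))
    (hW.const_mul _), integral_const_mul, h0, hX.integral_startsWith_mul hq, mul_zero, sub_zero]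

/-- The word of `S` has `|S|` letters with sum `|S| - 1`, so on the event that it occurs the centred
sum of these letters is `-1`. -/
lemma integral_pattern_mul_sum_centered (S : PlaneTree) {m : ℕ} (hm : S.size ≤ m) :
    ∫ ω, pattern q S (shiftSeq X 0 ω) * ∑ k ∈ Finset.range m, ((X k ω : ℝ) - 1) ∂P = -q S := by
  rw [hX.integral_mul_sum_centered (hX.isCenteredLocal_pattern hq S) (by simpa using hm),
    hX.integral_pattern_mul hq (c := -1) ((hX.memLp_sum_centered _).integrable one_le_two)
      (hX.integral_sum_centered _), mul_neg_one]
  intro ω h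
  have h1 := h.sum_take (n := S.size) (by rw [length_word])
  rw [← length_word, List.take_length, length_word] at h1
  have h2 := sum_word S
  rw [h1] at h2
  have h3 : ((∑ k ∈ Finset.range S.size, X k ω : ℕ) : ℝ) + 1 = S.size := by
    have e : ∀ k, shiftSeq X 0 ω k = X k ω := fun k => by rw [shiftSeq, zero_add]
    simp only [e] at h2
    exact_mod_cast h2
  push_cast at h3
  rw [Finset.sum_sub_distrib, Finset.sum_const, Finset.card_range, nsmul_one]
  linarith

open Classical in
lemma integral_pattern_mul_pattern (S T : PlaneTree) :
    ∫ ω, pattern q S (shiftSeq X 0 ω) * pattern q T (shiftSeq X 0 ω) ∂P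
      = (if S = T then q S else 0) - q S * q T := by
  have hT := hX.isCenteredLocal_pattern hq T
  rw [hX.integral_pattern_mul hq (c := (if S = T then 1 else 0) - q T)
    (hT.integrable hX.measurable 0) hT.mean]
  · split_ifs <;> ring
  · intro ω h
    have : StartsWith (shiftSeq X 0 ω) (word T) ↔ S = T :=
      ⟨fun hT => eq_of_startsWith h hT, fun e => e ▸ h⟩
    simp only [pattern, this]

/-- The sum of the covariances of the pattern `S` with the patterns `T` that start inside it. -/
lemma sum_integral_pattern_mul_pattern (S T : PlaneTree) {m : ℕ} (hm : S.size ≤ m) :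
    ∑ k ∈ Finset.range m, ∫ ω, pattern q S (shiftSeq X 0 ω) * pattern q T (shiftSeq X k ω) ∂P
      = q S * (fringeCount T S - S.size * q T) := by
  classical
  have hS := hX.isCenteredLocal_pattern hq S
  have hT := hX.isCenteredLocal_pattern hq T
  have h1 : ∀ k ∈ Finset.range S.size, Integrable (fun ω => pattern q T (shiftSeq X k ω)) P :=
    fun k _ => hT.integrable hX.measurable k
  rw [← Finset.sum_subset (Finset.range_mono hm) fun k _ hk =>
    hS.integral_mul_eq_zero hT hX.measurable hX.indep
      (not_lt.1 (mt Finset.mem_range.2 hk)),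
    ← integral_finsetSum _ fun k _ => hS.integrable_mul hT hX.measurable 0 k]
  simp only [← Finset.mul_sum]
  refine hX.integral_pattern_mul hq (integrable_finsetSum _ h1) ?_ fun ω h => ?_
  · rw [integral_finsetSum _ h1]
    exact Finset.sum_eq_zero fun k _ => hT.integral_shiftSeq hX.measurable hX.indep hX.ident k
  · rw [← card_startsWith_eq_fringeCount T S h]
    have e : ∀ i, (fun k => shiftSeq X 0 ω (i + k)) = shiftSeq X i ω := fun i =>
      funext fun k => by rw [shiftSeq, shiftSeq, zero_add]
    simp only [pattern, Finset.sum_sub_distrib, Finset.sum_const, Finset.card_range, nsmul_eq_mul,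
      e]
    rw [Finset.card_filter]
    push_cast
    rfl

omit hX hq in
/-- Both cases of the definition of `γ` in one formula, since a tree contains itself exactly once as
a fringe subtree. -/
lemma _root_.gwGamma_eq (q : PlaneTree → ℝ) (σ2 : ℝ) (S T : PlaneTree) [Decidable (S = T)] :
    gwGamma q σ2 S T = q S * (fringeCount T S - S.size * q T)
      + q T * (fringeCount S T - T.size * q S)
      - ((if S = T then q S else 0) - q S * q T) - q S * q T / σ2 := by
  unfold gwGamma
  by_cases h : S = T
  · subst h
    simp only [if_true, fringeCount_self, Nat.cast_one]
    ring
  · simp only [h, if_false]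
    ring

omit hX hq in
lemma _root_.gwGamma_comm (q : PlaneTree → ℝ) (σ2 : ℝ) (S T : PlaneTree) :
    gwGamma q σ2 S T = gwGamma q σ2 T S := by
  classical
  rw [gwGamma_eq, gwGamma_eq]
  by_cases h : S = T
  · subst h
    ring
  · simp only [h, Ne.symm h, if_false]
    ring

variable {ι : Type*} [Fintype ι] (S : ι → PlaneTree) (a : ι → ℝ)

lemma isCenteredLocal_sum_pattern :
    IsCenteredLocal P X (fun x => ∑ i, a i * pattern q (S i) x) (∑ i, (S i).size + 1)
      (∑ i, |a i| + 1) where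
  pos := Nat.succ_pos _
  dependsOn := fun x y h => by
    refine Finset.sum_congr rfl fun i hi => ?_
    rw [(hX.isCenteredLocal_pattern hq (S i)).dependsOn fun k hk => h k ?_]
    have h1 := Finset.single_le_sum (f := fun i => (S i).size) (fun i _ => Nat.zero_le _) hi
    simp only [Set.mem_Iio] at hk ⊢
    omega
  bound_pos := by positivity
  bound := fun x => by
    refine (Finset.abs_sum_le_sum_abs _ _).trans (le_add_of_le_of_nonneg
      (Finset.sum_le_sum fun i _ => ?_) zero_le_one)
    rw [abs_mul]
    exact mul_le_of_le_one_right (abs_nonneg _) ((hX.isCenteredLocal_pattern hq (S i)).bound x)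
  mean := by
    have h := fun i => hX.isCenteredLocal_pattern hq (S i)
    rw [integral_finsetSum _ fun i _ => ((h i).integrable hX.measurable 0).const_mul (a i)]
    refine Finset.sum_eq_zero fun i _ => ?_
    rw [integral_const_mul, (h i).mean, mul_zero]

/-- The asymptotic variance of a linear combination of pattern counts given the total sum: the sum
of the covariances over all distances (both signs, hence twice the sum over `k ≥ 0` minus the term
`k = 0`), less the part explained by the linear regression on the total sum. -/
lemma asymptotic_variance_sum_pattern :
    (2 * ∑ k ∈ Finset.range (∑ i, (S i).size + 1),
        ∫ ω, (∑ i, a i * pattern q (S i) (shiftSeq X 0 ω))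
          * (∑ i, a i * pattern q (S i) (shiftSeq X k ω)) ∂P
        - ∫ ω, (∑ i, a i * pattern q (S i) (shiftSeq X 0 ω))
          * (∑ i, a i * pattern q (S i) (shiftSeq X 0 ω)) ∂P)
      - (∫ ω, (∑ i, a i * pattern q (S i) (shiftSeq X 0 ω))
          * ∑ k ∈ Finset.range (∑ i, (S i).size + 1), ((X k ω : ℝ) - 1) ∂P) ^ 2 / σ2
      = ∑ i, ∑ j, a i * a j * gwGamma q σ2 (S i) (S j) := by
  classical
  set m := ∑ i, (S i).size + 1 with hm
  have hle : ∀ i, (S i).size ≤ m := fun i =>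
    (Finset.single_le_sum (f := fun i => (S i).size) (fun i _ => Nat.zero_le _)
      (Finset.mem_univ i)).trans (Nat.le_succ _)
  have h := fun i => hX.isCenteredLocal_pattern hq (S i)
  have h1 : ∀ k, ∫ ω, (∑ i, a i * pattern q (S i) (shiftSeq X 0 ω))
      * (∑ i, a i * pattern q (S i) (shiftSeq X k ω)) ∂P
      = ∑ i, ∑ j, a i * a j
        * ∫ ω, pattern q (S i) (shiftSeq X 0 ω) * pattern q (S j) (shiftSeq X k ω) ∂P := by
    intro k
    simp only [Finset.sum_mul_sum, mul_mul_mul_comm (a _)]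
    have hi : ∀ i j, Integrable (fun ω => a i * a j * (pattern q (S i) (shiftSeq X 0 ω)
        * pattern q (S j) (shiftSeq X k ω))) P :=
      fun i j => ((h i).integrable_mul (h j) hX.measurable 0 k).const_mul _
    rw [integral_finsetSum _ fun i _ => integrable_finsetSum _ fun j _ => hi i j]
    refine Finset.sum_congr rfl fun i _ => ?_
    rw [integral_finsetSum _ fun j _ => hi i j]
    exact Finset.sum_congr rfl fun j _ => integral_const_mul _ _
  have h2 : ∫ ω, (∑ i, a i * pattern q (S i) (shiftSeq X 0 ω))
      * ∑ k ∈ Finset.range m, ((X k ω : ℝ) - 1) ∂P = ∑ i, a i * -q (S i) := by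
    simp only [Finset.sum_mul, mul_assoc]
    rw [integral_finsetSum _ fun i _ =>
      (hX.integrable_mul_sum_centered (h i) 0 (Finset.range m)).const_mul (a i)]
    refine Finset.sum_congr rfl fun i _ => ?_
    rw [integral_const_mul, hX.integral_pattern_mul_sum_centered hq (S i) (hle i)]
  have h3 : ∑ k ∈ Finset.range m, ∑ i, ∑ j, a i * a j
        * ∫ ω, pattern q (S i) (shiftSeq X 0 ω) * pattern q (S j) (shiftSeq X k ω) ∂P
      = ∑ i, ∑ j, a i * a j * (q (S i) * (fringeCount (S j) (S i) - (S i).size * q (S j))) := by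
    rw [Finset.sum_comm]
    refine Finset.sum_congr rfl fun i _ => ?_
    rw [Finset.sum_comm]
    refine Finset.sum_congr rfl fun j _ => ?_
    rw [← Finset.mul_sum, hX.sum_integral_pattern_mul_pattern hq _ _ (hle i)]
  have h4 : ∑ i, ∑ j, a i * a j * (q (S i) * (fringeCount (S j) (S i) - (S i).size * q (S j)))
      = ∑ i, ∑ j, a i * a j * (q (S j) * (fringeCount (S i) (S j) - (S j).size * q (S i))) := by
    rw [Finset.sum_comm]
    exact Finset.sum_congr rfl fun i _ => Finset.sum_congr rfl fun j _ => by ring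
  have h5 : (∑ i, a i * -q (S i)) ^ 2 / σ2
      = ∑ i, ∑ j, a i * a j * (q (S i) * q (S j) / σ2) := by
    rw [sq, Finset.sum_mul_sum, Finset.sum_div]
    refine Finset.sum_congr rfl fun i _ => ?_
    rw [Finset.sum_div]
    exact Finset.sum_congr rfl fun j _ => by ring
  simp only [h1, hX.integral_pattern_mul_pattern hq]
  rw [h2, h3, h5, two_mul]
  nth_rewrite 2 [h4]
  simp only [← Finset.sum_add_distrib, ← Finset.sum_sub_distrib]
  refine Finset.sum_congr rfl fun i _ => Finset.sum_congr rfl fun j _ => ?_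
  rw [gwGamma_eq]
  ring

end IsCriticalSequence

/-! ### Convergence of moments from convergence of characteristic functions -/

lemma abs_sin_sub_self_le (x : ℝ) : |Real.sin x - x| ≤ 2 * x ^ 2 := by
  have h : ∀ x : ℝ, 0 ≤ x → |Real.sin x - x| ≤ 2 * x ^ 2 := by
    intro x hx
    rcases hx.eq_or_lt with rfl | hx
    · simp
    · have h1 := Real.sin_lt hx
      rw [abs_of_neg (by linarith)]
      rcases le_total x 1 with h2 | h2
      · have h3 := Real.sin_gt_sub_cube hx
        nlinarith [mul_nonneg (sq_nonneg x) (sub_nonneg.2 h2), sq_nonneg x]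
      · have h3 := Real.neg_one_le_sin x
        nlinarith
  rcases le_total 0 x with hx | hx
  · exact h x hx
  · have := h (-x) (by linarith)
    rw [Real.sin_neg, ← abs_neg] at this
    convert this using 2 <;> ring

lemma abs_cos_sub_le (x : ℝ) : |Real.cos x - (1 - x ^ 2 / 2)| ≤ x ^ 4 := by
  have h4 : |x| ^ 4 = x ^ 4 := by rw [← abs_pow, abs_of_nonneg (by positivity)]
  rcases le_total |x| 1 with h | h
  · have h1 := Real.cos_bound h
    rw [h4] at h1
    nlinarith [pow_nonneg (sq_nonneg x) 2]
  · have h1 : 1 ≤ x ^ 2 := by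
      rw [← sq_abs]
      exact one_le_pow₀ h
    rw [abs_le]
    constructor <;> nlinarith [Real.cos_le_one x, Real.one_sub_sq_div_two_le_cos (x := x)]

/-- If the characteristic functions of random variables `W n` converge to that of a centred normal
law of variance `v`, and the fourth moments are bounded, then the first two moments converge. -/
theorem tendsto_moments_of_tendsto_charFun {ι Ω : Type*} [MeasurableSpace Ω] {l : Filter ι}
    {μ : ι → Measure Ω} [∀ n, IsProbabilityMeasure (μ n)] {W : ι → Ω → ℝ} {v C : ℝ}
    (hW : ∀ n, Measurable (W n)) (hint : ∀ n, Integrable (fun ω => W n ω ^ 4) (μ n))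
    (hC : ∀ n, ∫ ω, W n ω ^ 4 ∂(μ n) ≤ C)
    (hlim : ∀ t : ℝ, Tendsto (fun n => ∫ ω, Complex.exp ((t * W n ω : ℝ) * Complex.I) ∂(μ n)) l
      (𝓝 (Complex.exp (-(t ^ 2 * v : ℝ) / 2)))) :
    Tendsto (fun n => ∫ ω, W n ω ∂(μ n)) l (𝓝 0)
      ∧ Tendsto (fun n => ∫ ω, W n ω ^ 2 ∂(μ n)) l (𝓝 v) := by
  rcases l.eq_or_neBot with rfl | hl
  · exact ⟨tendsto_bot, tendsto_bot⟩
  have hC0 : 0 ≤ C := by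
    obtain ⟨n⟩ := hl.nonempty
    exact (integral_nonneg fun ω => by positivity).trans (hC n)
  have hsq : ∀ n, Integrable (fun ω => W n ω ^ 2) (μ n) := fun n => by
    refine ((integrable_const (1 : ℝ)).add (hint n)).mono'
      ((hW n).pow_const 2).aestronglyMeasurable (.of_forall fun ω => ?_)
    rw [Real.norm_of_nonneg (by positivity)]
    simp only [Pi.add_apply]
    nlinarith [sq_nonneg (W n ω ^ 2 - 1)]
  have hsqC : ∀ n, ∫ ω, W n ω ^ 2 ∂(μ n) ≤ 1 + C := fun n => by
    have h1 : ∫ ω, W n ω ^ 2 ∂(μ n) ≤ ∫ ω, (1 + W n ω ^ 4) ∂(μ n) :=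
      integral_mono (hsq n) ((integrable_const (1 : ℝ)).add (hint n)) fun ω => by
        nlinarith [sq_nonneg (W n ω ^ 2 - 1)]
    rw [integral_add (integrable_const _) (hint n), integral_const, probReal_univ, one_smul] at h1
    linarith [hC n]
  have h1 : ∀ n, Integrable (W n) (μ n) := fun n => by
    refine ((integrable_const (1 : ℝ)).add (hsq n)).mono' (hW n).aestronglyMeasurable
      (.of_forall fun ω => ?_)
    rw [Real.norm_eq_abs]
    simp only [Pi.add_apply]
    nlinarith [sq_nonneg (|W n ω| - 1), sq_abs (W n ω), abs_nonneg (W n ω)]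
  have hexp : ∀ n (t : ℝ), Integrable (fun ω => Complex.exp ((t * W n ω : ℝ) * Complex.I)) (μ n) :=
    fun n t => Integrable.of_bound (by have := hW n; fun_prop) 1
      (.of_forall fun ω => (Complex.norm_exp_ofReal_mul_I _).le)
  have hsin : ∀ t : ℝ, Tendsto (fun n => ∫ ω, Real.sin (t * W n ω) ∂(μ n)) l (𝓝 0) := by
    intro t
    have h := (Complex.continuous_im.tendsto _).comp (hlim t)
    have e : (-((t ^ 2 * v : ℝ) : ℂ) / 2) = ((-(t ^ 2 * v) / 2 : ℝ) : ℂ) := by push_cast; ring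
    rw [e, ← Complex.ofReal_exp, Complex.ofReal_im] at h
    refine h.congr fun n => ?_
    simp only [Function.comp_apply]
    rw [← RCLike.im_eq_complex_im, ← integral_im (hexp n t)]
    simp only [RCLike.im_eq_complex_im, Complex.exp_ofReal_mul_I_im]
  have hcos : ∀ t : ℝ, Tendsto (fun n => ∫ ω, Real.cos (t * W n ω) ∂(μ n)) l
      (𝓝 (Real.exp (-(t ^ 2 * v) / 2))) := by
    intro t
    have h := (Complex.continuous_re.tendsto _).comp (hlim t)
    have e : (-((t ^ 2 * v : ℝ) : ℂ) / 2) = ((-(t ^ 2 * v) / 2 : ℝ) : ℂ) := by push_cast; ring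
    rw [e, ← Complex.ofReal_exp, Complex.ofReal_re] at h
    refine h.congr fun n => ?_
    simp only [Function.comp_apply]
    rw [← RCLike.re_eq_complex_re, ← integral_re (hexp n t)]
    simp only [RCLike.re_eq_complex_re, Complex.exp_ofReal_mul_I_re]
  have hsini : ∀ n (t : ℝ), Integrable (fun ω => Real.sin (t * W n ω)) (μ n) := fun n t =>
    Integrable.of_bound (by have := hW n; fun_prop) 1 (.of_forall fun ω => Real.abs_sin_le_one _)
  have hcosi : ∀ n (t : ℝ), Integrable (fun ω => Real.cos (t * W n ω)) (μ n) := fun n t =>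
    Integrable.of_bound (by have := hW n; fun_prop) 1 (.of_forall fun ω => Real.abs_cos_le_one _)
  constructor
  · rw [Metric.tendsto_nhds]
    intro e he
    -- this `t` makes the error of the linear approximation of `sin` smaller than `e / 2`
    set t : ℝ := e / (4 * (1 + C)) with ht
    have ht0 : 0 < t := by positivity
    filter_upwards [Metric.tendsto_nhds.1 (hsin t) (t * (e / 2)) (by positivity)] with n hn
    rw [Real.dist_eq, sub_zero] at hn ⊢
    have h2 : |∫ ω, Real.sin (t * W n ω) ∂(μ n) - t * ∫ ω, W n ω ∂(μ n)| ≤ 2 * t ^ 2 * (1 + C) := by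
      rw [← integral_const_mul, ← integral_sub (hsini n t) ((h1 n).const_mul t)]
      refine (abs_integral_le_integral_abs).trans ?_
      calc _ ≤ ∫ ω, 2 * t ^ 2 * W n ω ^ 2 ∂(μ n) := by
            refine integral_mono ((hsini n t).sub ((h1 n).const_mul t)).abs
              ((hsq n).const_mul _) fun ω => ?_
            refine (abs_sin_sub_self_le _).trans (le_of_eq ?_)
            ring
        _ ≤ _ := by
            rw [integral_const_mul]
            exact mul_le_mul_of_nonneg_left (hsqC n) (by positivity)
    have h3 : 2 * t ^ 2 * (1 + C) = t * (e / 2) := by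
      rw [ht]
      field_simp
      ring
    have h4 : |t * ∫ ω, W n ω ∂(μ n)| < t * e := by
      have h5 := abs_sub_abs_le_abs_sub (t * ∫ ω, W n ω ∂(μ n)) (∫ ω, Real.sin (t * W n ω) ∂(μ n))
      rw [abs_sub_comm] at h5
      linarith
    rw [abs_mul, abs_of_pos ht0] at h4
    exact lt_of_mul_lt_mul_left h4 ht0.le
  · rw [Metric.tendsto_nhds]
    intro e he
    -- a positive `s = t ^ 2` for which the quadratic approximations are accurate
    obtain ⟨s, hs0, hs1, hs2⟩ : ∃ s : ℝ, 0 < s ∧ s * |v| ≤ 2 ∧ s * (2 * C + v ^ 2) ≤ e / 2 := by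
      refine ⟨min (2 / (|v| + 1)) (e / 2 / (2 * C + v ^ 2 + 1)), by positivity, ?_, ?_⟩
      · refine (mul_le_mul_of_nonneg_right (min_le_left _ _) (abs_nonneg _)).trans ?_
        rw [div_mul_eq_mul_div, div_le_iff₀ (by positivity)]
        linarith
      · refine (mul_le_mul_of_nonneg_right (min_le_right _ _) (by positivity)).trans ?_
        rw [div_mul_eq_mul_div, div_le_iff₀ (by positivity)]
        nlinarith
    set t := Real.sqrt s with ht
    have hts : t ^ 2 = s := Real.sq_sqrt hs0.le
    filter_upwards [Metric.tendsto_nhds.1 (hcos t) (s * (e / 4)) (by positivity)] with n hn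
    rw [Real.dist_eq] at hn ⊢
    rw [hts] at hn
    have h2 : |∫ ω, Real.cos (t * W n ω) ∂(μ n) - (1 - s / 2 * ∫ ω, W n ω ^ 2 ∂(μ n))|
        ≤ s ^ 2 * C := by
      have e1 : 1 - s / 2 * ∫ ω, W n ω ^ 2 ∂(μ n) = ∫ ω, (1 - s / 2 * W n ω ^ 2) ∂(μ n) := by
        rw [integral_sub (integrable_const _) ((hsq n).const_mul _), integral_const_mul,
          integral_const, probReal_univ, one_smul]
      have hi : Integrable (fun ω => 1 - s / 2 * W n ω ^ 2) (μ n) :=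
        (integrable_const (1 : ℝ)).sub ((hsq n).const_mul (s / 2))
      rw [e1, ← integral_sub (hcosi n t) hi]
      refine (abs_integral_le_integral_abs).trans ?_
      calc _ ≤ ∫ ω, s ^ 2 * W n ω ^ 4 ∂(μ n) := by
            refine integral_mono ((hcosi n t).sub hi).abs ((hint n).const_mul _) fun ω => ?_
            have h3 := abs_cos_sub_le (t * W n ω)
            rw [mul_pow, mul_pow, hts, show t ^ 4 = (t ^ 2) ^ 2 by ring, hts, mul_div_right_comm]
              at h3
            exact h3
        _ ≤ _ := by
            rw [integral_const_mul]
            exact mul_le_mul_of_nonneg_left (hC n) (by positivity)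
    have h3 : |Real.exp (-(s * v) / 2) - 1 - -(s * v) / 2| ≤ (-(s * v) / 2) ^ 2 := by
      refine Real.abs_exp_sub_one_sub_id_le ?_
      rw [abs_div, abs_neg, abs_mul, abs_of_pos hs0, abs_two]
      linarith
    have h4 : |s / 2 * (∫ ω, W n ω ^ 2 ∂(μ n) - v)| < s / 2 * e := by
      have h5 : s / 2 * (s * (2 * C + v ^ 2)) ≤ s / 2 * (e / 2) :=
        mul_le_mul_of_nonneg_left hs2 (by positivity)
      have h6 := abs_lt.1 hn
      have h7 := abs_le.1 h2
      have h8 := abs_le.1 h3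
      have h9 : 0 ≤ s ^ 2 * v ^ 2 := by positivity
      rw [abs_lt]
      constructor <;> nlinarith
    rw [abs_mul, abs_of_pos (by positivity)] at h4
    exact lt_of_mul_lt_mul_left h4 (by positivity)

/-! ### Gaussian limits in a countable product -/

section GaussianLimit

variable {T : Type} {Γ : T → T → ℝ}

/-- The finite linear combinations of the coordinates have the characteristic functions of a
centred Gaussian family with covariances `Γ`. The same coordinate may occur several times in a
linear combination. -/
def HasGaussianCharFun (ν : Measure (T → ℝ)) (Γ : T → T → ℝ) : Prop :=
  ∀ (ι : Type) [Fintype ι] (S : ι → T) (a : ι → ℝ),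
    ∫ z, Complex.exp ((∑ i, a i * z (S i) : ℝ) * Complex.I) ∂ν
      = Complex.exp (-(∑ i, ∑ j, a i * a j * Γ (S i) (S j) : ℝ) / 2)

namespace HasGaussianCharFun

variable {ν ν' : Measure (T → ℝ)} [IsProbabilityMeasure ν] [IsProbabilityMeasure ν']

lemma map_eq_gaussianReal (h : HasGaussianCharFun ν Γ) {ι : Type} [Fintype ι] (S : ι → T)
    (a : ι → ℝ) : 0 ≤ ∑ i, ∑ j, a i * a j * Γ (S i) (S j) ∧
      ν.map (fun z => ∑ i, a i * z (S i))
        = gaussianReal 0 (∑ i, ∑ j, a i * a j * Γ (S i) (S j)).toNNReal := by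
  set v := ∑ i, ∑ j, a i * a j * Γ (S i) (S j) with hv
  have hm : Measurable fun z : T → ℝ => ∑ i, a i * z (S i) := by fun_prop
  have hv0 : 0 ≤ v := by
    have h1 : ‖∫ z, Complex.exp ((∑ i, a i * z (S i) : ℝ) * Complex.I) ∂ν‖ ≤ 1 := by
      refine (norm_integral_le_integral_norm _).trans ?_
      simp only [Complex.norm_exp_ofReal_mul_I]
      simp
    rw [h ι S a, ← hv, Complex.norm_exp] at h1
    have e : (-(v : ℂ) / 2) = ((-v / 2 : ℝ) : ℂ) := by push_cast; ring
    rw [e, Complex.ofReal_re, Real.exp_le_one_iff] at h1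
    linarith
  refine ⟨hv0, ?_⟩
  have := Measure.isProbabilityMeasure_map hm.aemeasurable (μ := ν)
  refine Measure.ext_of_charFun (funext fun t => ?_)
  rw [charFun_apply_real, integral_map hm.aemeasurable (by fun_prop), charFun_gaussianReal]
  have h1 := h ι S fun i => t * a i
  have e1 : ∀ z : T → ℝ, ((∑ i, t * a i * z (S i) : ℝ) : ℂ) = t * ((∑ i, a i * z (S i) : ℝ) : ℂ) :=
    fun z => by
      rw [← Complex.ofReal_mul, Finset.mul_sum]
      simp only [mul_assoc]
  have e2 : ∑ i, ∑ j, t * a i * (t * a j) * Γ (S i) (S j) = t ^ 2 * v := by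
    rw [hv, Finset.mul_sum]
    refine Finset.sum_congr rfl fun i _ => ?_
    rw [Finset.mul_sum]
    exact Finset.sum_congr rfl fun j _ => by ring
  simp only [e1] at h1
  rw [h1, e2]
  congr 1
  rw [show ((v.toNNReal : ℝ) : ℂ) = v by rw [Real.coe_toNNReal v hv0]]
  push_cast
  ring

lemma exists_continuousLinearMap_eq_sum {I : Finset T} (L : (I → ℝ) →L[ℝ] ℝ) :
    ∃ c : I → ℝ, ∀ z, L z = ∑ i, c i * z i := by
  classical
  refine ⟨fun i => L fun j => if i = j then 1 else 0, fun z => ?_⟩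
  have h := L.toLinearMap.pi_apply_eq_sum_univ z
  simp only [ContinuousLinearMap.coe_coe, smul_eq_mul] at h
  rw [h]
  exact Finset.sum_congr rfl fun i _ => mul_comm _ _

/-- A law in a product space is determined by the characteristic functions of the finite linear
combinations of the coordinates. -/
lemma ext (h : HasGaussianCharFun ν Γ) (h' : HasGaussianCharFun ν' Γ) : ν = ν' := by
  have hp : ∀ I : Finset T, IsProbabilityMeasure (ν'.map I.restrict) := fun I =>
    Measure.isProbabilityMeasure_map (by fun_prop)
  have hp' : ∀ I : Finset T, IsProbabilityMeasure (ν.map I.restrict) := fun I =>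
    Measure.isProbabilityMeasure_map (by fun_prop)
  refine IsProjectiveLimit.unique (P := fun I => ν'.map I.restrict) (fun I => ?_) fun I => rfl
  refine Measure.ext_of_charFunDual (funext fun L => ?_)
  rw [charFunDual_apply, charFunDual_apply, integral_map (by fun_prop) (by fun_prop),
    integral_map (by fun_prop) (by fun_prop)]
  obtain ⟨c, hc⟩ := exists_continuousLinearMap_eq_sum L
  simp only [hc, Finset.restrict]
  rw [h I (fun i => i), h' I (fun i => i)]

lemma isGaussianProcess (h : HasGaussianCharFun ν Γ) :
    IsGaussianProcess (fun (t : T) (z : T → ℝ) => z t) ν where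
  hasGaussianLaw I := by
    refine ⟨isGaussian_of_map_eq_gaussianReal fun L => ?_⟩
    obtain ⟨c, hc⟩ := exists_continuousLinearMap_eq_sum L
    refine ⟨0, (∑ i : I, ∑ j : I, c i * c j * Γ i j).toNNReal, ?_⟩
    rw [Measure.map_map L.continuous.measurable (by fun_prop),
      ← (h.map_eq_gaussianReal (fun i : I => (i : T)) c).2]
    congr 1
    ext z
    exact hc _

lemma memLp_coord (h : HasGaussianCharFun ν Γ) (t : T) : MemLp (fun z : T → ℝ => z t) 2 ν := by
  have hm : AEMeasurable (fun z : T → ℝ => z t) ν := (measurable_pi_apply t).aemeasurable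
  have h1 := (h.map_eq_gaussianReal (ι := Unit) (fun _ => t) fun _ => 1).2
  simp only [Finset.univ_unique, Finset.sum_singleton, one_mul] at h1
  have h2 := memLp_id_gaussianReal' (μ := 0) (v := (Γ t t).toNNReal) 2 (by simp)
  rw [← h1, memLp_map_measure_iff (by fun_prop) hm] at h2
  exact h2

lemma integral_coord (h : HasGaussianCharFun ν Γ) (t : T) : ∫ z : T → ℝ, z t ∂ν = 0 := by
  have h1 := (h.map_eq_gaussianReal (ι := Unit) (fun _ => t) fun _ => 1).2
  simp only [Finset.univ_unique, Finset.sum_singleton, one_mul] at h1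
  have h2 := integral_id_gaussianReal (μ := 0) (v := (Γ t t).toNNReal)
  rwa [← h1, integral_map (measurable_pi_apply t).aemeasurable (by fun_prop)] at h2

lemma integral_sum_sq (h : HasGaussianCharFun ν Γ) {ι : Type} [Fintype ι] (S : ι → T)
    (a : ι → ℝ) : ∫ z : T → ℝ, (∑ i, a i * z (S i)) ^ 2 ∂ν
      = ∑ i, ∑ j, a i * a j * Γ (S i) (S j) := by
  have hm : Measurable fun z : T → ℝ => ∑ i, a i * z (S i) := by fun_prop
  obtain ⟨h0, h1⟩ := h.map_eq_gaussianReal S a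
  have h2 := variance_id_gaussianReal (μ := 0) (v := (∑ i, ∑ j, a i * a j * Γ (S i) (S j)).toNNReal)
  rw [variance_of_integral_eq_zero (X := id) (by fun_prop) integral_id_gaussianReal, ← h1,
    integral_map hm.aemeasurable (by fun_prop), Real.coe_toNNReal _ h0] at h2
  exact h2

/-- Polarization. -/
lemma covariance_coord (h : HasGaussianCharFun ν Γ) (hΓ : ∀ s t, Γ s t = Γ t s) (s t : T) :
    covariance (fun z : T → ℝ => z s) (fun z => z t) ν = Γ s t := by
  have hs := h.memLp_coord s
  have ht := h.memLp_coord t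
  rw [covariance_eq_sub hs ht, h.integral_coord, zero_mul, sub_zero]
  have h1 := h.integral_sum_sq ![s, t] ![1, 1]
  have h2 := h.integral_sum_sq ![s, t] ![1, -1]
  simp only [Fin.sum_univ_two, Matrix.cons_val_zero, Matrix.cons_val_one] at h1 h2
  have h3 : ∫ z : T → ℝ, (1 * z s + 1 * z t) ^ 2 ∂ν - ∫ z : T → ℝ, (1 * z s + -1 * z t) ^ 2 ∂ν
      = 4 * ∫ z : T → ℝ, z s * z t ∂ν := by
    have hp : MemLp (fun z : T → ℝ => 1 * z s + 1 * z t) 2 ν :=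
      (hs.const_mul 1).add (ht.const_mul 1)
    have hm : MemLp (fun z : T → ℝ => 1 * z s + -1 * z t) 2 ν :=
      (hs.const_mul 1).add (ht.const_mul (-1))
    rw [← integral_sub hp.integrable_sq
      hm.integrable_sq, ← integral_const_mul]
    refine integral_congr_ae (.of_forall fun z => ?_)
    simp only
    ring
  rw [h1, h2, hΓ t s] at h3
  simp only [Pi.mul_apply]
  linarith

end HasGaussianCharFun

/-- Convergence of means and covariances, under bounds for the fourth moments. -/
theorem tendsto_moments_coord {N : Type*} {l : Filter N} {μ : N → Measure (T → ℝ)}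
    [∀ n, IsProbabilityMeasure (μ n)] (hΓ : ∀ s t, Γ s t = Γ t s)
    (hmom : ∀ (ι : Type) [Fintype ι] (S : ι → T) (a : ι → ℝ), ∃ C : ℝ, ∀ n,
      Integrable (fun z : T → ℝ => (∑ i, a i * z (S i)) ^ 4) (μ n)
        ∧ ∫ z, (∑ i, a i * z (S i)) ^ 4 ∂(μ n) ≤ C)
    (hlim : ∀ (ι : Type) [Fintype ι] (S : ι → T) (a : ι → ℝ),
      Tendsto (fun n => ∫ z, Complex.exp ((∑ i, a i * z (S i) : ℝ) * Complex.I) ∂(μ n)) l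
        (𝓝 (Complex.exp (-(∑ i, ∑ j, a i * a j * Γ (S i) (S j) : ℝ) / 2)))) :
    (∀ n t, MemLp (fun z : T → ℝ => z t) 2 (μ n)) ∧
    (∀ t, Tendsto (fun n => ∫ z, z t ∂(μ n)) l (𝓝 0)) ∧
    ∀ s t, Tendsto (fun n => ∫ z, z s * z t ∂(μ n)) l (𝓝 (Γ s t)) := by
  have key : ∀ (ι : Type) [Fintype ι] (S : ι → T) (a : ι → ℝ),
      Tendsto (fun n => ∫ z, ∑ i, a i * z (S i) ∂(μ n)) l (𝓝 0)
        ∧ Tendsto (fun n => ∫ z, (∑ i, a i * z (S i)) ^ 2 ∂(μ n)) l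
          (𝓝 (∑ i, ∑ j, a i * a j * Γ (S i) (S j))) := by
    intro ι _ S a
    obtain ⟨C, hC⟩ := hmom ι S a
    have hm : Measurable fun z : T → ℝ => ∑ i, a i * z (S i) := by fun_prop
    refine tendsto_moments_of_tendsto_charFun (μ := μ) (W := fun _ z => ∑ i, a i * z (S i))
      (v := ∑ i, ∑ j, a i * a j * Γ (S i) (S j)) (C := C)
      (fun _ => hm) (fun n => (hC n).1) (fun n => (hC n).2) fun t => ?_
    have h := hlim ι S fun i => t * a i
    have e1 : ∀ z : T → ℝ, ∑ i, t * a i * z (S i) = t * ∑ i, a i * z (S i) := fun z => by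
      rw [Finset.mul_sum]
      simp only [mul_assoc]
    have e2 : ∑ i, ∑ j, t * a i * (t * a j) * Γ (S i) (S j)
        = t ^ 2 * ∑ i, ∑ j, a i * a j * Γ (S i) (S j) := by
      rw [Finset.mul_sum]
      refine Finset.sum_congr rfl fun i _ => ?_
      rw [Finset.mul_sum]
      exact Finset.sum_congr rfl fun j _ => by ring
    simpa only [e1, e2] using h
  have hL2 : ∀ n t, MemLp (fun z : T → ℝ => z t) 2 (μ n) := by
    intro n t
    obtain ⟨C, hC⟩ := hmom Unit (fun _ => t) fun _ => 1
    have h1 := (hC n).1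
    simp only [Finset.univ_unique, Finset.sum_singleton, one_mul] at h1
    have hm : Measurable fun z : T → ℝ => z t := measurable_pi_apply t
    refine (memLp_two_iff_integrable_sq hm.aestronglyMeasurable).2 ?_
    refine ((integrable_const (1 : ℝ)).add h1).mono' (hm.pow_const 2).aestronglyMeasurable
      (.of_forall fun z => ?_)
    rw [Real.norm_of_nonneg (by positivity)]
    simp only [Pi.add_apply]
    nlinarith [sq_nonneg (z t ^ 2 - 1)]
  refine ⟨hL2, fun t => ?_, fun s t => ?_⟩
  · have h := (key Unit (fun _ => t) fun _ => 1).1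
    simpa only [Finset.univ_unique, Finset.sum_singleton, one_mul] using h
  · -- polarization
    have h := ((key (Fin 2) ![s, t] ![1, 1]).2.sub (key (Fin 2) ![s, t] ![1, -1]).2).const_mul
      (1 / 4 : ℝ)
    simp only [Fin.sum_univ_two, Matrix.cons_val_zero, Matrix.cons_val_one] at h
    rw [hΓ t s, show 1 / 4 * (1 * 1 * Γ s s + 1 * 1 * Γ s t + (1 * 1 * Γ s t + 1 * 1 * Γ t t)
      - (1 * 1 * Γ s s + 1 * -1 * Γ s t + (-1 * 1 * Γ s t + -1 * -1 * Γ t t))) = Γ s t by ring] at h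
    refine h.congr fun n => ?_
    have hs := hL2 n s
    have ht := hL2 n t
    have hp : MemLp (fun z : T → ℝ => 1 * z s + 1 * z t) 2 (μ n) :=
      (hs.const_mul 1).add (ht.const_mul 1)
    have hm : MemLp (fun z : T → ℝ => 1 * z s + -1 * z t) 2 (μ n) :=
      (hs.const_mul 1).add (ht.const_mul (-1))
    rw [← integral_sub hp.integrable_sq hm.integrable_sq, ← integral_const_mul]
    refine integral_congr_ae (.of_forall fun z => ?_)
    simp only
    ring

variable [Countable T]

/-- A family of laws in a countable product whose coordinates have bounded second moments is
tight. -/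
lemma isTightMeasureSet_of_integral_sq_le {N : Type*} {μ : N → Measure (T → ℝ)}
    [∀ n, IsProbabilityMeasure (μ n)]
    (h : ∀ t, ∃ C : ℝ, ∀ n, Integrable (fun z : T → ℝ => z t ^ 2) (μ n)
      ∧ ∫ z, z t ^ 2 ∂(μ n) ≤ C) :
    IsTightMeasureSet (Set.range μ) := by
  choose C hint hC using fun t => h t
  rw [isTightMeasureSet_iff_exists_isCompact_measure_compl_le]
  intro ε hε
  obtain ⟨δ, hδ, hsum⟩ := ENNReal.exists_pos_sum_of_countable hε.ne' T
  let R : T → ℝ := fun t => Real.sqrt ((|C t| + 1) / δ t)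
  refine ⟨Set.univ.pi fun t => Set.Icc (-R t) (R t), isCompact_univ_pi fun t => isCompact_Icc, ?_⟩
  rintro _ ⟨n, rfl⟩
  have hsub : (Set.univ.pi fun t => Set.Icc (-R t) (R t))ᶜ
      ⊆ ⋃ t, {z : T → ℝ | (|C t| + 1) / δ t ≤ z t ^ 2} := by
    intro z hz
    simp only [Set.mem_compl_iff, Set.mem_pi, Set.mem_univ, true_implies, not_forall] at hz
    obtain ⟨t, ht⟩ := hz
    refine Set.mem_iUnion.2 ⟨t, ?_⟩
    rw [Set.mem_Icc, ← abs_le, not_le] at ht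
    have hpos : (0 : ℝ) ≤ (|C t| + 1) / δ t := by positivity
    rw [Set.mem_ofPred_eq, ← sq_abs, ← Real.sq_sqrt hpos]
    exact pow_le_pow_left₀ (Real.sqrt_nonneg _) ht.le 2
  refine (measure_mono hsub).trans ((measure_iUnion_le _).trans (le_trans ?_ hsum.le))
  refine ENNReal.tsum_le_tsum fun t => ?_
  have hδt : (0 : ℝ) < δ t := hδ t
  have h1 := mul_meas_ge_le_integral_of_nonneg (μ := μ n) (f := fun z : T → ℝ => z t ^ 2)
    (.of_forall fun z => by positivity) (hint t n) ((|C t| + 1) / δ t)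
  have h2 : (μ n).real {z : T → ℝ | (|C t| + 1) / δ t ≤ z t ^ 2} ≤ δ t := by
    have h3 : (|C t| + 1) / δ t * (μ n).real {z : T → ℝ | (|C t| + 1) / δ t ≤ z t ^ 2}
        ≤ (|C t| + 1) / δ t * δ t := by
      refine h1.trans ((hC t n).trans ?_)
      rw [div_mul_cancel₀ _ hδt.ne']
      linarith [le_abs_self (C t)]
    exact le_of_mul_le_mul_left h3 (by positivity)
  rw [← ENNReal.ofReal_coe_nnreal]
  exact (ENNReal.le_ofReal_iff_toReal_le (measure_ne_top _ _) hδt.le).2 h2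

/-- Convergence in law to a Gaussian family in a countable product: by Prokhorov's theorem a tight
sequence has limit points, and all of them have the Gaussian characteristic functions. -/
theorem exists_hasGaussianCharFun_tendsto {N : Type*} {l : Filter N} [l.NeBot]
    {μ : N → ProbabilityMeasure (T → ℝ)}
    (hmom : ∀ t, ∃ C : ℝ, ∀ n, Integrable (fun z : T → ℝ => z t ^ 2) (μ n : Measure (T → ℝ))
      ∧ ∫ z, z t ^ 2 ∂(μ n : Measure (T → ℝ)) ≤ C)
    (hlim : ∀ (ι : Type) [Fintype ι] (S : ι → T) (a : ι → ℝ),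
      Tendsto (fun n => ∫ z, Complex.exp ((∑ i, a i * z (S i) : ℝ) * Complex.I)
        ∂(μ n : Measure (T → ℝ))) l
        (𝓝 (Complex.exp (-(∑ i, ∑ j, a i * a j * Γ (S i) (S j) : ℝ) / 2)))) :
    ∃ ν : ProbabilityMeasure (T → ℝ), HasGaussianCharFun (ν : Measure (T → ℝ)) Γ
      ∧ Tendsto μ l (𝓝 ν) := by
  have htight : IsTightMeasureSet
      {((ρ : ProbabilityMeasure (T → ℝ)) : Measure (T → ℝ)) | ρ ∈ Set.range μ} := by
    have h1 := isTightMeasureSet_of_integral_sq_le (μ := fun n => (μ n : Measure (T → ℝ))) hmom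
    have h2 : {((ρ : ProbabilityMeasure (T → ℝ)) : Measure (T → ℝ)) | ρ ∈ Set.range μ}
        = Set.range fun n => (μ n : Measure (T → ℝ)) := by
      ext ρ
      simp
    rwa [h2]
  have hcomp := isCompact_closure_of_isTightMeasureSet htight
  have hcluster : ∀ U : Ultrafilter N, (U : Filter N) ≤ l →
      ∃ ν : ProbabilityMeasure (T → ℝ), HasGaussianCharFun (ν : Measure (T → ℝ)) Γ
        ∧ Tendsto μ U (𝓝 ν) := by
    intro U hU
    obtain ⟨ν, -, hν⟩ := isCompact_iff_ultrafilter_le_nhds.1 hcomp (U.map μ)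
      (le_principal_iff.2 (mem_of_superset
        (mem_map.2 (univ_mem' fun n => Set.mem_range_self n)) subset_closure))
    have hν' : Tendsto μ U (𝓝 ν) := hν
    refine ⟨ν, fun ι _ S a => ?_, hν'⟩
    rw [ProbabilityMeasure.tendsto_iff_forall_integral_rclike_tendsto ℂ] at hν'
    let f : BoundedContinuousFunction (T → ℝ) ℂ := BoundedContinuousFunction.ofNormedAddCommGroup
      (fun z : T → ℝ => Complex.exp ((∑ i, a i * z (S i) : ℝ) * Complex.I)) (by fun_prop) 1
      fun z => (Complex.norm_exp_ofReal_mul_I _).le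
    exact tendsto_nhds_unique (hν' f) ((hlim ι S a).mono_left hU)
  obtain ⟨ν, hν, -⟩ := hcluster (Ultrafilter.of l) (Ultrafilter.of_le l)
  refine ⟨ν, hν, (tendsto_iff_ultrafilter _ _ _).2 fun U hU => ?_⟩
  obtain ⟨ν', hν', hlim'⟩ := hcluster U hU
  have e : (ν' : Measure (T → ℝ)) = ν := hν'.ext hν
  have : ν' = ν := Subtype.ext e
  rwa [this] at hlim'

end GaussianLimit

/-! ### Subtree counts of conditioned Galton–Watson trees -/

namespace IsCriticalSequence

variable {Ω : Type*} [MeasurableSpace Ω] {P : Measure Ω} [IsProbabilityMeasure P]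
  {X : ℕ → Ω → ℕ} {σ2 : ℝ} (hX : IsCriticalSequence P X σ2)
include hX

omit [IsProbabilityMeasure P] in
lemma measure_startsWith (l : List ℕ) :
    P {ω | StartsWith (shiftSeq X 0 ω) l} = (l.map fun k => P {ω | X 0 ω = k}).prod := by
  let x : ℕ → ℕ := fun k => l.getD k 0
  have hx : StartsWith x l := fun k hk => by simp [x, hk]
  have hset : {ω | StartsWith (shiftSeq X 0 ω) l}
      = ⋂ k ∈ Finset.range l.length, X k ⁻¹' {x k} := by
    ext ω
    simp only [StartsWith, shiftSeq, zero_add, Set.mem_ofPred_eq, Set.mem_iInter, Finset.mem_range,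
      Set.mem_preimage, Set.mem_singleton_iff]
    exact forall_congr' fun k => forall_congr' fun hk => by rw [hx k hk]
  rw [hset, hX.indep.measure_inter_preimage_eq_mul _ fun k _ => measurableSet_singleton _,
    ← hx.prod_map fun k => P {ω | X 0 ω = k}]
  exact Finset.prod_congr rfl fun k _ =>
    (hX.ident k).measure_preimage_eq (measurableSet_singleton _)

omit [IsProbabilityMeasure P] in
lemma dvd_of_measure_bridgeEvent_ne_zero {d : ℕ} (hd : IsSpan P (X 0) d) {n : ℕ}
    (hn : P (bridgeEvent X n) ≠ 0) : (d : ℤ) ∣ n - 1 := by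
  by_contra h
  refine hn (measure_eq_zero_iff_ae_notMem.2 ?_)
  filter_upwards [hX.ae_dvd hd] with ω hω hmem
  refine h ?_
  have h1 : d ∣ ∑ i ∈ Finset.range n, X i ω := Finset.dvd_sum fun i _ => hω i
  rw [bridgeEvent, Set.mem_ofPred_eq] at hmem
  have h2 : ((∑ i ∈ Finset.range n, X i ω : ℕ) : ℤ) = n - 1 := by omega
  rw [← h2]
  exact_mod_cast h1

end IsCriticalSequence

lemma wrappedSum_sum_pattern {Ω ι : Type*} [Fintype ι] (X : ℕ → Ω → ℕ) (n : ℕ)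
    (q : PlaneTree → ℝ) (S : ι → PlaneTree) (a : ι → ℝ) (ω : Ω) :
    wrappedSum X n (fun x => ∑ i, a i * PlaneTree.pattern q (S i) x) ω
      = ∑ i, a i * (wrappedCount X n (S i) ω - n * q (S i)) := by
  rw [wrappedSum, Finset.sum_comm]
  refine Finset.sum_congr rfl fun i _ => ?_
  rw [← Finset.mul_sum]
  simp only [PlaneTree.pattern, Finset.sum_sub_distrib, Finset.sum_const, Finset.card_range,
    nsmul_eq_mul]
  rw [wrappedCount, Finset.card_filter]
  push_cast
  rfl

section

variable {Ω : Type*} [MeasurableSpace Ω] {P : Measure Ω} [IsProbabilityMeasure P]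
  {ξ : List ℕ → Ω → ℕ} {σ2 : ℝ}

/-- The law of the family of normalized subtree counts of the conditioned Galton–Watson tree. -/
noncomputable def normalizedLaw (P : Measure Ω) (ξ : List ℕ → Ω → ℕ) (n : AdmissibleSize P ξ) :
    Measure (PlaneTree → ℝ) :=
  (condGW P ξ n).map fun ω T =>
    (gwCount ξ T ω - (n.val : ℝ) * gwProb P ξ T) / Real.sqrt (n.val : ℝ)

variable (hmeas : ∀ u, Measurable (ξ u))
include hmeas

omit [IsProbabilityMeasure P] in
lemma measurable_normalized (n : AdmissibleSize P ξ) : Measurable fun ω T =>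
    (gwCount ξ T ω - (n.val : ℝ) * gwProb P ξ T) / Real.sqrt (n.val : ℝ) :=
  measurable_pi_lambda _ fun T => ((measurable_gwCount hmeas T).sub_const _).div_const _

lemma isProbabilityMeasure_normalizedLaw (n : AdmissibleSize P ξ) :
    IsProbabilityMeasure (normalizedLaw P ξ n) :=
  Measure.isProbabilityMeasure_map (measurable_normalized hmeas n).aemeasurable

variable (hindep : iIndepFun ξ P) (hident : ∀ u, IdentDistrib (ξ u) (ξ []) P P)
include hindep hident

omit [IsProbabilityMeasure P] in
lemma isCriticalSequence_spine (hL2 : MemLp (fun ω => (ξ [] ω : ℝ)) 2 P)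
    (hmean : ∫ ω, (ξ [] ω : ℝ) ∂P = 1) (hσ2 : σ2 = variance (fun ω => (ξ [] ω : ℝ)) P)
    (hpos : 0 < σ2) : IsCriticalSequence P (spine ξ) σ2 where
  measurable _ := hmeas _
  indep := iIndepFun_spine hindep
  ident _ := hident _
  memLp := hL2
  mean := hmean
  variance_eq := hσ2.symm
  pos := hpos

omit [IsProbabilityMeasure P] in
lemma normalizedLaw_eq (n : AdmissibleSize P ξ) :
    normalizedLaw P ξ n = (cond P (bridgeEvent (spine ξ) n.val)).map fun ω T =>
      ((wrappedCount (spine ξ) n.val T ω : ℝ) - (n.val : ℝ) * gwProb P ξ T)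
        / Real.sqrt (n.val : ℝ) := by
  have hg : Measurable fun (z : PlaneTree → ℝ) T =>
      (z T - (n.val : ℝ) * gwProb P ξ T) / Real.sqrt (n.val : ℝ) :=
    measurable_pi_lambda _ fun T => ((measurable_pi_apply T).sub_const _).div_const _
  have h1 : Measurable fun ω S => gwCount ξ S ω :=
    measurable_pi_lambda _ fun S => measurable_gwCount hmeas S
  have h2 : Measurable fun ω S => (wrappedCount (spine ξ) n.val S ω : ℝ) :=
    measurable_pi_lambda _ fun S => (measurable_from_top (f := fun k : ℕ => (k : ℝ))).comp
      (measurable_wrappedCount (fun i => hmeas _) n.val S)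
  have h := congrArg (Measure.map fun (z : PlaneTree → ℝ) T =>
      (z T - (n.val : ℝ) * gwProb P ξ T) / Real.sqrt (n.val : ℝ))
    (map_gwCount_condGW hmeas hindep hident n)
  rwa [Measure.map_map hg h1, Measure.map_map hg h2] at h

omit [IsProbabilityMeasure P] hmeas in
lemma gwProb_eq (hX : IsCriticalSequence P (spine ξ) σ2) (S : PlaneTree) :
    gwProb P ξ S = P.real {ω | StartsWith (shiftSeq (spine ξ) 0 ω) S.word} := by
  rw [gwProb, Measure.real, Measure.real, measure_gwTree_eq hindep hident,
    hX.measure_startsWith]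
  rfl

omit [IsProbabilityMeasure P] hmeas hindep hident in
lemma AdmissibleSize.pos (n : AdmissibleSize P ξ) : 0 < n.val :=
  Nat.pos_of_ne_zero fun h => n.property (by rw [h, gwSizeEvent_zero, measure_empty])

omit [IsProbabilityMeasure P] in
lemma tendsto_val_latticeAtTop (hX : IsCriticalSequence P (spine ξ) σ2) {d : ℕ}
    (hd : IsSpan P (spine ξ 0) d) :
    Tendsto (fun n : AdmissibleSize P ξ => n.val) (admissibleAtTop P ξ) (latticeAtTop d) := by
  refine tendsto_inf.2 ⟨tendsto_comap, tendsto_principal.2 (.of_forall fun n => ?_)⟩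
  refine hX.dvd_of_measure_bridgeEvent_ne_zero hd ?_
  rw [← mul_measure_gwSizeEvent hmeas hindep hident]
  exact mul_ne_zero (by exact_mod_cast (AdmissibleSize.pos n).ne') n.property

lemma admissibleAtTop_neBot (hX : IsCriticalSequence P (spine ξ) σ2) :
    (admissibleAtTop P ξ).NeBot := by
  obtain ⟨d, hd⟩ := hX.exists_isSpan
  have := latticeAtTop_neBot hd.pos
  have h := ((hX.eventually_measure_bridgeEvent_ne_zero hd).frequently).filter_mono
    (latticeAtTop_le d)
  refine comap_neBot_iff_frequently.2 (h.mono fun n hn => ?_)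
  rw [← mul_measure_gwSizeEvent hmeas hindep hident] at hn
  exact ⟨⟨n, right_ne_zero_of_mul hn⟩, rfl⟩

omit [IsProbabilityMeasure P] in
/-- Linear combinations of normalized subtree counts are normalized cyclic sums of tree
patterns. -/
lemma integral_normalizedLaw {E : Type*} [NormedAddCommGroup E] [NormedSpace ℝ E] {ι : Type*}
    [Fintype ι] (S : ι → PlaneTree) (a : ι → ℝ) {g : ℝ → E} (hg : Continuous g)
    [SecondCountableTopology E] (n : AdmissibleSize P ξ) :
    ∫ z, g (∑ i, a i * z (S i)) ∂(normalizedLaw P ξ n)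
      = ∫ ω, g ((Real.sqrt (n.val : ℝ))⁻¹ * wrappedSum (spine ξ) n.val
          (fun x => ∑ i, a i * PlaneTree.pattern (gwProb P ξ) (S i) x) ω)
          ∂(cond P (bridgeEvent (spine ξ) n.val)) := by
  have hm : Measurable fun ω T =>
      ((wrappedCount (spine ξ) n.val T ω : ℝ) - (n.val : ℝ) * gwProb P ξ T)
        / Real.sqrt (n.val : ℝ) :=
    measurable_pi_lambda _ fun T => (((measurable_from_top (f := fun k : ℕ => (k : ℝ))).comp
      (measurable_wrappedCount (fun i => hmeas _) n.val T)).sub_const _).div_const _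
  have hgm : Measurable fun z : PlaneTree → ℝ => ∑ i, a i * z (S i) := by fun_prop
  have hgs : AEStronglyMeasurable (fun z : PlaneTree → ℝ => g (∑ i, a i * z (S i)))
      ((cond P (bridgeEvent (spine ξ) n.val)).map fun ω T =>
        ((wrappedCount (spine ξ) n.val T ω : ℝ) - (n.val : ℝ) * gwProb P ξ T)
          / Real.sqrt (n.val : ℝ)) :=
    (hg.stronglyMeasurable.comp_measurable hgm).aestronglyMeasurable
  rw [normalizedLaw_eq hmeas hindep hident, integral_map hm.aemeasurable hgs]
  refine integral_congr_ae (.of_forall fun ω => congrArg g ?_)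
  rw [wrappedSum_sum_pattern, Finset.mul_sum]
  exact Finset.sum_congr rfl fun i _ => by ring

lemma tendsto_integral_exp_normalizedLaw (hX : IsCriticalSequence P (spine ξ) σ2) {ι : Type*}
    [Fintype ι] (S : ι → PlaneTree) (a : ι → ℝ) :
    Tendsto (fun n => ∫ z, Complex.exp ((∑ i, a i * z (S i) : ℝ) * Complex.I)
        ∂(normalizedLaw P ξ n)) (admissibleAtTop P ξ)
      (𝓝 (Complex.exp
        (-(∑ i, ∑ j, a i * a j * gwGamma (gwProb P ξ) σ2 (S i) (S j) : ℝ) / 2))) := by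
  obtain ⟨d, hd⟩ := hX.exists_isSpan
  have hq := gwProb_eq hindep hident hX
  have hF := hX.isCenteredLocal_sum_pattern hq S a
  have h := (hX.tendsto_integral_exp_wrappedSum_cond hd hF
    (hF.tendsto_integral_blockSum_sq_div hX.measurable hX.indep hX.ident)).comp
      (tendsto_val_latticeAtTop hmeas hindep hident hX hd)
  rw [hX.asymptotic_variance_sum_pattern hq S a] at h
  refine h.congr fun n => ?_
  exact (integral_normalizedLaw hmeas hindep hident S a
    (g := fun x => Complex.exp ((x : ℂ) * Complex.I)) (by fun_prop) n).symm

lemma exists_integral_normalizedLaw_pow_four_le (hX : IsCriticalSequence P (spine ξ) σ2)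
    {ι : Type*} [Fintype ι] (S : ι → PlaneTree) (a : ι → ℝ) :
    ∃ C : ℝ, ∀ n, Integrable (fun z => (∑ i, a i * z (S i)) ^ 4) (normalizedLaw P ξ n)
      ∧ ∫ z, (∑ i, a i * z (S i)) ^ 4 ∂(normalizedLaw P ξ n) ≤ C := by
  obtain ⟨d, hd⟩ := hX.exists_isSpan
  have hq := gwProb_eq hindep hident hX
  have hF := hX.isCenteredLocal_sum_pattern hq S a
  obtain ⟨C, hC, hev⟩ := hX.exists_integral_wrappedSum_pow_four_le hd hF
  set F : (ℕ → ℕ) → ℝ := fun x => ∑ i, a i * PlaneTree.pattern (gwProb P ξ) (S i) x with hFdef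
  set M := ∑ i, |a i| + 1 with hM
  have hev' := (tendsto_val_latticeAtTop hmeas hindep hident hX hd).eventually hev
  obtain ⟨N, hN⟩ : ∃ N : ℕ, ∀ n : AdmissibleSize P ξ, N ≤ n.val →
      ∫ ω, ((Real.sqrt (n.val : ℝ))⁻¹ * wrappedSum (spine ξ) n.val F ω) ^ 4
        ∂(cond P (bridgeEvent (spine ξ) n.val)) ≤ C := by
    obtain ⟨t, ht, hsub⟩ := mem_comap.1 hev'
    obtain ⟨N, hN⟩ := mem_atTop_sets.1 ht
    exact ⟨N, fun n hn => hsub (hN n.val hn)⟩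
  have hbound : ∀ (n : AdmissibleSize P ξ) ω,
      ((Real.sqrt (n.val : ℝ))⁻¹ * wrappedSum (spine ξ) n.val F ω) ^ 4
        ≤ ((n.val : ℝ) * M) ^ 4 := by
    intro n ω
    have hn : (1 : ℝ) ≤ n.val := by exact_mod_cast AdmissibleSize.pos n
    have h1 : |wrappedSum (spine ξ) n.val F ω| ≤ n.val * M := by
      refine (Finset.abs_sum_le_sum_abs _ _).trans
        ((Finset.sum_le_sum fun i _ => hF.bound _).trans ?_)
      rw [Finset.sum_const, Finset.card_range, nsmul_eq_mul]
    have h2 : |(Real.sqrt (n.val : ℝ))⁻¹ * wrappedSum (spine ξ) n.val F ω| ≤ n.val * M := by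
      rw [abs_mul, abs_of_nonneg (by positivity)]
      exact (mul_le_of_le_one_left (abs_nonneg _)
        (inv_le_one_of_one_le₀ (Real.one_le_sqrt.2 hn))).trans h1
    have h3 := pow_le_pow_left₀ (abs_nonneg _) h2 4
    rwa [← abs_pow, abs_of_nonneg (by positivity)] at h3
  have hcond : ∀ n : AdmissibleSize P ξ,
      IsProbabilityMeasure (cond P (bridgeEvent (spine ξ) n.val)) := fun n =>
    cond_isProbabilityMeasure (by
      rw [← mul_measure_gwSizeEvent hmeas hindep hident]
      exact mul_ne_zero (by exact_mod_cast (AdmissibleSize.pos n).ne') n.property)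
  have hWm : ∀ n : AdmissibleSize P ξ, Measurable fun ω =>
      ((Real.sqrt (n.val : ℝ))⁻¹ * wrappedSum (spine ξ) n.val F ω) ^ 4 := fun n =>
    ((hF.measurable_wrappedSum hX.measurable n.val).const_mul _).pow_const 4
  have hint : ∀ n : AdmissibleSize P ξ, Integrable (fun ω =>
      ((Real.sqrt (n.val : ℝ))⁻¹ * wrappedSum (spine ξ) n.val F ω) ^ 4)
      (cond P (bridgeEvent (spine ξ) n.val)) := fun n =>
    Integrable.of_bound (hWm n).aestronglyMeasurable (((n.val : ℝ) * M) ^ 4)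
      (.of_forall fun ω => by
        rw [Real.norm_of_nonneg (by positivity)]
        exact hbound n ω)
  refine ⟨C + (N * M) ^ 4, fun n => ⟨?_, ?_⟩⟩
  · have hm : Measurable fun ω T =>
        ((wrappedCount (spine ξ) n.val T ω : ℝ) - (n.val : ℝ) * gwProb P ξ T)
          / Real.sqrt (n.val : ℝ) :=
      measurable_pi_lambda _ fun T => (((measurable_from_top (f := fun k : ℕ => (k : ℝ))).comp
        (measurable_wrappedCount (fun i => hmeas _) n.val T)).sub_const _).div_const _
    have hgm : Measurable fun z : PlaneTree → ℝ => ∑ i, a i * z (S i) := by fun_prop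
    rw [normalizedLaw_eq hmeas hindep hident,
      integrable_map_measure (hgm.pow_const 4).aestronglyMeasurable hm.aemeasurable]
    refine (hint n).congr (.of_forall fun ω => congrArg (· ^ 4) ?_)
    rw [wrappedSum_sum_pattern, Finset.mul_sum]
    exact Finset.sum_congr rfl fun i _ => by ring
  · rw [integral_normalizedLaw hmeas hindep hident S a (g := fun x => x ^ 4) (by fun_prop) n]
    rcases le_or_gt N n.val with h | h
    · have := hN n h
      have h2 : 0 ≤ (N * M) ^ 4 := by positivity
      linarith
    · have hM0 : 0 ≤ M := by positivity
      have h1 := integral_mono (hint n) (integrable_const _) (hbound n)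
      rw [integral_const, probReal_univ, one_smul] at h1
      have h2 : ((n.val : ℝ) * M) ^ 4 ≤ (N * M) ^ 4 := by
        refine pow_le_pow_left₀ (by positivity) (mul_le_mul_of_nonneg_right ?_ hM0) 4
        exact_mod_cast h.le
      linarith

end

section

variable {Ω : Type*} [MeasurableSpace Ω] {P : Measure Ω} [IsProbabilityMeasure P]
  {ξ : List ℕ → Ω → ℕ} (hmeas : ∀ u, Measurable (ξ u))
include hmeas

lemma integral_gwCount_eq (n : AdmissibleSize P ξ) (T : PlaneTree)
    (hint : MemLp (fun z : PlaneTree → ℝ => z T) 2 (normalizedLaw P ξ n)) :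
    ∫ ω, gwCount ξ T ω ∂(condGW P ξ n) - (n.val : ℝ) * gwProb P ξ T
      = Real.sqrt (n.val : ℝ) * ∫ z, z T ∂(normalizedLaw P ξ n) := by
  have hm := measurable_normalized (P := P) hmeas n
  have hs : Real.sqrt (n.val : ℝ) ≠ 0 :=
    (Real.sqrt_pos.2 (by exact_mod_cast AdmissibleSize.pos n)).ne'
  have hT : AEStronglyMeasurable (fun z : PlaneTree → ℝ => z T) (normalizedLaw P ξ n) :=
    (measurable_pi_apply T).aestronglyMeasurable
  have hi := (memLp_map_measure_iff hT hm.aemeasurable).1 hint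
  have hi' : Integrable (fun ω => (gwCount ξ T ω - (n.val : ℝ) * gwProb P ξ T)
      / Real.sqrt (n.val : ℝ)) (condGW P ξ n) := hi.integrable one_le_two
  rw [normalizedLaw, integral_map hm.aemeasurable hT, ← integral_const_mul]
  have h1 : ∀ ω, gwCount ξ T ω = Real.sqrt (n.val : ℝ) * ((gwCount ξ T ω
      - (n.val : ℝ) * gwProb P ξ T) / Real.sqrt (n.val : ℝ)) + (n.val : ℝ) * gwProb P ξ T :=
    fun ω => by
      rw [mul_div_cancel₀ _ hs]
      ring
  rw [integral_congr_ae (.of_forall h1), integral_add (hi'.const_mul _) (integrable_const _)]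
  simp

lemma covariance_gwCount_eq (n : AdmissibleSize P ξ) (S T : PlaneTree)
    (hS : MemLp (fun z : PlaneTree → ℝ => z S) 2 (normalizedLaw P ξ n))
    (hT : MemLp (fun z : PlaneTree → ℝ => z T) 2 (normalizedLaw P ξ n)) :
    covariance (gwCount ξ S) (gwCount ξ T) (condGW P ξ n)
      = n.val * (∫ z, z S * z T ∂(normalizedLaw P ξ n)
        - (∫ z, z S ∂(normalizedLaw P ξ n)) * ∫ z, z T ∂(normalizedLaw P ξ n)) := by
  have := isProbabilityMeasure_normalizedLaw (P := P) hmeas n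
  have hm := measurable_normalized (P := P) hmeas n
  have hs : Real.sqrt (n.val : ℝ) ≠ 0 :=
    (Real.sqrt_pos.2 (by exact_mod_cast AdmissibleSize.pos n)).ne'
  have hc : ∀ T : PlaneTree,
      AEStronglyMeasurable (fun z : PlaneTree → ℝ => z T) (normalizedLaw P ξ n) := fun T =>
    (measurable_pi_apply T).aestronglyMeasurable
  have h1 : ∀ T : PlaneTree, gwCount ξ T = fun ω => Real.sqrt (n.val : ℝ) * ((gwCount ξ T ω
      - (n.val : ℝ) * gwProb P ξ T) / Real.sqrt (n.val : ℝ)) + (n.val : ℝ) * gwProb P ξ T :=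
    fun T => funext fun ω => by
      rw [mul_div_cancel₀ _ hs]
      ring
  have hint : ∀ T : PlaneTree, MemLp (fun z : PlaneTree → ℝ => z T) 2 (normalizedLaw P ξ n) →
      Integrable (fun ω => Real.sqrt (n.val : ℝ) * ((gwCount ξ T ω
        - (n.val : ℝ) * gwProb P ξ T) / Real.sqrt (n.val : ℝ))) (condGW P ξ n) := fun T hT =>
    (((memLp_map_measure_iff (hc T) hm.aemeasurable).1 hT).integrable one_le_two).const_mul _
  have h2 := covariance_map_fun (hc S) (hc T) hm.aemeasurable
  have h3 := covariance_eq_sub hS hT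
  have h4 : ∀ c d e f : Ω → ℝ, c = d → e = f →
      covariance c e (condGW P ξ n) = covariance d f (condGW P ξ n) := by
    rintro _ _ _ _ rfl rfl
    rfl
  rw [h4 _ _ _ _ (h1 S) (h1 T), covariance_add_const_left (hint S hS),
    covariance_add_const_right (hint T hT), covariance_const_mul_left, covariance_const_mul_right,
    ← mul_assoc, Real.mul_self_sqrt (by positivity)]
  exact congrArg _ (h2.symm.trans h3)

end

theorem corollary1p3 {Ω : Type*} [MeasurableSpace Ω] (P : Measure Ω) [IsProbabilityMeasure P]
    (ξ : List ℕ → Ω → ℕ) (hmeas : ∀ u, Measurable (ξ u)) (hindep : iIndepFun ξ P)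
    (hident : ∀ u, IdentDistrib (ξ u) (ξ []) P P)
    (hL2 : MemLp (fun ω => (ξ [] ω : ℝ)) 2 P)
    (hmean : ∫ ω, (ξ [] ω : ℝ) ∂P = 1)
    (σ2 : ℝ) (hσ2 : σ2 = variance (fun ω => (ξ [] ω : ℝ)) P) (hpos : 0 < σ2) :
    -- there are arbitrarily large admissible sizes
    (admissibleAtTop P ξ).NeBot ∧
    -- expectations
    (∀ T : PlaneTree,
      (fun n : AdmissibleSize P ξ =>
          ∫ ω, gwCount ξ T ω ∂(condGW P ξ n) - (n.val : ℝ) * gwProb P ξ T)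
        =o[admissibleAtTop P ξ] fun n => Real.sqrt (n.val : ℝ)) ∧
    -- variances
    (∀ T : PlaneTree,
      (fun n : AdmissibleSize P ξ =>
          variance (gwCount ξ T) (condGW P ξ n) - (n.val : ℝ) * gwGamma (gwProb P ξ) σ2 T T)
        =o[admissibleAtTop P ξ] fun n => (n.val : ℝ)) ∧
    -- covariances
    (∀ T₁ T₂ : PlaneTree,
      (fun n : AdmissibleSize P ξ =>
          covariance (gwCount ξ T₁) (gwCount ξ T₂) (condGW P ξ n)
            - (n.val : ℝ) * gwGamma (gwProb P ξ) σ2 T₁ T₂)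
        =o[admissibleAtTop P ξ] fun n => (n.val : ℝ)) ∧
    -- joint convergence in distribution, in the product space of all trees, to a centred Gaussian
    -- family with covariances `γ`
    (∃ (ν : Measure (PlaneTree → ℝ)) (_ : IsProbabilityMeasure ν),
      IsGaussianProcess (fun (T : PlaneTree) (z : PlaneTree → ℝ) => z T) ν ∧
      (∀ T : PlaneTree, ∫ z, z T ∂ν = 0) ∧
      (∀ T₁ T₂ : PlaneTree,
        covariance (fun z : PlaneTree → ℝ => z T₁) (fun z => z T₂) ν
          = gwGamma (gwProb P ξ) σ2 T₁ T₂) ∧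
      TendstoInDistribution
        (fun (n : AdmissibleSize P ξ) (ω : Ω) (T : PlaneTree) =>
          (gwCount ξ T ω - (n.val : ℝ) * gwProb P ξ T) / Real.sqrt (n.val : ℝ))
        (admissibleAtTop P ξ) (fun z : PlaneTree → ℝ => z) (fun n => condGW P ξ n) ν) := by
  have hX := isCriticalSequence_spine hmeas hindep hident hL2 hmean hσ2 hpos
  have hne := admissibleAtTop_neBot hmeas hindep hident hX
  have hprob := isProbabilityMeasure_normalizedLaw (P := P) hmeas
  have hΓ := gwGamma_comm (gwProb P ξ) σ2
  obtain ⟨hL2', hmean', hcov'⟩ := tendsto_moments_coord (μ := normalizedLaw P ξ) hΓ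
    (fun ι _ S a => exists_integral_normalizedLaw_pow_four_le hmeas hindep hident hX S a)
    (fun ι _ S a => tendsto_integral_exp_normalizedLaw hmeas hindep hident hX S a)
  have hcov : ∀ T₁ T₂ : PlaneTree,
      (fun n : AdmissibleSize P ξ =>
          covariance (gwCount ξ T₁) (gwCount ξ T₂) (condGW P ξ n)
            - (n.val : ℝ) * gwGamma (gwProb P ξ) σ2 T₁ T₂)
        =o[admissibleAtTop P ξ] fun n => (n.val : ℝ) := by
    intro T₁ T₂
    have h1 := ((hcov' T₁ T₂).sub ((hmean' T₁).mul (hmean' T₂))).sub_const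
      (gwGamma (gwProb P ξ) σ2 T₁ T₂)
    rw [mul_zero, sub_zero, sub_self] at h1
    have h2 := (isBigO_refl (fun n : AdmissibleSize P ξ => (n.val : ℝ)) _).mul_isLittleO
      ((isLittleO_one_iff ℝ).2 h1)
    refine (h2.congr (fun n => ?_) fun n => mul_one _)
    rw [covariance_gwCount_eq hmeas n T₁ T₂ (hL2' n T₁) (hL2' n T₂)]
    ring
  refine ⟨hne, fun T => ?_, fun T => ?_, hcov, ?_⟩
  · have h2 := (isBigO_refl (fun n : AdmissibleSize P ξ => Real.sqrt (n.val : ℝ)) _).mul_isLittleO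
      ((isLittleO_one_iff ℝ).2 (hmean' T))
    refine (h2.congr (fun n => ?_) fun n => mul_one _)
    rw [integral_gwCount_eq hmeas n T (hL2' n T)]
  · refine (hcov T T).congr_left fun n => ?_
    rw [covariance_self (measurable_gwCount hmeas T).aemeasurable]
  · obtain ⟨ν, hν, hlim⟩ := exists_hasGaussianCharFun_tendsto
      (Γ := gwGamma (gwProb P ξ) σ2) (μ := fun n => ⟨normalizedLaw P ξ n, hprob n⟩)
      (l := admissibleAtTop P ξ) (fun T => by
        obtain ⟨C, hC⟩ := exists_integral_normalizedLaw_pow_four_le hmeas hindep hident hX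
          (fun _ : Unit => T) fun _ => 1
        simp only [Finset.univ_unique, Finset.sum_const, Finset.card_singleton, one_smul,
          one_mul] at hC
        refine ⟨1 + C, fun n => ⟨(hL2' n T).integrable_sq, ?_⟩⟩
        have h1 := integral_mono (hL2' n T).integrable_sq ((integrable_const (1 : ℝ)).add (hC n).1)
          fun z => (by
            have := sq_nonneg (z T ^ 2 - 1)
            have := sq_nonneg (z T)
            simp only [Pi.add_apply]
            nlinarith)
        rw [integral_add' (integrable_const (1 : ℝ)) (hC n).1, integral_const, probReal_univ,
          one_smul] at h1
        exact h1.trans (by linarith [(hC n).2]))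
      (fun ι _ S a => tendsto_integral_exp_normalizedLaw hmeas hindep hident hX S a)
    refine ⟨ν, inferInstance, hν.isGaussianProcess, hν.integral_coord,
      fun T₁ T₂ => hν.covariance_coord hΓ T₁ T₂,
      fun n => (measurable_normalized hmeas n).aemeasurable, aemeasurable_id, ?_⟩
    have e : (⟨(ν : Measure (PlaneTree → ℝ)).map fun z => z,
        Measure.isProbabilityMeasure_map aemeasurable_id⟩ : ProbabilityMeasure (PlaneTree → ℝ))
        = ν := Subtype.ext Measure.map_id'
    rw [e]
    exact hlim
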